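/- Let $M$ be a connected smooth $7$-manifold with a torsion-free (i.e. closed and co-closed) $G_2$-structure $\varphi$, with induced metric $g$ and dual $4$-form ${*}\varphi$. Let $T^3=(S^1)^3$ act smoothly and effectively on $M$ preserving $\varphi$, let $U_1,U_2,U_3$ be the vector fields generated by the standard circle factors, and suppose that the action is multi-Hamiltonian for both $\varphi$ and ${*}\varphi$: there are smooth $T^3$-invariant maps $\nu=(\nu_1,\nu_2,\nu_3)\colon M\to\mathbb R^3$ and $\mu\colon M\to\mathbb R$ with $d\nu_i=\varphi(U_j,U_k,\cdot)$ for $(ijk)$ cyclic permutations of $(123)$, and $d\mu={*}\varphi(U_1,U_2,U_3,\cdot)$. Let $M_0\subset M$ be the set of points at which the infinitesimal action $\xi_p\colon\mathbb R^3\to T_pM$ is injective, and let $B_p=(g_p(U_i,U_j))_{i,j}$. Let $S\subset M/T^3$ be the image of $M\setminus M_0$, and let $W\subset S$ be the image of the set of points whose stabiliser is two-dimensional. Denote the maps induced by $\nu,\mu$ on $M/T^3$ by the same letters. Then: 1. $\operatorname{rank} B_p\leqslant 2$ for every $p\in M\setminus M_0$. 2. $S$ is a closed subset of $M/T^3$ and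 is a trivalent graph (possibly empty, disconnected or infinite, and with edges possibly unbounded or lacking end points) with vertex set $W$. That is, $W$ is closed; each edge, i.e. each connected component of $S\setminus W$, is open in $S$ and homeomorphic to $\mathbb R$; and each $w\in W$ has an open neighbourhood $N$ in $M/T^3$ containing no other element of $W$ such that $N\cap S$ is homeomorphic to three half-open intervals glued at their end point, with $w$ corresponding to that end point. 3. The function $\mu$ is constant on each connected component of $S$. 4. Each edge is a straight line of rational slope in the $\nu$-coordinates: for each edge $e$ there are $a\in\mathbb R^3$, a primitive vector $v\in\mathbb Z^3$ and a non-empty open interval $J\subset\mathbb R$ such that $\nu$ maps $e$ homeomorphically onto $\{a+tv : t\in J\}$. 5. For each vertex $w\in W$ there are exactly three edges $e_1,e_2,e_3$ whose closure contains $w$, and there are primitive vectors $v_1,v_2,v_3\in\mathbb Z^3$ with $v_1+v_2+v_3=0$ such that, for each $i$, $\nu$ maps $e_i$ homeomorphically onto $\{\nu(w)+tv_i : 0<t<L_i\}$ for some $L_i\in(0,\infty]$. In particular $\nu(e_1),\nu(e_2),\nu(e_3)$ lie in a common plane in $\mathbb R^3$. -/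

import Mathlib

open scoped Manifold ContDiff Topology

namespace ToricG2

noncomputable section

/-! ### Linear algebra of `G₂`-forms -/

/-- The constant form `e^{i₁} ∧ ⋯ ∧ e^{iₖ}` on `ℝ⁷` (indices counted from `0`), with
`(e^{i₁} ∧ ⋯ ∧ e^{iₖ})(X₁, …, Xₖ) = det (e^{i_b}(X_a))`. -/
def coordForm {k : ℕ} (I : Fin k → Fin 7) : (Fin 7 → ℝ) [⋀^Fin k]→L[ℝ] ℝ where
  __ := (Matrix.detRowAlternating (R := ℝ) (n := Fin k)).compLinearMap (LinearMap.funLeft ℝ ℝ I)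
  cont := by
    change Continuous fun X : Fin k → Fin 7 → ℝ =>
      Matrix.det (fun a b => X a (I b) : Matrix (Fin k) (Fin k) ℝ)
    apply Continuous.matrix_det
    fun_prop

theorem coordForm_apply {k : ℕ} (I : Fin k → Fin 7) (X : Fin k → Fin 7 → ℝ) :
    coordForm I X = Matrix.det (Matrix.of fun a b => X a (I b)) := rfl

/-- `φ₀ = e^{123} - e^1(e^{45}+e^{67}) - e^2(e^{46}+e^{75}) - e^3(e^{47}+e^{56})`. -/
def phi0 : (Fin 7 → ℝ) [⋀^Fin 3]→L[ℝ] ℝ :=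
  coordForm ![0, 1, 2]
    - (coordForm ![0, 3, 4] + coordForm ![0, 5, 6])
    - (coordForm ![1, 3, 5] + coordForm ![1, 6, 4])
    - (coordForm ![2, 3, 6] + coordForm ![2, 4, 5])

/-- `*φ₀ = e^{4567} - e^{23}(e^{45}+e^{67}) - e^{31}(e^{46}+e^{75}) - e^{12}(e^{47}+e^{56})`. -/
def starPhi0 : (Fin 7 → ℝ) [⋀^Fin 4]→L[ℝ] ℝ :=
  coordForm ![3, 4, 5, 6]
    - (coordForm ![1, 2, 3, 4] + coordForm ![1, 2, 5, 6])
    - (coordForm ![2, 0, 3, 5] + coordForm ![2, 0, 6, 4])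
    - (coordForm ![0, 1, 3, 6] + coordForm ![0, 1, 4, 5])

section Linear

variable {V : Type*} [AddCommGroup V] [Module ℝ V] [TopologicalSpace V]

/-- `f = (e^1, …, e^7)` is the dual basis of an adapted basis for `φ`. -/
def IsAdaptedCoframe (φ : V [⋀^Fin 3]→L[ℝ] ℝ) (f : V ≃L[ℝ] (Fin 7 → ℝ)) : Prop :=
  φ = phi0.compContinuousLinearMap (f : V →L[ℝ] (Fin 7 → ℝ))

/-- `φ` is linearly equivalent to `φ₀`. -/
def IsG2Form (φ : V [⋀^Fin 3]→L[ℝ] ℝ) : Prop :=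
  ∃ f : V ≃L[ℝ] (Fin 7 → ℝ), IsAdaptedCoframe φ f

open Classical in
/-- The inner product `∑ (e^j)²` determined by `φ`. It does not depend on the adapted coframe
that is used, because the stabiliser of `φ₀` is contained in `SO(7)`. -/
def metricOf (φ : V [⋀^Fin 3]→L[ℝ] ℝ) (X Y : V) : ℝ :=
  if h : IsG2Form φ then h.choose X ⬝ᵥ h.choose Y else 0

open Classical in
/-- The dual four-form `*φ` determined by `φ`. It does not depend on the adapted coframe
that is used, because the stabiliser of `φ₀` is contained in `SO(7)`. -/
def starOf (φ : V [⋀^Fin 3]→L[ℝ] ℝ) : V [⋀^Fin 4]→L[ℝ] ℝ :=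
  if h : IsG2Form φ then
    starPhi0.compContinuousLinearMap (h.choose : V →L[ℝ] (Fin 7 → ℝ)) else 0

end Linear

/-! ### Differential forms on seven-manifolds -/

/-- The model space `ℝ⁷`. -/
abbrev E7 : Type := EuclideanSpace ℝ (Fin 7)

/-- (Not necessarily smooth) differential `k`-forms on a seven-manifold. -/
abbrev Form (k : ℕ) (M : Type*) [TopologicalSpace M] [ChartedSpace E7 M] : Type _ :=
  ∀ p : M, TangentSpace (𝓡 7) p [⋀^Fin k]→L[ℝ] ℝ

section Forms

variable {M : Type*} [TopologicalSpace M] [ChartedSpace E7 M] {k : ℕ}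

/-- The expression of a form in the preferred chart at `x`: its pull-back under the inverse of
the chart, meaningful on the target of the chart. -/
def Form.inChart (α : Form k M) (x : M) (y : E7) : E7 [⋀^Fin k]→L[ℝ] ℝ :=
  (α ((extChartAt (𝓡 7) x).symm y)).compContinuousLinearMap
    (mfderiv 𝓘(ℝ, E7) (𝓡 7) (extChartAt (𝓡 7) x).symm y)

/-- Smoothness of a form, in charts. -/
def Form.IsSmooth (α : Form k M) : Prop :=
  ∀ x : M, ContDiffOn ℝ ∞ (Form.inChart α x) (extChartAt (𝓡 7) x).target

/-- `dα = 0`, in charts. -/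
def Form.IsClosed (α : Form k M) : Prop :=
  ∀ x : M, ∀ y ∈ (extChartAt (𝓡 7) x).target, extDeriv (Form.inChart α x) y = 0

/-- The Hodge dual four-form `*φ` of a `G₂`-structure `φ`. -/
def starForm (φ : Form 3 M) : Form 4 M := fun p => starOf (φ p)

end Forms

/-! ### Torus actions -/

/-- The torus `T³ = S¹ × S¹ × S¹`. -/
abbrev Torus3 : Type := Fin 3 → Circle

/-- The exponential map `𝔱³ = ℝ³ → T³`, `(t₁,t₂,t₃) ↦ (e^{it₁}, e^{it₂}, e^{it₃})`. -/
def expT (t : Fin 3 → ℝ) : Torus3 := fun i => Circle.exp (t i)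

section Action

variable {M : Type*} [TopologicalSpace M] [ChartedSpace E7 M] [MulAction Torus3 M]

variable (M) in
/-- The action map `T³ × M → M` is smooth. As `expT` is a surjective local diffeomorphism, this
is smoothness of `(t, p) ↦ expT t • p`. -/
def IsSmoothAction : Prop :=
  ContMDiff (𝓘(ℝ, Fin 3 → ℝ).prod (𝓡 7)) (𝓡 7) ∞
    (fun x : (Fin 3 → ℝ) × M => expT x.1 • x.2)

/-- The infinitesimal action `ξ_p : 𝔱³ → T_pM`, the derivative of `t ↦ expT t • p` at `0`. -/
def infAct (p : M) : (Fin 3 → ℝ) →L[ℝ] TangentSpace (𝓡 7) p :=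
  mfderiv 𝓘(ℝ, Fin 3 → ℝ) (𝓡 7) (fun t : Fin 3 → ℝ => expT t • p) 0

/-- The generating vector fields `U₁, U₂, U₃`. -/
def gen (i : Fin 3) (p : M) : TangentSpace (𝓡 7) p := infAct p (Pi.single i 1)

variable (M) in
/-- The set `M₀` of points at which `ξ` is injective. -/
def regularSet : Set M := {p | Function.Injective (infAct p)}

/-- The matrix `B` of inner products, `B_{ij} = g(U_i, U_j)`. -/
def gram (φ : Form 3 M) (p : M) : Matrix (Fin 3) (Fin 3) ℝ :=
  Matrix.of fun i j => metricOf (φ p) (gen i p) (gen j p)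

/-- `φ` is a torsion-free (closed and co-closed) `G₂`-structure on `M`, preserved by a smooth
effective action of `T³`. -/
structure IsG2WithTorusSymmetry (φ : Form 3 M) : Prop where
  smooth : Form.IsSmooth φ
  isG2 : ∀ p, IsG2Form (φ p)
  closed : Form.IsClosed φ
  coclosed : Form.IsClosed (starForm φ)
  smooth_action : IsSmoothAction M
  effective : FaithfulSMul Torus3 M
  preserves : ∀ (a : Torus3) (p : M),
    (φ (a • p)).compContinuousLinearMap (mfderiv (𝓡 7) (𝓡 7) (fun q : M => a • q) p) = φ p

/-- `ν = (ν₁, ν₂, ν₃)` is a multi-moment map for `φ`: it is invariant and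
`dν_i = φ(U_j, U_k, ·)` for `(ijk)` a cyclic permutation of `(123)`. -/
structure IsMultiMomentPhi (φ : Form 3 M) (ν : M → Fin 3 → ℝ) : Prop where
  smooth : ContMDiff (𝓡 7) 𝓘(ℝ, Fin 3 → ℝ) ∞ ν
  invariant : ∀ (a : Torus3) (p : M), ν (a • p) = ν p
  deriv : ∀ (p : M) (i : Fin 3) (X : TangentSpace (𝓡 7) p),
    (mfderiv (𝓡 7) 𝓘(ℝ, ℝ) (fun q => ν q i) p X : ℝ)
      = φ p ![gen (i + 1) p, gen (i + 2) p, X]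

/-- `μ` is a multi-moment map for `*φ`: it is invariant and `dμ = *φ(U₁, U₂, U₃, ·)`. -/
structure IsMultiMomentStar (φ : Form 3 M) (μ : M → ℝ) : Prop where
  smooth : ContMDiff (𝓡 7) 𝓘(ℝ, ℝ) ∞ μ
  invariant : ∀ (a : Torus3) (p : M), μ (a • p) = μ p
  deriv : ∀ (p : M) (X : TangentSpace (𝓡 7) p),
    (mfderiv (𝓡 7) 𝓘(ℝ, ℝ) μ p X : ℝ)
      = starForm φ p ![gen 0 p, gen 1 p, gen 2 p, X]

variable (M) in
/-- The orbit space `M/T³`, with the quotient topology. -/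
abbrev OrbitSpace : Type _ := Quotient (MulAction.orbitRel Torus3 M)

/-- The map on `M/T³` induced by an invariant map on `M`. -/
def orbitLift {X : Type*} (f : M → X) (hf : ∀ (a : Torus3) (p : M), f (a • p) = f p) :
    OrbitSpace M → X :=
  Quotient.lift f (by
    rintro p q ⟨a, rfl⟩
    exact hf a q)

variable (M) in
/-- The image in `M/T³` of the union `M \ M₀` of the singular orbits. -/
def singularImage : Set (OrbitSpace M) :=
  (Quotient.mk (MulAction.orbitRel Torus3 M)) '' (regularSet M)ᶜ

variable (M) in
/-- The orbits whose stabiliser is two-dimensional; the kernel of `ξ_p` is the Lie algebra of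
the stabiliser of `p`. -/
def vertexSet : Set (OrbitSpace M) :=
  (Quotient.mk (MulAction.orbitRel Torus3 M)) ''
    {p | Module.finrank ℝ (LinearMap.ker (infAct p).toLinearMap) = 2}

end Action

/-! ### Graphs -/

/-- Three half-open intervals `[0, 1)` glued at `0`. -/
def tripod : Set (Fin 3 → ℝ) :=
  {x | (∀ i, 0 ≤ x i ∧ x i < 1) ∧ ∀ i j, i ≠ j → x i = 0 ∨ x j = 0}

section Graph

variable {Q : Type*} [TopologicalSpace Q]

/-- The (open) edges of a graph `S` with vertex set `W` are the connected components
of `S \ W`. -/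
def IsEdge (S W e : Set Q) : Prop :=
  ∃ x ∈ S \ W, e = connectedComponentIn (S \ W) x

/-- The closed subset `S` of the space `Q` is a (possibly empty, disconnected, infinite)
trivalent graph with vertex set `W`: vertices are isolated from each other, the open edges are
open in `S` and homeomorphic to the real line, and each vertex has a neighbourhood in `S` that
is a tripod centred at the vertex. An edge may be unbounded or without end points. -/
structure IsTrivalentGraph (S W : Set Q) : Prop where
  isClosed : IsClosed S
  vertices_subset : W ⊆ S
  vertices_closed : IsClosed W
  edges : ∀ e, IsEdge S W e → (∃ O, IsOpen O ∧ e = O ∩ S) ∧ Nonempty (e ≃ₜ ℝ)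
  vertices : ∀ w ∈ W, ∃ N : Set Q, IsOpen N ∧ N ∩ W = {w} ∧
    ∃ h : ↥(N ∩ S) ≃ₜ tripod, ∀ x : ↥(N ∩ S), (h x : Fin 3 → ℝ) = 0 ↔ (x : Q) = w

/-- An integral vector whose entries have no common divisor except units (so it is not zero). -/
def IsPrimitive (v : Fin 3 → ℤ) : Prop := ∀ d : ℤ, (∀ i, d ∣ v i) → IsUnit d

/-- The map `ν` sends `e` homeomorphically onto `{a + t v | t ∈ J}`. -/
def MapsOntoSegment (ν : Q → Fin 3 → ℝ) (e : Set Q) (a : Fin 3 → ℝ) (v : Fin 3 → ℤ)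
    (J : Set ℝ) : Prop :=
  Topology.IsEmbedding (e.domRestrict ν) ∧ ν '' e = (fun t : ℝ => a + t • fun i => (v i : ℝ)) '' J

end Graph

end

end ToricG2

open ToricG2

namespace ToricG2

open Set Filter Module

/-! ### Local homeomorphisms to the line -/

section Line

variable {E : Type*} [TopologicalSpace E]

/-! The problem is local around a singular orbit; the graph and its image under `ν` are then
assembled by elementary topology.

Let `p` be singular, with isotropy algebra `𝔥 ⊆ ℝ³`. The isotropy representation preserves `φ` at
`p`, so `𝔥` acts by commuting infinitesimal symmetries of `φ₀`, which are skew. As seven is odd,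
they share a null unit vector `u`. Then `u × ·` is a complex structure on the orthogonal complement
of `u`, and `𝔥` acts diagonally on it in the manner of `𝔰𝔲(3)`: three real weights with sum zero
(`IsToralFamily.exists_frame`). An effective action on a connected manifold has faithful isotropy
representations (`eq_one_of_isotropyRep`). Hence two of the weights determine an element of `𝔥`, so
`dim 𝔥 ≤ 2`, and an element of `𝔥` is an integral vector exactly when all its weights are integers
(`IsIsotropyFrame.integral_iff`).

Averaging over the stabiliser linearises its action (`exists_linearization`) and yields a slice:
orbits near `p` are represented by normal vectors `n`, with isotropy algebra `{b ∈ 𝔥 | b n = 0}`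
(`IsLinearization.exists_isSliceRadius`). If `dim 𝔥 = 1`, the orbit directions are fixed, the
weights are `0, β, -β` and the singular orbits form an arc. If `dim 𝔥 = 2`, the normal space is
`ℂ³`, the singular vectors fill its three coordinate axes, and rotating phases folds each axis to a
half-line: this is the tripod.

The moment maps enter through `(a × b) · dν = φ(ξa, ξb, ·)`. Where `ξa = 0` the differential of `ν`
takes values in `ℝa`, and `dμ = 0` because `U₁, U₂, U₃` are dependent. So along the singular set `ν`
moves in the direction of the kernel and `μ` is constant (`moment_eq_on_slice`). A component of `ν`
has positive derivative along an edge arc; along a leg of a star it is monotone with the first-order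
factor `r` (`exists_height`). Suitable generators of the kernels of the three weights are primitive,
sum to zero, and after one common choice of sign all point away from the vertex
(`exists_vertex_vectors`).

Globally, the kernel line is locally constant on a component of `S \ W`, so `ν` maps the component
into one affine line by an open, locally injective map. On a connected Hausdorff space such a map to
a line is injective, which makes every edge an embedded open segment. -/

theorem injOn_union_of_isOpenMap [T2Space E] {f : E → ℝ} (hf : Continuous f) (ho : IsOpenMap f)
    {U V : Set E} (hU : IsOpen U) (hV : IsOpen V) (hUc : IsPreconnected U)
    (hVc : IsPreconnected V) (hUi : InjOn f U) (hVi : InjOn f V) (hne : (U ∩ V).Nonempty) :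
    InjOn f (U ∪ V) := by
  have key : ∀ a ∈ U, ∀ b ∈ V, f a = f b → a = b := by
    intro a ha b hb hab
    have hI : IsPreconnected (f '' U ∩ f '' V) :=
      ((hUc.image f hf.continuousOn).ordConnected.inter
        (hVc.image f hf.continuousOn).ordConnected).isPreconnected
    by_contra hne'
    have hA : IsOpen (f '' (U ∩ V)) := ho _ (hU.inter hV)
    -- Over the interval `f(U) ∩ f(V)`, the values taken on `U ∩ V` and the values taken at two
    -- distinct points of `U` and `V` form two open sets that cover. Injectivity on `U` and on `V`
    -- makes them disjoint, so the second is empty.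
    let B : Set ℝ := {c | ∃ y ∈ U, ∃ z ∈ V, y ≠ z ∧ f y = c ∧ f z = c}
    have hB : IsOpen B := by
      rw [isOpen_iff_mem_nhds]
      rintro c ⟨y, hy, z, hz, hyz, rfl, hzc⟩
      obtain ⟨A₁, A₂, h1, h2, hy1, hz2, hd⟩ := t2_separation hyz
      have n1 : f '' (U ∩ A₁) ∈ 𝓝 (f y) := (ho _ (hU.inter h1)).mem_nhds ⟨y, ⟨hy, hy1⟩, rfl⟩
      have n2 : f '' (V ∩ A₂) ∈ 𝓝 (f y) := (ho _ (hV.inter h2)).mem_nhds ⟨z, ⟨hz, hz2⟩, hzc⟩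
      filter_upwards [n1, n2]
      rintro c ⟨y', hy', rfl⟩ ⟨z', hz', hc⟩
      exact ⟨y', hy'.1, z', hz'.1, fun h => (disjoint_left.1 hd hy'.2) (h ▸ hz'.2), rfl, hc⟩
    have hcov : f '' U ∩ f '' V ⊆ f '' (U ∩ V) ∪ B := by
      rintro c ⟨⟨y, hy, rfl⟩, z, hz, hzc⟩
      by_cases h : y = z
      · subst h; exact Or.inl ⟨y, ⟨hy, hz⟩, rfl⟩
      · exact Or.inr ⟨y, hy, z, hz, h, rfl, hzc⟩
    obtain ⟨p, hpU, hpV⟩ := hne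
    obtain ⟨c, _, ⟨q, ⟨hqU, hqV⟩, hq⟩, y, hy, z, hz, hyz, hyc, hzc⟩ := hI _ _ hA hB hcov
      ⟨f p, ⟨⟨p, hpU, rfl⟩, p, hpV, rfl⟩, p, ⟨hpU, hpV⟩, rfl⟩
      ⟨f a, ⟨⟨a, ha, rfl⟩, b, hb, hab.symm⟩, a, ha, b, hb, hne', rfl, hab.symm⟩
    exact hyz ((hUi hy hqU (hyc.trans hq.symm)).trans (hVi hz hqV (hzc.trans hq.symm)).symm)
  rintro a (ha | ha) b (hb | hb) hab
  · exact hUi ha hb hab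
  · exact key a ha b hb hab
  · exact (key b hb a ha hab.symm).symm
  · exact hVi ha hb hab

/-- Gluing shows that the union of all connected open sets through `x₀` on which `f` is injective
has the same property, and that this largest set absorbs every small neighbourhood it meets. It is
therefore clopen. This is what prevents an edge from closing up into a circle. -/
theorem injective_of_isOpenMap_of_locally_injOn [T2Space E] [ConnectedSpace E] {f : E → ℝ}
    (hf : Continuous f) (ho : IsOpenMap f)
    (hloc : ∀ y, ∃ U, IsOpen U ∧ y ∈ U ∧ IsPreconnected U ∧ InjOn f U) :
    Function.Injective f := by
  obtain ⟨x₀⟩ := (inferInstance : Nonempty E)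
  let 𝒞 : Set (Set E) := {U | IsOpen U ∧ x₀ ∈ U ∧ IsPreconnected U ∧ InjOn f U}
  have hopen : IsOpen (⋃₀ 𝒞) := isOpen_sUnion fun U hU => hU.1
  have hpre : IsPreconnected (⋃₀ 𝒞) :=
    isPreconnected_sUnion x₀ _ (fun U hU => hU.2.1) (fun U hU => hU.2.2.1)
  have hinj : InjOn f (⋃₀ 𝒞) := by
    rintro a ⟨U, hU, ha⟩ b ⟨V, hV, hb⟩ hab
    exact injOn_union_of_isOpenMap hf ho hU.1 hV.1 hU.2.2.1 hV.2.2.1 hU.2.2.2 hV.2.2.2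
      ⟨x₀, hU.2.1, hV.2.1⟩ (Or.inl ha) (Or.inr hb) hab
  obtain ⟨U₀, hU₀⟩ := hloc x₀
  have hx₀ : x₀ ∈ ⋃₀ 𝒞 := ⟨U₀, hU₀, hU₀.2.1⟩
  have hclosed : IsClosed (⋃₀ 𝒞) := by
    refine isClosed_of_closure_subset fun y hy => ?_
    obtain ⟨V, hV, hyV, hVc, hVi⟩ := hloc y
    obtain ⟨z, hzV, hz⟩ := mem_closure_iff.1 hy V hV hyV
    exact ⟨⋃₀ 𝒞 ∪ V, ⟨hopen.union hV, Or.inl hx₀, hpre.union z hz hzV hVc,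
      injOn_union_of_isOpenMap hf ho hopen hV hpre hVc hinj hVi ⟨z, hz, hzV⟩⟩, Or.inr hyV⟩
  have huniv : ⋃₀ 𝒞 = univ := IsClopen.eq_univ ⟨hclosed, hopen⟩ ⟨x₀, hx₀⟩
  rw [huniv] at hinj
  exact injOn_univ.1 hinj

/-- Injectivity on an interval means strict monotonicity, and the intermediate value theorem then
covers a neighbourhood of the value. Openness of `ν` along an arc thus needs no derivative. -/
theorem nhds_le_map_of_continuousOn_injOn {g : ℝ → ℝ} (hg : ContinuousOn g (Ioo (-1) 1))
    (hi : InjOn g (Ioo (-1) 1)) : 𝓝 (g 0) ≤ map g (𝓝 0) := by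
  intro U hU
  rw [mem_map] at hU
  obtain ⟨ε, hε, hεU⟩ := Metric.mem_nhds_iff.1 hU
  set δ := min (ε / 2) (1 / 2) with hδ
  have hδ0 : 0 < δ := by positivity
  have hδ1 : δ ≤ 1 / 2 := min_le_right _ _
  have hδε : δ ≤ ε / 2 := min_le_left _ _
  have hsub : Icc (-δ) δ ⊆ Ioo (-1 : ℝ) 1 := fun s hs => ⟨by linarith [hs.1], by linarith [hs.2]⟩
  have hgU : g '' Icc (-δ) δ ⊆ U := by
    rintro _ ⟨s, hs, rfl⟩
    refine hεU ?_
    rw [Metric.mem_ball, dist_zero_right, Real.norm_eq_abs, abs_lt]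
    exact ⟨by linarith [hs.1], by linarith [hs.2]⟩
  have hc : ContinuousOn g (Icc (-δ) δ) := hg.mono hsub
  have hm0 : (0 : ℝ) ∈ Icc (-δ) δ := ⟨by linarith, hδ0.le⟩
  have hml : -δ ∈ Icc (-δ) δ := ⟨le_rfl, by linarith⟩
  have hmr : δ ∈ Icc (-δ) δ := ⟨by linarith, le_rfl⟩
  rcases hc.strictMonoOn_of_injOn_Icc' (by linarith) (hi.mono hsub) with h | h
  · exact mem_of_superset (Icc_mem_nhds (h hml hm0 (by linarith)) (h hm0 hmr hδ0))
      ((intermediate_value_Icc (by linarith) hc).trans hgU)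
  · exact mem_of_superset (Icc_mem_nhds (h hm0 hmr hδ0) (h hml hm0 (by linarith)))
      ((intermediate_value_Icc' (by linarith) hc).trans hgU)

theorem nonempty_homeomorph_real_of_isOpen {J : Set ℝ} (hJ : IsOpen J) (hc : J.OrdConnected)
    (hne : J.Nonempty) : Nonempty (J ≃ₜ ℝ) := by
  -- reduce to a bounded interval through `arctan`
  set K := Real.arctan '' J with hK
  have hemb : Topology.IsOpenEmbedding Real.arctan := by
    have h1 : Topology.IsOpenEmbedding (Subtype.val : Ioo (-(Real.pi / 2)) (Real.pi / 2) → ℝ) :=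
      isOpen_Ioo.isOpenEmbedding_subtypeVal
    exact h1.comp Real.tanOrderIso.symm.toHomeomorph.isOpenEmbedding
  have hKo : IsOpen K := hemb.isOpenMap _ hJ
  have hKc : IsPreconnected K := hc.isPreconnected.image _ Real.continuous_arctan.continuousOn
  have hKa : BddAbove K := ⟨Real.pi / 2, by rintro _ ⟨x, _, rfl⟩; exact (Real.arctan_lt_pi_div_two x).le⟩
  have hKb : BddBelow K := ⟨-(Real.pi / 2), by
    rintro _ ⟨x, _, rfl⟩; exact (Real.neg_pi_div_two_lt_arctan x).le⟩
  have hKne : K.Nonempty := hne.image _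
  set a := sInf K
  set b := sSup K
  have hKI : K = Ioo a b := by
    apply Subset.antisymm
    · intro x hx
      obtain ⟨ε, hε, hx'⟩ := Metric.isOpen_iff.1 hKo x hx
      have h1 : x - ε / 2 ∈ K := hx' (by simp [abs_of_pos hε]; linarith)
      have h2 : x + ε / 2 ∈ K := hx' (by simp [abs_of_pos hε]; linarith)
      exact ⟨by linarith [csInf_le hKb h1], by linarith [le_csSup hKa h2]⟩
    · exact IsConnected.Ioo_csInf_csSup_subset ⟨hKne, hKc⟩ hKb hKa
  obtain ⟨c, hcK⟩ := hKne
  have hab : a < b := by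
    have := hKI ▸ hcK
    exact this.1.trans this.2
  let e1 : J ≃ₜ K := hemb.toIsEmbedding.homeomorphImage J
  let e2 : K ≃ₜ Ioo a b := Homeomorph.setCongr hKI
  have hpi := Real.pi_pos
  -- The affine map with `a ↦ -π/2` and `b ↦ π/2`, so that `tan` can finish.
  let g : ℝ ≃ₜ ℝ := affineHomeomorph (Real.pi / (b - a)) (-(Real.pi / 2) - Real.pi / (b - a) * a)
    (by have : b - a ≠ 0 := by linarith
        positivity)
  have hg : g '' Ioo a b = Ioo (-(Real.pi / 2)) (Real.pi / 2) := by
    have hp : 0 < Real.pi / (b - a) := div_pos hpi (by linarith)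
    have : b - a ≠ 0 := by linarith
    have hg' : ∀ x, g x = Real.pi / (b - a) * x + (-(Real.pi / 2) - Real.pi / (b - a) * a) :=
      fun x => rfl
    have : (fun x => g x) = fun x => Real.pi / (b - a) * x +
      (-(Real.pi / 2) - Real.pi / (b - a) * a) := funext hg'
    change (fun x => g x) '' _ = _
    rw [this, image_affine_Ioo hp]
    congr 1 <;> field_simp <;> ring
  let e3 : Ioo a b ≃ₜ g '' Ioo a b := g.isEmbedding.homeomorphImage _
  exact ⟨e1.trans <| e2.trans <| e3.trans <| (Homeomorph.setCongr hg).trans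
    Real.tanOrderIso.toHomeomorph⟩

theorem eq_of_locally_eq_of_isPreconnected {X : Type*} {g : E → X} {e : Set E}
    (he : IsPreconnected e)
    (h : ∀ y ∈ e, ∃ O, IsOpen O ∧ y ∈ O ∧ ∀ z ∈ O ∩ e, g z = g y) {x y : E} (hx : x ∈ e)
    (hy : y ∈ e) : g y = g x := by
  have : PreconnectedSpace e := isPreconnected_iff_preconnectedSpace.1 he
  have hl : IsLocallyConstant fun z : e => g z := by
    rw [IsLocallyConstant.iff_exists_open]
    rintro ⟨z, hz⟩
    obtain ⟨O, hO, hzO, hc⟩ := h z hz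
    exact ⟨Subtype.val ⁻¹' O, hO.preimage continuous_subtype_val, hzO,
      fun w hw => hc w ⟨hw, w.2⟩⟩
  exact hl.apply_eq_of_preconnectedSpace ⟨y, hy⟩ ⟨x, hx⟩

end Line

/-! ### Trivalent graphs from local data -/

section LocalData

variable {Q : Type*} [TopologicalSpace Q]

/-- An integral vector, viewed in `ℝ³`. -/
def realVec (v : Fin 3 → ℤ) : Fin 3 → ℝ := fun i => (v i : ℝ)

theorem realVec_ne_zero {v : Fin 3 → ℤ} (hv : IsPrimitive v) : realVec v ≠ 0 := by
  intro h
  have : ∀ i, v i = 0 := fun i => by simpa [realVec] using congrFun h i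
  simpa using hv 0 fun i => by simp [this i]

/-- A parametrised arc in `S` around a point `x` outside the vertex set. -/
structure IsEdgeArc (S W : Set Q) (ν : Q → Fin 3 → ℝ) (κ : Q → Submodule ℝ (Fin 3 → ℝ))
    (μ : Q → ℝ) (x : Q) (τ : ℝ → Q) : Prop where
  continuousOn : ContinuousOn τ (Ioo (-1) 1)
  map_zero : τ 0 = x
  exists_open : ∃ O, IsOpen O ∧ τ '' Ioo (-1) 1 = O ∩ S ∧ O ∩ W = ∅
  injOn : InjOn (ν ∘ τ) (Ioo (-1) 1)
  sub_mem : ∀ s ∈ Ioo (-1 : ℝ) 1, ν (τ s) - ν x ∈ κ x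
  ker_eq : ∀ s ∈ Ioo (-1 : ℝ) 1, κ (τ s) = κ x
  mu_eq : ∀ s ∈ Ioo (-1 : ℝ) 1, μ (τ s) = μ x

/-- A parametrised star in `S` around a vertex `w`, with primitive slope vectors `v`. -/
structure IsVertexStar (S W : Set Q) (ν : Q → Fin 3 → ℝ) (κ : Q → Submodule ℝ (Fin 3 → ℝ))
    (μ : Q → ℝ) (w : Q) (σ : (Fin 3 → ℝ) → Q) (v : Fin 3 → Fin 3 → ℤ) (h : Fin 3 → ℝ → ℝ) :
    Prop where
  continuousOn : ContinuousOn σ (Icc 0 1)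
  map_zero : σ 0 = w
  exists_open : ∃ O, IsOpen O ∧ σ '' tripod = O ∩ S ∧ O ∩ W = {w}
  primitive : ∀ i, IsPrimitive (v i)
  sum_eq_zero : ∑ i, v i = 0
  indep : ∀ i j, i ≠ j → ∀ a b : ℝ, a • realVec (v i) = b • realVec (v j) → a = 0 ∧ b = 0
  strictMonoOn : ∀ i, StrictMonoOn (h i) (Icc 0 1)
  height_zero : ∀ i, h i 0 = 0
  nu_eq : ∀ i, ∀ s ∈ Icc (0 : ℝ) 1, ν (σ (Pi.single i s)) = ν w + h i s • realVec (v i)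
  ker_eq : ∀ i, ∀ s ∈ Ioo (0 : ℝ) 1, κ (σ (Pi.single i s)) = Submodule.span ℝ {realVec (v i)}
  mu_eq : ∀ i, ∀ s ∈ Icc (0 : ℝ) 1, μ (σ (Pi.single i s)) = μ w

/-- The closed version of `tripod`. -/
def closedTripod : Set (Fin 3 → ℝ) :=
  {x | (∀ i, 0 ≤ x i ∧ x i ≤ 1) ∧ ∀ i j, i ≠ j → x i = 0 ∨ x j = 0}

theorem tripod_subset_closedTripod : tripod ⊆ closedTripod :=
  fun _ hx => ⟨fun i => ⟨(hx.1 i).1, (hx.1 i).2.le⟩, hx.2⟩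

theorem closedTripod_subset_Icc : closedTripod ⊆ Icc 0 1 :=
  fun _ hx => ⟨fun i => (hx.1 i).1, fun i => (hx.1 i).2⟩

theorem isCompact_closedTripod : IsCompact closedTripod := by
  refine isCompact_Icc.of_isClosed_subset ?_ closedTripod_subset_Icc
  have : closedTripod = (⋂ i, ({x | 0 ≤ x i} ∩ {x | x i ≤ 1})) ∩
      ⋂ i, ⋂ j, ⋂ _ : i ≠ j, ({x : Fin 3 → ℝ | x i = 0} ∪ {x | x j = 0}) := by
    ext x; simp [closedTripod]
  rw [this]
  refine (isClosed_iInter fun i => ?_).inter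
    (isClosed_iInter fun i => isClosed_iInter fun j => isClosed_iInter fun _ => ?_)
  · exact (isClosed_le continuous_const (continuous_apply i)).inter
      (isClosed_le (continuous_apply i) continuous_const)
  · exact (isClosed_eq (continuous_apply i) continuous_const).union
      (isClosed_eq (continuous_apply j) continuous_const)

theorem exists_eq_single_of_mem_closedTripod {x : Fin 3 → ℝ} (hx : x ∈ closedTripod) :
    ∃ i, ∃ s ∈ Icc (0 : ℝ) 1, x = Pi.single i s := by
  by_cases h : ∃ i, x i ≠ 0
  · obtain ⟨i, hi⟩ := h
    refine ⟨i, x i, hx.1 i, funext fun j => ?_⟩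
    by_cases hj : j = i
    · subst hj; simp
    · rw [Pi.single_eq_of_ne hj]
      exact (hx.2 i j (Ne.symm hj)).resolve_left hi
  · push Not at h
    exact ⟨0, 0, ⟨le_rfl, zero_le_one⟩, funext fun j => by simp [h j]⟩

theorem single_mem_closedTripod (i : Fin 3) {s : ℝ} (hs : s ∈ Icc (0 : ℝ) 1) :
    (Pi.single i s : Fin 3 → ℝ) ∈ closedTripod := by
  refine ⟨fun j => ?_, fun j k hjk => ?_⟩
  · by_cases hj : j = i
    · subst hj; simpa using hs
    · simp [Pi.single_eq_of_ne hj]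
  · by_cases hj : j = i
    · subst hj; exact Or.inr (Pi.single_eq_of_ne (Ne.symm hjk) _)
    · exact Or.inl (Pi.single_eq_of_ne hj _)

theorem single_mem_tripod (i : Fin 3) {s : ℝ} (hs : s ∈ Ico (0 : ℝ) 1) :
    (Pi.single i s : Fin 3 → ℝ) ∈ tripod := by
  refine ⟨fun j => ?_, (single_mem_closedTripod i ⟨hs.1, hs.2.le⟩).2⟩
  by_cases hj : j = i
  · subst hj; simpa using hs
  · simp [Pi.single_eq_of_ne hj]

theorem exists_eq_single_of_mem_tripod {x : Fin 3 → ℝ} (hx : x ∈ tripod) :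
    ∃ i, ∃ s ∈ Ico (0 : ℝ) 1, x = Pi.single i s := by
  obtain ⟨i, s, hs, rfl⟩ := exists_eq_single_of_mem_closedTripod (tripod_subset_closedTripod hx)
  exact ⟨i, s, ⟨hs.1, by simpa using (hx.1 i).2⟩, rfl⟩

variable {S W : Set Q} {ν : Q → Fin 3 → ℝ} {κ : Q → Submodule ℝ (Fin 3 → ℝ)} {μ : Q → ℝ}

theorem IsEdgeArc.continuousAt {x : Q} {τ : ℝ → Q} (h : IsEdgeArc S W ν κ μ x τ) :
    ContinuousAt τ 0 :=
  h.continuousOn.continuousAt (Ioo_mem_nhds (by norm_num) (by norm_num))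

theorem IsEdgeArc.isPreconnected {x : Q} {τ : ℝ → Q} (h : IsEdgeArc S W ν κ μ x τ) :
    IsPreconnected (τ '' Ioo (-1) 1) :=
  isPreconnected_Ioo.image _ h.continuousOn

/-- The edge through `x` is carried by `ν` onto a segment, and is open in `S`. -/
theorem exists_segment_of_isEdgeArc [T2Space Q] (hν : Continuous ν)
    (hE : ∀ x ∈ S \ W, ∃ τ, IsEdgeArc S W ν κ μ x τ) {x : Q} (hx : x ∈ S \ W) {v : Fin 3 → ℝ}
    (hv0 : v ≠ 0) (hv : κ x = Submodule.span ℝ {v}) {a : Fin 3 → ℝ} (ha : ν x - a ∈ κ x) :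
    (∃ O, IsOpen O ∧ connectedComponentIn (S \ W) x = O ∩ S) ∧
    ∃ f : Q → ℝ, Continuous f ∧ (∀ y t, ν y = a + t • v → f y = t) ∧
      (∀ y ∈ connectedComponentIn (S \ W) x, ν y = a + f y • v) ∧
      Topology.IsOpenEmbedding ((connectedComponentIn (S \ W) x).domRestrict f) := by
  set e := connectedComponentIn (S \ W) x with he
  have hec : IsPreconnected e := isPreconnected_connectedComponentIn
  have hxe : x ∈ e := mem_connectedComponentIn hx
  have heS : e ⊆ S \ W := connectedComponentIn_subset _ _
  have hsub : ∀ y ∈ e, ∀ τ, IsEdgeArc S W ν κ μ y τ → τ '' Ioo (-1) 1 ⊆ e := by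
    intro y hy τ hτ
    obtain ⟨O, -, hOS, hOW⟩ := hτ.exists_open
    have h0 : y ∈ τ '' Ioo (-1) 1 := ⟨0, by norm_num, hτ.map_zero⟩
    rw [he, connectedComponentIn_eq hy]
    refine hτ.isPreconnected.subset_connectedComponentIn h0 ?_
    rw [hOS]
    exact fun z hz => ⟨hz.2, fun hzW => (hOW ▸ (⟨hz.1, hzW⟩ : z ∈ O ∩ W) : z ∈ (∅ : Set Q))⟩
  have hloc : ∀ y ∈ e, ∃ τ, IsEdgeArc S W ν κ μ y τ ∧ ∃ O, IsOpen O ∧ y ∈ O ∧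
      O ∩ S = τ '' Ioo (-1) 1 ∧ O ∩ e = τ '' Ioo (-1) 1 := by
    intro y hy
    obtain ⟨τ, hτ⟩ := hE y (heS hy)
    obtain ⟨O, hO, hOS, hOW⟩ := hτ.exists_open
    have h0 : y ∈ τ '' Ioo (-1) 1 := ⟨0, by norm_num, hτ.map_zero⟩
    refine ⟨τ, hτ, O, hO, (hOS ▸ h0 : y ∈ O ∩ S).1, hOS.symm, Subset.antisymm ?_ ?_⟩
    · rw [hOS]; exact inter_subset_inter_right _ fun z hz => (heS hz).1
    · exact fun z hz => ⟨(hOS ▸ hz : z ∈ O ∩ S).1, hsub y hy τ hτ hz⟩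
  -- Both `κ` and the class of `ν` modulo `κ x` are locally constant on the connected set `e`; hence
  -- `ν` maps `e` into the single affine line `a + κ x`.
  have hκ : ∀ y ∈ e, κ y = κ x := fun y hy => by
    refine eq_of_locally_eq_of_isPreconnected hec (fun y hy => ?_) hxe hy
    obtain ⟨τ, hτ, O, hO, hyO, -, hOe⟩ := hloc y hy
    refine ⟨O, hO, hyO, fun z hz => ?_⟩
    rw [hOe] at hz
    obtain ⟨s, hs, rfl⟩ := hz
    exact hτ.ker_eq s hs
  have hline : ∀ y ∈ e, ν y - a ∈ κ x := by
    intro y hy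
    have : (Submodule.Quotient.mk (ν y) : (Fin 3 → ℝ) ⧸ κ x) = Submodule.Quotient.mk (ν x) := by
      refine eq_of_locally_eq_of_isPreconnected
        (g := fun y => (Submodule.Quotient.mk (ν y) : (Fin 3 → ℝ) ⧸ κ x)) hec
        (fun y hy => ?_) hxe hy
      obtain ⟨τ, hτ, O, hO, hyO, -, hOe⟩ := hloc y hy
      refine ⟨O, hO, hyO, fun z hz => ?_⟩
      rw [hOe] at hz
      obtain ⟨s, hs, rfl⟩ := hz
      have := hτ.sub_mem s hs
      rw [hκ y hy] at this
      exact (Submodule.Quotient.eq (κ x)).2 this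
    have h2 : ν y - ν x ∈ κ x := (Submodule.Quotient.eq (κ x)).1 this
    simpa using (κ x).add_mem h2 ha
  obtain ⟨i, hi⟩ : ∃ i, v i ≠ 0 := by
    by_contra! h
    exact hv0 (funext h)
  -- The parameter along the line, defined on all of `Q` and not only on `e`, so that it can also be
  -- evaluated at a vertex in the closure of `e`.
  let f : Q → ℝ := fun y => (ν y i - a i) / v i
  have hf : Continuous f :=
    (((continuous_apply i).comp hν).sub continuous_const).div_const _
  have hft : ∀ y t, ν y = a + t • v → f y = t := by
    intro y t h
    simp only [f, h, Pi.add_apply, Pi.smul_apply, smul_eq_mul, add_sub_cancel_left]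
    field_simp
  have hfe : ∀ y ∈ e, ν y = a + f y • v := by
    intro y hy
    have := hline y hy
    rw [hv, Submodule.mem_span_singleton] at this
    obtain ⟨t, ht⟩ := this
    have h2 : ν y = a + t • v := by rw [ht]; abel
    rw [hft y t h2]; exact h2
  refine ⟨⟨⋃₀ {O | IsOpen O ∧ O ∩ S ⊆ e}, isOpen_sUnion fun O hO => hO.1, ?_⟩,
    f, hf, hft, hfe, ?_⟩
  · apply Subset.antisymm
    · intro y hy
      obtain ⟨τ, hτ, O, hO, hyO, hOS, hOe⟩ := hloc y hy
      exact ⟨⟨O, ⟨hO, by rw [hOS, ← hOe]; exact inter_subset_right⟩, hyO⟩, (heS hy).1⟩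
    · rintro y ⟨⟨O, hO, hyO⟩, hyS⟩
      exact hO.2 ⟨hyO, hyS⟩
  have hfc : Continuous (e.domRestrict f) := hf.comp continuous_subtype_val
  have hinjτ : ∀ y ∈ e, ∀ τ, IsEdgeArc S W ν κ μ y τ → InjOn (f ∘ τ) (Ioo (-1) 1) := by
    intro y hy τ hτ s hs t ht hst
    refine hτ.injOn hs ht ?_
    have h1 := hfe _ (hsub y hy τ hτ ⟨s, hs, rfl⟩)
    have h2 := hfe _ (hsub y hy τ hτ ⟨t, ht, rfl⟩)
    simp only [Function.comp_apply] at hst ⊢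
    rw [h1, h2, hst]
  -- The arc through a point carries `f` to an injective continuous function of one real variable,
  -- whose image already contains a neighbourhood of the value.
  have hopen : IsOpenMap (e.domRestrict f) := by
    rw [isOpenMap_iff_nhds_le]
    rintro ⟨y, hy⟩
    obtain ⟨τ, hτ, -⟩ := hloc y hy
    have h1 := nhds_le_map_of_continuousOn_injOn (hf.comp_continuousOn hτ.continuousOn)
      (hinjτ y hy τ hτ)
    have hIoo : Ioo (-1 : ℝ) 1 ∈ 𝓝 0 := Ioo_mem_nhds (by norm_num) (by norm_num)
    have h2 : Tendsto τ (𝓝 0) (𝓝[e] y) := by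
      refine tendsto_nhdsWithin_iff.2 ⟨?_, ?_⟩
      · simpa [ContinuousAt, hτ.map_zero] using hτ.continuousAt
      · filter_upwards [hIoo] with s hs using hsub y hy τ hτ ⟨s, hs, rfl⟩
    have h3 : map (e.domRestrict f) (𝓝 ⟨y, hy⟩) = map f (𝓝[e] y) := by
      rw [nhdsWithin_eq_map_subtype_coe hy, map_map]; rfl
    rw [h3]
    have : f y = (f ∘ τ) 0 := by simp [hτ.map_zero]
    change 𝓝 (f y) ≤ _
    rw [this]
    refine h1.trans ?_
    rw [← map_map]
    exact map_mono h2
  have hconn : ConnectedSpace e := isConnected_iff_connectedSpace.1 ⟨⟨x, hxe⟩, hec⟩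
  refine Topology.IsOpenEmbedding.of_continuous_injective_isOpenMap hfc ?_ hopen
  refine injective_of_isOpenMap_of_locally_injOn hfc hopen ?_
  rintro ⟨y, hy⟩
  obtain ⟨τ, hτ, O, hO, hyO, hOS, hOe⟩ := hloc y hy
  refine ⟨Subtype.val ⁻¹' O, hO.preimage continuous_subtype_val, hyO, ?_, ?_⟩
  · rw [← Topology.IsInducing.subtypeVal.isPreconnected_image, Subtype.image_preimage_coe,
      inter_comm, hOe]
    exact hτ.isPreconnected
  · rintro ⟨z, hz⟩ hzO ⟨z', hz'⟩ hzO' hzz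
    have m1 : z ∈ τ '' Ioo (-1) 1 := hOe ▸ ⟨hzO, hz⟩
    have m2 : z' ∈ τ '' Ioo (-1) 1 := hOe ▸ ⟨hzO', hz'⟩
    obtain ⟨s, hs, rfl⟩ := m1
    obtain ⟨t, ht, rfl⟩ := m2
    have := hinjτ y hy τ hτ hs ht hzz
    subst this; rfl

/-- The parameter `f` is a coordinate of `ν` up to an affine change, so it factors through `ν`; a
continuous first factor of an embedding is an embedding. -/
theorem mapsOntoSegment_of_isOpenEmbedding {e : Set Q} (hν : Continuous ν) {f : Q → ℝ}
    {a : Fin 3 → ℝ} {v : Fin 3 → ℤ} (hv : realVec v ≠ 0)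
    (hfe : ∀ y ∈ e, ν y = a + f y • realVec v)
    (hf : Topology.IsOpenEmbedding (e.domRestrict f)) : MapsOntoSegment ν e a v (f '' e) := by
  refine ⟨?_, ?_⟩
  · obtain ⟨i, hi⟩ : ∃ i, realVec v i ≠ 0 := by
      by_contra! h
      exact hv (funext h)
    let g : (Fin 3 → ℝ) → ℝ := fun y => (y i - a i) / realVec v i
    have hg : Continuous g := ((continuous_apply i).sub continuous_const).div_const _
    have hgf : g ∘ e.domRestrict ν = e.domRestrict f := by
      funext y
      have := hfe y y.2
      simp only [Function.comp_apply, domRestrict_apply, g, this, Pi.add_apply, Pi.smul_apply,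
        smul_eq_mul, add_sub_cancel_left]
      field_simp
    exact Topology.IsEmbedding.of_comp (hν.comp continuous_subtype_val) hg
      (hgf ▸ hf.toIsEmbedding)
  · ext y
    constructor
    · rintro ⟨z, hz, rfl⟩
      exact ⟨f z, ⟨z, hz, rfl⟩, (hfe z hz).symm⟩
    · rintro ⟨_, ⟨z, hz, rfl⟩, rfl⟩
      exact ⟨z, hz, hfe z hz⟩

end LocalData

/-! ### Global structure of the graph from arcs and stars -/

section GraphOfLocalData

variable {Q : Type*} [TopologicalSpace Q]
variable {S W : Set Q} {ν : Q → Fin 3 → ℝ} {κ : Q → Submodule ℝ (Fin 3 → ℝ)} {μ : Q → ℝ}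

theorem IsEdgeArc.exists_inter_eq {x : Q} {τ : ℝ → Q} (h : IsEdgeArc S W ν κ μ x τ) :
    ∃ O, IsOpen O ∧ x ∈ O ∧ O ∩ W = ∅ ∧ ∀ z ∈ O ∩ S, μ z = μ x := by
  obtain ⟨O, hO, hOS, hOW⟩ := h.exists_open
  have h0 : x ∈ τ '' Ioo (-1) 1 := ⟨0, by norm_num, h.map_zero⟩
  refine ⟨O, hO, (hOS ▸ h0 : x ∈ O ∩ S).1, hOW, fun z hz => ?_⟩
  rw [← hOS] at hz
  obtain ⟨s, hs, rfl⟩ := hz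
  exact h.mu_eq s hs

theorem mu_eq_of_localData (hE : ∀ x ∈ S \ W, ∃ τ, IsEdgeArc S W ν κ μ x τ)
    (hV : ∀ w ∈ W, ∃ σ v h, IsVertexStar S W ν κ μ w σ v h) :
    ∀ x ∈ S, ∀ y ∈ connectedComponentIn S x, μ y = μ x := by
  intro x hx y hy
  refine eq_of_locally_eq_of_isPreconnected isPreconnected_connectedComponentIn
    (fun z hz => ?_) (mem_connectedComponentIn hx) hy
  have hzS : z ∈ S := connectedComponentIn_subset _ _ hz
  by_cases hzW : z ∈ W
  · obtain ⟨σ, v, h, hσ⟩ := hV z hzW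
    obtain ⟨O, hO, hOS, hOW⟩ := hσ.exists_open
    refine ⟨O, hO, ((hOW ▸ mem_singleton z : z ∈ O ∩ W)).1, fun q hq => ?_⟩
    have : q ∈ σ '' tripod := hOS ▸ ⟨hq.1, connectedComponentIn_subset _ _ hq.2⟩
    obtain ⟨t, ht, rfl⟩ := this
    obtain ⟨i, s, hs, rfl⟩ := exists_eq_single_of_mem_tripod ht
    exact hσ.mu_eq i s ⟨hs.1, hs.2.le⟩
  · obtain ⟨τ, hτ⟩ := hE z ⟨hzS, hzW⟩
    obtain ⟨O, hO, hzO, -, h⟩ := hτ.exists_inter_eq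
    exact ⟨O, hO, hzO, fun q hq => h q ⟨hq.1, connectedComponentIn_subset _ _ hq.2⟩⟩

variable [T2Space Q]

/-- A continuous injection of a compact space into a Hausdorff one is an embedding; this is why a
star is parametrised up to the closed ends of its legs. Injectivity is read off from `ν`: heights
are strictly monotone on a leg, and distinct legs have independent directions. -/
theorem IsVertexStar.isEmbedding {w : Q} {σ : (Fin 3 → ℝ) → Q} {v : Fin 3 → Fin 3 → ℤ}
    {h : Fin 3 → ℝ → ℝ} (hσ : IsVertexStar S W ν κ μ w σ v h) :
    Topology.IsEmbedding (closedTripod.domRestrict σ) := by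
  have : CompactSpace closedTripod := isCompact_iff_compactSpace.1 isCompact_closedTripod
  have hc : Continuous (closedTripod.domRestrict σ) :=
    continuousOn_iff_continuous_domRestrict.1 (hσ.continuousOn.mono closedTripod_subset_Icc)
  refine (hc.isClosedEmbedding ?_).toIsEmbedding
  rintro ⟨x, hx⟩ ⟨y, hy⟩ hxy
  obtain ⟨i, s, hs, rfl⟩ := exists_eq_single_of_mem_closedTripod hx
  obtain ⟨j, t, ht, rfl⟩ := exists_eq_single_of_mem_closedTripod hy
  have h1 := hσ.nu_eq i s hs
  have h2 := hσ.nu_eq j t ht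
  have hxy' : σ (Pi.single i s) = σ (Pi.single j t) := hxy
  rw [hxy', h2, add_right_inj] at h1
  have h0 : (0 : ℝ) ∈ Icc (0 : ℝ) 1 := ⟨le_rfl, zero_le_one⟩
  by_cases hij : j = i
  · subst hij
    rw [← sub_eq_zero, ← sub_smul] at h1
    have := (smul_eq_zero.1 h1).resolve_right (realVec_ne_zero (hσ.primitive j))
    have : s = t := (hσ.strictMonoOn j).injOn hs ht (by linarith)
    subst this; rfl
  · obtain ⟨h3, h4⟩ := hσ.indep j i hij _ _ h1
    have hs0 : s = 0 := (hσ.strictMonoOn i).injOn hs h0 (by rw [h4, hσ.height_zero])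
    have ht0 : t = 0 := (hσ.strictMonoOn j).injOn ht h0 (by rw [h3, hσ.height_zero])
    subst hs0; subst ht0
    exact Subtype.ext (by simp)

theorem IsVertexStar.exists_tripod_nhd {w : Q} {σ : (Fin 3 → ℝ) → Q} {v : Fin 3 → Fin 3 → ℤ}
    {h : Fin 3 → ℝ → ℝ} (hσ : IsVertexStar S W ν κ μ w σ v h) :
    ∃ N : Set Q, IsOpen N ∧ N ∩ W = {w} ∧
    ∃ h : ↥(N ∩ S) ≃ₜ tripod, ∀ x : ↥(N ∩ S), (h x : Fin 3 → ℝ) = 0 ↔ (x : Q) = w := by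
  obtain ⟨O, hO, hOS, hOW⟩ := hσ.exists_open
  have hemb : Topology.IsEmbedding (tripod.domRestrict σ) :=
    hσ.isEmbedding.comp (Topology.IsEmbedding.inclusion tripod_subset_closedTripod)
  have hr : range (tripod.domRestrict σ) = O ∩ S := by rw [range_domRestrict, hOS]
  let H : tripod ≃ₜ ↥(O ∩ S) := hemb.toHomeomorph.trans (Homeomorph.setCongr hr)
  have hH : ∀ x : tripod, (H x : Q) = σ x := fun x => rfl
  have z0 : (0 : Fin 3 → ℝ) ∈ tripod := ⟨fun i => by simp, fun i j _ => by simp⟩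
  refine ⟨O, hO, hOW, H.symm, fun x => ?_⟩
  obtain ⟨y, rfl⟩ := H.surjective x
  rw [Homeomorph.symm_apply_apply]
  constructor
  · intro hy
    rw [hH, hy, hσ.map_zero]
  · intro hy
    have : H y = H ⟨0, z0⟩ := Subtype.ext (by rw [hy, hH, ← hσ.map_zero])
    rw [H.injective this]

theorem isTrivalentGraph_of_localData (hS : IsClosed S) (hWS : W ⊆ S) (hν : Continuous ν)
    (hκ : ∀ x ∈ S \ W, ∃ v : Fin 3 → ℤ, IsPrimitive v ∧ κ x = Submodule.span ℝ {realVec v})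
    (hE : ∀ x ∈ S \ W, ∃ τ, IsEdgeArc S W ν κ μ x τ)
    (hV : ∀ w ∈ W, ∃ σ v h, IsVertexStar S W ν κ μ w σ v h) : IsTrivalentGraph S W where
  isClosed := hS
  vertices_subset := hWS
  vertices_closed := by
    rw [← isOpen_compl_iff, isOpen_iff_mem_nhds]
    intro x hx
    by_cases hxS : x ∈ S
    · obtain ⟨τ, hτ⟩ := hE x ⟨hxS, hx⟩
      obtain ⟨O, hO, hxO, hOW, -⟩ := hτ.exists_inter_eq
      exact mem_of_superset (hO.mem_nhds hxO) fun z hz hzW =>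
        (hOW ▸ (⟨hz, hzW⟩ : z ∈ O ∩ W) : z ∈ (∅ : Set Q))
    · exact mem_of_superset (hS.isOpen_compl.mem_nhds hxS) (compl_subset_compl.2 hWS)
  edges := by
    rintro e ⟨x, hx, rfl⟩
    obtain ⟨v, hv, hκv⟩ := hκ x hx
    obtain ⟨h1, f, hf, hft, hfe, hemb⟩ := exists_segment_of_isEdgeArc hν hE hx
      (realVec_ne_zero hv) hκv (a := ν x) (by simp)
    refine ⟨h1, ?_⟩
    have hr : IsOpen (range ((connectedComponentIn (S \ W) x).domRestrict f)) :=
      hemb.isOpen_range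
    have hc : (range ((connectedComponentIn (S \ W) x).domRestrict f)).OrdConnected := by
      rw [range_domRestrict]
      exact (isPreconnected_connectedComponentIn.image f hf.continuousOn).ordConnected
    have hne : (range ((connectedComponentIn (S \ W) x).domRestrict f)).Nonempty := by
      rw [range_domRestrict]
      exact ⟨_, x, mem_connectedComponentIn hx, rfl⟩
    obtain ⟨g⟩ := nonempty_homeomorph_real_of_isOpen hr hc hne
    exact ⟨hemb.toIsEmbedding.toHomeomorph.trans g⟩
  vertices := fun w hw => by
    obtain ⟨σ, v, h, hσ⟩ := hV w hw
    exact hσ.exists_tripod_nhd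

theorem edges_straight_of_localData (hν : Continuous ν)
    (hκ : ∀ x ∈ S \ W, ∃ v : Fin 3 → ℤ, IsPrimitive v ∧ κ x = Submodule.span ℝ {realVec v})
    (hE : ∀ x ∈ S \ W, ∃ τ, IsEdgeArc S W ν κ μ x τ) :
    ∀ e, IsEdge S W e → ∃ (a : Fin 3 → ℝ) (v : Fin 3 → ℤ) (J : Set ℝ), IsPrimitive v ∧
        IsOpen J ∧ J.OrdConnected ∧ J.Nonempty ∧ MapsOntoSegment ν e a v J := by
  rintro e ⟨x, hx, rfl⟩
  obtain ⟨v, hv, hκv⟩ := hκ x hx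
  obtain ⟨-, f, hf, hft, hfe, hemb⟩ := exists_segment_of_isEdgeArc hν hE hx
    (realVec_ne_zero hv) hκv (a := ν x) (by simp)
  refine ⟨ν x, v, _, hv, ?_, ?_, ?_,
    mapsOntoSegment_of_isOpenEmbedding hν (realVec_ne_zero hv) hfe hemb⟩
  · rw [← range_domRestrict]; exact hemb.isOpen_range
  · exact (isPreconnected_connectedComponentIn.image f hf.continuousOn).ordConnected
  · exact ⟨_, x, mem_connectedComponentIn hx, rfl⟩

theorem vertex_edges_of_localData (hν : Continuous ν)
    (hE : ∀ x ∈ S \ W, ∃ τ, IsEdgeArc S W ν κ μ x τ) {w : Q} {σ : (Fin 3 → ℝ) → Q}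
    {v : Fin 3 → Fin 3 → ℤ} {h : Fin 3 → ℝ → ℝ} (hσ : IsVertexStar S W ν κ μ w σ v h) :
    ∃ e : Fin 3 → Set Q,
      Function.Injective e ∧
      (∀ e', (IsEdge S W e' ∧ w ∈ closure e') ↔ ∃ i, e' = e i) ∧
      (∀ i, ∃ J : Set ℝ, IsOpen J ∧ J.OrdConnected ∧ J.Nonempty ∧ IsGLB J 0 ∧
        MapsOntoSegment ν (e i) (ν w) (v i) J) ∧
      ∃ P : AffineSubspace ℝ (Fin 3 → ℝ), Module.finrank ℝ P.direction = 2 ∧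
        ∀ i, ν '' e i ⊆ P := by
  obtain ⟨O, hO, hOS, hOW⟩ := hσ.exists_open
  have hwW : w ∈ O ∩ W := hOW ▸ mem_singleton w
  have hv0 : ∀ i, realVec (v i) ≠ 0 := fun i => realVec_ne_zero (hσ.primitive i)
  have hpos : ∀ i, ∀ s ∈ Ioc (0 : ℝ) 1, 0 < h i s := fun i s hs => by
    have := hσ.strictMonoOn i ⟨le_rfl, zero_le_one⟩ ⟨hs.1.le, hs.2⟩ hs.1
    rwa [hσ.height_zero] at this
  have harc : ∀ i, ∀ s ∈ Ioo (0 : ℝ) 1, σ (Pi.single i s) ∈ O ∩ (S \ W) := fun i s hs => by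
    have h1 : σ (Pi.single i s) ∈ O ∩ S :=
      hOS ▸ ⟨_, single_mem_tripod i ⟨hs.1.le, hs.2⟩, rfl⟩
    refine ⟨h1.1, h1.2, fun hW => ?_⟩
    have h2 : σ (Pi.single i s) = w := by
      have : σ (Pi.single i s) ∈ O ∩ W := ⟨h1.1, hW⟩
      rwa [hOW] at this
    have h3 := hσ.nu_eq i s ⟨hs.1.le, hs.2.le⟩
    rw [h2, left_eq_add, smul_eq_zero] at h3
    exact h3.elim (hpos i s ⟨hs.1, hs.2.le⟩).ne' (hv0 i)
  have hcσ : ∀ i, ContinuousOn (fun s : ℝ => σ (Pi.single i s)) (Icc 0 1) := fun i =>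
    hσ.continuousOn.comp (f := fun s : ℝ => (Pi.single i s : Fin 3 → ℝ))
      (continuous_single (A := fun _ : Fin 3 => ℝ) i).continuousOn
      fun s hs => closedTripod_subset_Icc (single_mem_closedTripod i hs)
  have hhalf : (1 / 2 : ℝ) ∈ Ioo (0 : ℝ) 1 := by norm_num
  let x : Fin 3 → Q := fun i => σ (Pi.single i (1 / 2))
  have hx : ∀ i, x i ∈ S \ W := fun i => (harc i _ hhalf).2
  let e : Fin 3 → Set Q := fun i => connectedComponentIn (S \ W) (x i)
  have hxe : ∀ i, x i ∈ e i := fun i => mem_connectedComponentIn (hx i)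
  have harce : ∀ i, ∀ s ∈ Ioo (0 : ℝ) 1, σ (Pi.single i s) ∈ e i := fun i s hs => by
    have hp : IsPreconnected ((fun s : ℝ => σ (Pi.single i s)) '' Ioo 0 1) :=
      isPreconnected_Ioo.image _ ((hcσ i).mono Ioo_subset_Icc_self)
    refine hp.subset_connectedComponentIn ⟨_, hhalf, rfl⟩ ?_ ⟨s, hs, rfl⟩
    rintro _ ⟨t, ht, rfl⟩
    exact (harc i t ht).2
  have hseg : ∀ i, ∃ f : Q → ℝ, Continuous f ∧ (∀ y t, ν y = ν w + t • realVec (v i) → f y = t) ∧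
      (∀ y ∈ e i, ν y = ν w + f y • realVec (v i)) ∧
      Topology.IsOpenEmbedding ((e i).domRestrict f) := fun i => by
    have hk : κ (x i) = Submodule.span ℝ {realVec (v i)} := hσ.ker_eq i _ hhalf
    refine (exists_segment_of_isEdgeArc hν hE (hx i) (hv0 i) hk ?_).2
    rw [hk, hσ.nu_eq i _ ⟨hhalf.1.le, hhalf.2.le⟩, add_sub_cancel_left]
    exact Submodule.smul_mem _ _ (Submodule.mem_span_singleton_self _)
  choose f hf hft hfe hemb using hseg
  have hfσ : ∀ i, ∀ s ∈ Icc (0 : ℝ) 1, f i (σ (Pi.single i s)) = h i s := fun i s hs =>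
    hft i _ _ (hσ.nu_eq i s hs)
  have htend : ∀ i, Tendsto (fun s : ℝ => σ (Pi.single i s)) (𝓝[>] 0) (𝓝 w) := fun i => by
    have h1 : ContinuousWithinAt (fun s : ℝ => σ (Pi.single i s)) (Icc 0 1) 0 :=
      hcσ i 0 ⟨le_rfl, zero_le_one⟩
    have h2 : Tendsto (fun s : ℝ => σ (Pi.single i s)) (𝓝[Icc 0 1] 0) (𝓝 w) := by
      simpa [ContinuousWithinAt, hσ.map_zero] using h1
    refine h2.mono_left ?_
    rw [← nhdsWithin_Ioo_eq_nhdsGT (zero_lt_one)]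
    exact nhdsWithin_mono _ Ioo_subset_Icc_self
  have hev : ∀ᶠ s : ℝ in 𝓝[>] 0, s ∈ Ioo (0 : ℝ) 1 := Ioo_mem_nhdsGT zero_lt_one
  have hfw : ∀ i, f i w = 0 := fun i => hft i w 0 (by simp)
  -- An edge cannot run through or past its vertex. Its parameter interval contains positive values,
  -- so a nonpositive one would give a point `y` of the edge at parameter `0`. As `f i` embeds the
  -- edge, the leg would converge to `y` when `s → 0`, but it converges to `w`, which is not in `S \
  -- W`.
  have hJpos : ∀ i, ∀ t ∈ f i '' e i, 0 < t := by
    intro i t ht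
    by_contra! ht0
    have hoc : (f i '' e i).OrdConnected :=
      (isPreconnected_connectedComponentIn.image _ (hf i).continuousOn).ordConnected
    have hm : h i (1 / 2) ∈ f i '' e i :=
      ⟨_, hxe i, hfσ i _ ⟨hhalf.1.le, hhalf.2.le⟩⟩
    obtain ⟨y, hy, hy0⟩ := hoc.out ht hm ⟨ht0, (hpos i _ ⟨hhalf.1, hhalf.2.le⟩).le⟩
    have h1 : Tendsto (fun s : ℝ => f i (σ (Pi.single i s))) (𝓝[>] 0) (𝓝 (f i y)) := by
      have := ((hf i).tendsto w).comp (htend i)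
      rw [hfw i] at this
      rw [hy0]
      exact this
    have h2 : Tendsto (fun s : ℝ => σ (Pi.single i s)) (𝓝[>] 0) (𝓝 y) := by
      have hex : ∀ s : ℝ, ∃ z : e i, s ∈ Ioo (0 : ℝ) 1 → (z : Q) = σ (Pi.single i s) := by
        intro s
        by_cases hs : s ∈ Ioo (0 : ℝ) 1
        · exact ⟨⟨_, harce i s hs⟩, fun _ => rfl⟩
        · exact ⟨⟨y, hy⟩, fun h => (hs h).elim⟩
      choose z hz using hex
      have h3 : Tendsto (fun s => (e i).domRestrict (f i) (z s)) (𝓝[>] 0)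
          (𝓝 ((e i).domRestrict (f i) ⟨y, hy⟩)) := by
        refine h1.congr' ?_
        filter_upwards [hev] with s hs
        simp only [domRestrict_apply]
        rw [hz s hs]
      have h4 : Tendsto z (𝓝[>] 0) (𝓝 ⟨y, hy⟩) :=
        (hemb i).toIsEmbedding.toIsInducing.tendsto_nhds_iff.2 h3
      refine ((continuous_subtype_val.tendsto _).comp h4).congr' ?_
      filter_upwards [hev] with s hs using hz s hs
    have hyw : y = w := tendsto_nhds_unique h2 (htend i)
    exact (connectedComponentIn_subset _ _ hy).2 (hyw ▸ hwW.2)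
  refine ⟨e, ?_, ?_, fun i => ⟨f i '' e i, ?_, ?_, ⟨_, x i, hxe i, rfl⟩, ⟨?_, ?_⟩,
    mapsOntoSegment_of_isOpenEmbedding hν (hv0 i) (hfe i) (hemb i)⟩, ?_⟩
  -- If two of the edges coincided, one leg would have a point of positive height lying on both
  -- lines through `ν w`, against independence of the directions.
  · intro i j hij
    by_contra hne
    have h1 := hfe j (x i) (hij ▸ hxe i)
    rw [hσ.nu_eq i _ ⟨hhalf.1.le, hhalf.2.le⟩, add_right_inj] at h1
    exact (hpos i _ ⟨hhalf.1, hhalf.2.le⟩).ne' (hσ.indep i j hne _ _ h1).1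
  · intro e'
    constructor
    · rintro ⟨⟨y, hy, rfl⟩, hw⟩
      obtain ⟨z, hzO, hz⟩ := mem_closure_iff.1 hw O hO hwW.1
      have hzSW := connectedComponentIn_subset _ _ hz
      have : z ∈ σ '' tripod := hOS ▸ ⟨hzO, hzSW.1⟩
      obtain ⟨t, ht, rfl⟩ := this
      obtain ⟨i, s, hs, rfl⟩ := exists_eq_single_of_mem_tripod ht
      have hs0 : s ≠ 0 := by
        rintro rfl
        rw [Pi.single_zero, hσ.map_zero] at hzSW
        exact hzSW.2 hwW.2
      refine ⟨i, ?_⟩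
      rw [connectedComponentIn_eq hz]
      exact (connectedComponentIn_eq (harce i s ⟨lt_of_le_of_ne hs.1 hs0.symm, hs.2⟩)).symm
    · rintro ⟨i, rfl⟩
      refine ⟨⟨x i, hx i, rfl⟩, mem_closure_of_tendsto (htend i) ?_⟩
      filter_upwards [hev] with s hs using harce i s hs
  · rw [← range_domRestrict]; exact (hemb i).isOpen_range
  · exact (isPreconnected_connectedComponentIn.image _ (hf i).continuousOn).ordConnected
  · exact fun t ht => (hJpos i t ht).le
  · intro b hb
    have h1 : Tendsto (fun s : ℝ => f i (σ (Pi.single i s))) (𝓝[>] 0) (𝓝 0) := by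
      have := ((hf i).tendsto w).comp (htend i)
      rwa [hfw i] at this
    refine ge_of_tendsto h1 ?_
    filter_upwards [hev] with s hs using hb ⟨_, harce i s hs, rfl⟩
  · have hli : LinearIndependent ℝ ![realVec (v 0), realVec (v 1)] := by
      rw [LinearIndependent.pair_iff]
      intro s t hst
      have h1 : s • realVec (v 0) = (-t) • realVec (v 1) := by
        rw [neg_smul]; exact eq_neg_of_add_eq_zero_left hst
      have := hσ.indep 0 1 (by decide) _ _ h1
      exact ⟨this.1, by linarith [this.2]⟩
    refine ⟨AffineSubspace.mk' (ν w) (Submodule.span ℝ (range ![realVec (v 0), realVec (v 1)])),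
      ?_, ?_⟩
    · rw [AffineSubspace.direction_mk', finrank_span_eq_card hli]; simp
    · rintro i _ ⟨y, hy, rfl⟩
      rw [hfe i y hy]
      have hm : ∀ i, realVec (v i) ∈
          Submodule.span ℝ (range ![realVec (v 0), realVec (v 1)]) := by
        have h0 : realVec (v 0) ∈ Submodule.span ℝ (range ![realVec (v 0), realVec (v 1)]) :=
          Submodule.subset_span ⟨0, rfl⟩
        have h1 : realVec (v 1) ∈ Submodule.span ℝ (range ![realVec (v 0), realVec (v 1)]) :=
          Submodule.subset_span ⟨1, rfl⟩
        intro i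
        fin_cases i
        · exact h0
        · exact h1
        · have : realVec (v 2) = -(realVec (v 0) + realVec (v 1)) := by
            funext j
            have := congrFun hσ.sum_eq_zero j
            simp only [Fin.sum_univ_three, Pi.add_apply, Pi.zero_apply] at this
            have h3 : ((v 0 j : ℤ) : ℝ) + v 1 j + v 2 j = 0 := by exact_mod_cast this
            simp only [realVec, Pi.neg_apply, Pi.add_apply]
            linarith
          change realVec (v 2) ∈ _
          rw [this]
          exact Submodule.neg_mem _ (Submodule.add_mem _ h0 h1)
      rw [SetLike.mem_coe, AffineSubspace.mem_mk', vsub_eq_sub, add_sub_cancel_left]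
      exact Submodule.smul_mem _ _ (hm i)

end GraphOfLocalData

/-! ### The cross product on `ℝ⁷` -/

section Cross

/-- The cross product on `ℝ⁷`, given by `⟪X × Y, Z⟫ = φ₀(X, Y, Z)`. -/
def cross (X Y : E7) : E7 :=
  !₂[(X 1 * Y 2 - X 2 * Y 1) - (X 3 * Y 4 - X 4 * Y 3) - (X 5 * Y 6 - X 6 * Y 5),
    (X 2 * Y 0 - X 0 * Y 2) - (X 3 * Y 5 - X 5 * Y 3) - (X 6 * Y 4 - X 4 * Y 6),
    (X 0 * Y 1 - X 1 * Y 0) - (X 3 * Y 6 - X 6 * Y 3) - (X 4 * Y 5 - X 5 * Y 4),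
    - (X 4 * Y 0 - X 0 * Y 4) - (X 5 * Y 1 - X 1 * Y 5) - (X 6 * Y 2 - X 2 * Y 6),
    - (X 0 * Y 3 - X 3 * Y 0) - (X 1 * Y 6 - X 6 * Y 1) - (X 5 * Y 2 - X 2 * Y 5),
    - (X 6 * Y 0 - X 0 * Y 6) - (X 1 * Y 3 - X 3 * Y 1) - (X 2 * Y 4 - X 4 * Y 2),
    - (X 0 * Y 5 - X 5 * Y 0) - (X 4 * Y 1 - X 1 * Y 4) - (X 2 * Y 3 - X 3 * Y 2)]

theorem inner_E7 (X Y : E7) : inner ℝ X Y = X 0 * Y 0 + X 1 * Y 1 + X 2 * Y 2 + X 3 * Y 3 +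
    X 4 * Y 4 + X 5 * Y 5 + X 6 * Y 6 := by
  simp [PiLp.inner_apply, Fin.sum_univ_seven]; ring

theorem phi0_eq_inner_cross (X Y Z : E7) :
    phi0 ![WithLp.ofLp X, WithLp.ofLp Y, WithLp.ofLp Z] = inner ℝ (cross X Y) Z := by
  rw [inner_E7]
  simp only [phi0, ContinuousAlternatingMap.sub_apply, ContinuousAlternatingMap.add_apply,
    coordForm_apply, Matrix.det_fin_three, Matrix.of_apply, cross]
  simp
  ring

theorem cross_add (X Y Z : E7) : cross X (Y + Z) = cross X Y + cross X Z := by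
  ext i; fin_cases i <;> simp [cross] <;> ring

theorem cross_smul (c : ℝ) (X Y : E7) : cross X (c • Y) = c • cross X Y := by
  ext i; fin_cases i <;> simp [cross] <;> ring

theorem cross_swap (X Y : E7) : cross X Y = -cross Y X := by
  ext i; fin_cases i <;> simp [cross] <;> ring

/-- For a unit vector `u` this says that `u × ·` squares to `-1` on the orthogonal complement of
`u`. Together with cyclic symmetry it replaces coordinates in the norm and anticommutation
identities for the cross product used later. -/
theorem cross_cross_self (X Y : E7) :
    cross X (cross X Y) = (inner ℝ X Y : ℝ) • X - (inner ℝ X X : ℝ) • Y := by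
  rw [inner_E7, inner_E7]
  ext i; fin_cases i <;> simp [cross] <;> ring

theorem inner_cross_rotate (X Y Z : E7) :
    (inner ℝ (cross X Y) Z : ℝ) = inner ℝ (cross Y Z) X := by
  rw [inner_E7, inner_E7]
  simp [cross]; ring

/-- The cross product with a fixed vector, as a linear map. -/
def crossL (u : E7) : E7 →ₗ[ℝ] E7 where
  toFun := cross u
  map_add' := cross_add u
  map_smul' c X := cross_smul c u X

theorem cross_self (X : E7) : cross X X = 0 := by
  ext i; fin_cases i <;> simp [cross] <;> ring

theorem add_cross (X Y Z : E7) : cross (X + Y) Z = cross X Z + cross Y Z := by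
  rw [cross_swap, cross_add, neg_add, ← cross_swap, ← cross_swap]

theorem smul_cross (c : ℝ) (X Y : E7) : cross (c • X) Y = c • cross X Y := by
  rw [cross_swap, cross_smul, ← smul_neg, ← cross_swap]

theorem inner_cross_self_right (X Y : E7) : (inner ℝ (cross X Y) Y : ℝ) = 0 := by
  rw [inner_cross_rotate, cross_self, inner_zero_left]

theorem inner_cross_self_left (X Y : E7) : (inner ℝ (cross X Y) X : ℝ) = 0 := by
  rw [cross_swap, inner_neg_left, inner_cross_self_right, neg_zero]

theorem inner_cross_comm (u X Y : E7) : (inner ℝ (cross u X) Y : ℝ) = -inner ℝ X (cross u Y) := by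
  rw [inner_cross_rotate, cross_swap, inner_neg_left, ← inner_cross_rotate, real_inner_comm]

theorem inner_cross_cross (u X Y : E7) : (inner ℝ (cross u X) (cross u Y) : ℝ) =
    inner ℝ u u * inner ℝ X Y - inner ℝ u X * inner ℝ u Y := by
  rw [inner_cross_comm, cross_cross_self, inner_sub_right, inner_smul_right, inner_smul_right,
    real_inner_comm u X]
  ring

set_option maxHeartbeats 1000000 in
/-- An infinitesimal symmetry of `φ₀` is skew. -/
theorem skew_of_phi0 {A : E7 →ₗ[ℝ] E7} (hA : ∀ X Y Z : E7, (inner ℝ (cross (A X) Y) Z : ℝ) +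
    inner ℝ (cross X (A Y)) Z + inner ℝ (cross X Y) (A Z) = 0) (X Y : E7) :
    (inner ℝ (A X) Y : ℝ) = -inner ℝ X (A Y) := by
  let e : Fin 7 → E7 := fun i => EuclideanSpace.single i 1
  -- The 35 increasing triples of basis vectors give linear equations in the entries of `A`, and
  -- antisymmetry is a linear combination of them.
  have key : ∀ i j, A (e i) j = - A (e j) i := by
    have h : ∀ i j k, (inner ℝ (cross (A (e i)) (e j)) (e k) : ℝ) +
      inner ℝ (cross (e i) (A (e j))) (e k) + inner ℝ (cross (e i) (e j)) (A (e k)) = 0 :=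
      fun i j k => hA _ _ _
    have h012 := h 0 1 2
    have h013 := h 0 1 3
    have h014 := h 0 1 4
    have h015 := h 0 1 5
    have h016 := h 0 1 6
    have h023 := h 0 2 3
    have h024 := h 0 2 4
    have h025 := h 0 2 5
    have h026 := h 0 2 6
    have h034 := h 0 3 4
    have h035 := h 0 3 5
    have h036 := h 0 3 6
    have h045 := h 0 4 5
    have h046 := h 0 4 6
    have h056 := h 0 5 6
    have h123 := h 1 2 3
    have h124 := h 1 2 4
    have h125 := h 1 2 5
    have h126 := h 1 2 6
    have h134 := h 1 3 4
    have h135 := h 1 3 5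
    have h136 := h 1 3 6
    have h145 := h 1 4 5
    have h146 := h 1 4 6
    have h156 := h 1 5 6
    have h234 := h 2 3 4
    have h235 := h 2 3 5
    have h236 := h 2 3 6
    have h245 := h 2 4 5
    have h246 := h 2 4 6
    have h256 := h 2 5 6
    have h345 := h 3 4 5
    have h346 := h 3 4 6
    have h356 := h 3 5 6
    have h456 := h 4 5 6
    clear h hA
    simp only [inner_E7] at *
    simp [cross, e] at *
    intro i j
    fin_cases i <;> fin_cases j <;> simp <;> linarith
  have hX : ∀ X : E7, X = ∑ i, X i • e i := fun X => by
    ext j; simp [e, Finset.sum_apply, Pi.single_apply]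
  have hc : ∀ (X : E7) j, A X j = ∑ i, X i * A (e i) j := fun X j => by
    conv_lhs => rw [hX X]
    simp [map_sum, Finset.sum_apply]
  simp only [PiLp.inner_apply, hc X, hc Y, RCLike.inner_apply, conj_trivial, Finset.mul_sum,
    Finset.sum_mul, ← Finset.sum_neg_distrib]
  rw [Finset.sum_comm]
  refine Finset.sum_congr rfl fun i _ => Finset.sum_congr rfl fun j _ => ?_
  rw [key i j]; ring

theorem map_cross_of_phi0 {A : E7 →ₗ[ℝ] E7} (hA : ∀ X Y Z : E7,
    (inner ℝ (cross (A X) Y) Z : ℝ) + inner ℝ (cross X (A Y)) Z + inner ℝ (cross X Y) (A Z) = 0)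
    (X Y : E7) : A (cross X Y) = cross (A X) Y + cross X (A Y) := by
  refine ext_inner_right ℝ fun Z => ?_
  rw [skew_of_phi0 hA, inner_add_left, hA X Y Z |> eq_neg_of_add_eq_zero_left]

end Cross

/-! ### Commuting symmetric and skew operators -/

section Operators

variable {V : Type*} [NormedAddCommGroup V] [InnerProductSpace ℝ V] [FiniteDimensional ℝ V]

/-- Induction on the dimension of `W`. If every operator is scalar on `W`, any unit vector serves;
otherwise some operator has a proper nonzero eigenspace in `W`, and the others preserve it because
they commute with it. The family may be infinite. -/
theorem exists_joint_eigenvector {ι : Type*} (T : ι → V →ₗ[ℝ] V) (hs : ∀ i, (T i).IsSymmetric)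
    (hc : ∀ i j x, T i (T j x) = T j (T i x)) (W : Submodule ℝ V) (hW : W ≠ ⊥)
    (hT : ∀ i, ∀ x ∈ W, T i x ∈ W) : ∃ v ∈ W, ‖v‖ = 1 ∧ ∀ i, ∃ c : ℝ, T i v = c • v := by
  induction hn : finrank ℝ W using Nat.strong_induction_on generalizing W with
  | _ n ih =>
  by_cases hscal : ∀ i, ∃ c : ℝ, ∀ x ∈ W, T i x = c • x
  · obtain ⟨x, hx, hx0⟩ := W.exists_mem_ne_zero_of_ne_bot hW
    have hn : ‖x‖ ≠ 0 := norm_ne_zero_iff.2 hx0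
    refine ⟨‖x‖⁻¹ • x, W.smul_mem _ hx, by simp [norm_smul, hn], fun i => ?_⟩
    obtain ⟨c, hc⟩ := hscal i
    exact ⟨c, hc _ (W.smul_mem _ hx)⟩
  · push Not at hscal
    obtain ⟨i, hi⟩ := hscal
    have hsym := (hs i).restrict_invariant (hT i)
    have hnt : Nontrivial W := Submodule.nontrivial_iff_ne_bot.2 hW
    obtain ⟨c, hcE⟩ : ∃ c, Module.End.eigenspace ((T i).restrict (hT i)) c ≠ ⊥ := by
      by_contra! h
      exact not_subsingleton W (hsym.subsingleton_of_no_eigenvalue_finiteDimensional h)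
    obtain ⟨y, hy, hy0⟩ := Submodule.exists_mem_ne_zero_of_ne_bot hcE
    rw [Module.End.mem_eigenspace_iff] at hy
    have hy' : T i y = c • (y : V) := congrArg Subtype.val hy
    let W' : Submodule ℝ V := W ⊓ Module.End.eigenspace (T i) c
    have hlt : W' < W := by
      refine lt_of_le_of_ne inf_le_left fun h => ?_
      obtain ⟨x, hx, hne⟩ := hi c
      have : x ∈ W' := h ▸ hx
      exact hne (Module.End.mem_eigenspace_iff.1 this.2)
    obtain ⟨v, hv, h1, h2⟩ := ih (finrank ℝ W') (hn ▸ Submodule.finrank_lt_finrank_of_lt hlt) W'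
      (fun h => hy0 (Subtype.ext ((Submodule.mem_bot ℝ).1
        (h ▸ ⟨y.2, Module.End.mem_eigenspace_iff.2 hy'⟩ : (y : V) ∈ (⊥ : Submodule ℝ V)))))
      (fun j x hx => ⟨hT j x hx.1, Module.End.mem_eigenspace_iff.2 (by
        rw [hc, Module.End.mem_eigenspace_iff.1 hx.2, map_smul])⟩) rfl
    exact ⟨v, hv.1, h1, h2⟩

/-- A skew matrix of size `n` satisfies `det B = (-1)ⁿ det B`, and the determinant does not vanish.
-/
theorem even_finrank_of_injective_skew (B : V →ₗ[ℝ] V)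
    (hB : ∀ x y, (inner ℝ (B x) y : ℝ) = -inner ℝ x (B y)) (hi : Function.Injective B) :
    Even (finrank ℝ V) := by
  let b := stdOrthonormalBasis ℝ V
  have h1 : (LinearMap.toMatrix b.toBasis b.toBasis B).transpose =
      -LinearMap.toMatrix b.toBasis b.toBasis B := by
    ext i j
    simp only [Matrix.transpose_apply, Matrix.neg_apply, LinearMap.toMatrix_apply,
      OrthonormalBasis.coe_toBasis, OrthonormalBasis.coe_toBasis_repr_apply,
      OrthonormalBasis.repr_apply_apply]
    rw [← neg_eq_iff_eq_neg, ← hB, real_inner_comm]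
  have h2 : LinearMap.det B = (-1) ^ finrank ℝ V * LinearMap.det B := by
    conv_lhs => rw [← LinearMap.det_toMatrix b.toBasis, ← Matrix.det_transpose, h1,
      Matrix.det_neg, LinearMap.det_toMatrix]
    simp
  have h3 : LinearMap.det B ≠ 0 := by
    intro h
    have := LinearMap.bot_lt_ker_of_det_eq_zero h
    rw [LinearMap.ker_eq_bot.2 hi] at this
    exact lt_irrefl _ this
  by_contra hodd
  rw [Nat.not_even_iff_odd] at hodd
  rw [hodd.neg_one_pow] at h2
  exact h3 (by linarith)

/-- The kernel of a skew operator is orthogonal to its range, so the operator is injective on its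
range, which therefore has even dimension. Rank and nullity leave an odd kernel, which permits
iteration. -/
theorem odd_finrank_inf_ker_of_skew (B : V →ₗ[ℝ] V)
    (hB : ∀ x y, (inner ℝ (B x) y : ℝ) = -inner ℝ x (B y)) (W : Submodule ℝ V)
    (hW : ∀ x ∈ W, B x ∈ W) (hodd : Odd (finrank ℝ W)) :
    Odd (finrank ℝ (W ⊓ LinearMap.ker B : Submodule ℝ V)) := by
  let C : W →ₗ[ℝ] W := B.restrict hW
  have hC : ∀ x y, (inner ℝ (C x) y : ℝ) = -inner ℝ x (C y) := fun x y => hB x y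
  have hCr : ∀ x ∈ LinearMap.range C, C x ∈ LinearMap.range C := fun x _ => ⟨x, rfl⟩
  have h1 : Even (finrank ℝ (LinearMap.range C)) := by
    let D : LinearMap.range C →ₗ[ℝ] LinearMap.range C := C.restrict hCr
    have hD : ∀ x y, (inner ℝ (D x) y : ℝ) = -inner ℝ x (D y) := fun x y => hC x y
    refine even_finrank_of_injective_skew (V := LinearMap.range C) D hD ?_
    rw [← LinearMap.ker_eq_bot, LinearMap.ker_eq_bot']
    rintro ⟨_, x, rfl⟩ hx
    have h0 : C (C x) = 0 := congrArg Subtype.val hx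
    have : (inner ℝ (C x) (C x) : ℝ) = 0 := by rw [hC, h0, inner_zero_right, neg_zero]
    exact Subtype.ext (inner_self_eq_zero.1 this)
  have h2 := LinearMap.finrank_range_add_finrank_ker C
  have h3 : finrank ℝ (LinearMap.ker C) = finrank ℝ (W ⊓ LinearMap.ker B : Submodule ℝ V) := by
    have : (LinearMap.ker C).map W.subtype = W ⊓ LinearMap.ker B := by
      ext x
      simp only [Submodule.mem_map, LinearMap.mem_ker, Submodule.mem_inf]
      constructor
      · rintro ⟨y, hy, rfl⟩
        exact ⟨y.2, congrArg Subtype.val hy⟩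
      · rintro ⟨hx, hBx⟩
        exact ⟨⟨x, hx⟩, Subtype.ext hBx, rfl⟩
    rw [← this]
    exact (Submodule.equivMapOfInjective W.subtype W.injective_subtype _).finrank_eq
  rw [← h3]
  rw [← h2, Nat.odd_add] at hodd
  by_contra hev
  exact (Nat.not_odd_iff_even.2 h1) (hodd.2 (Nat.not_odd_iff_even.1 hev))

/-- Three commuting skew operators on an odd-dimensional space have a common null vector. -/
theorem exists_common_null_vector (B : Fin 3 → V →ₗ[ℝ] V)
    (hB : ∀ i x y, (inner ℝ (B i x) y : ℝ) = -inner ℝ x (B i y))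
    (hc : ∀ i j x, B i (B j x) = B j (B i x)) (hodd : Odd (finrank ℝ V)) :
    ∃ u : V, ‖u‖ = 1 ∧ ∀ i, B i u = 0 := by
  have hker : ∀ i j, ∀ x ∈ LinearMap.ker (B i), B j x ∈ LinearMap.ker (B i) := fun i j x hx => by
    rw [LinearMap.mem_ker, hc, LinearMap.mem_ker.1 hx, map_zero]
  have h0 := odd_finrank_inf_ker_of_skew (B 0) (hB 0) ⊤ (fun _ _ => trivial) (by simpa using hodd)
  have h1 := odd_finrank_inf_ker_of_skew (B 1) (hB 1) (⊤ ⊓ LinearMap.ker (B 0))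
    (fun x hx => ⟨trivial, hker 0 1 x hx.2⟩) h0
  have h2 := odd_finrank_inf_ker_of_skew (B 2) (hB 2)
    (⊤ ⊓ LinearMap.ker (B 0) ⊓ LinearMap.ker (B 1)) (fun x hx => ⟨⟨trivial, hker 0 2 x hx.1.2⟩, hker 1 2 x hx.2⟩) h1
  obtain ⟨u, hu, hu0⟩ := Submodule.exists_mem_ne_zero_of_ne_bot (p := (⊤ ⊓ LinearMap.ker (B 0)) ⊓
    LinearMap.ker (B 1) ⊓ LinearMap.ker (B 2)) (fun h => by rw [h, finrank_bot] at h2; simp at h2)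
  have hn : ‖u‖ ≠ 0 := norm_ne_zero_iff.2 hu0
  refine ⟨‖u‖⁻¹ • u, by simp [norm_smul, hn], fun i => ?_⟩
  rw [map_smul]
  have : B i u = 0 := by
    fin_cases i
    · exact hu.1.1.2
    · exact hu.1.2
    · exact hu.2
  rw [this, smul_zero]

end Operators

/-! ### Weights of a commuting family of infinitesimal symmetries of `φ₀` -/

section Weights

variable {𝔥 : Type*} [AddCommGroup 𝔥] [Module ℝ 𝔥]

/-- A commuting family of infinitesimal symmetries of `φ₀` that annihilate the unit vector `u`. -/
structure IsToralFamily (A : 𝔥 →ₗ[ℝ] E7 →ₗ[ℝ] E7) (u : E7) : Prop where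
  comm : ∀ a b x, A a (A b x) = A b (A a x)
  phi0 : ∀ a (X Y Z : E7), (inner ℝ (cross (A a X) Y) Z : ℝ) + inner ℝ (cross X (A a Y)) Z +
    inner ℝ (cross X Y) (A a Z) = 0
  norm_eq_one : ‖u‖ = 1
  map_eq_zero : ∀ a, A a u = 0

/-- `v` is a unit weight vector orthogonal to `u`, with weight `α`. -/
structure IsWeightVector (A : 𝔥 →ₗ[ℝ] E7 →ₗ[ℝ] E7) (u v : E7) (α : 𝔥 →ₗ[ℝ] ℝ) : Prop where
  norm_eq_one : ‖v‖ = 1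
  inner_eq_zero : (inner ℝ u v : ℝ) = 0
  apply_eq : ∀ a, A a v = α a • cross u v

variable {A : 𝔥 →ₗ[ℝ] E7 →ₗ[ℝ] E7} {u : E7}

namespace IsToralFamily

theorem skew (h : IsToralFamily A u) (a : 𝔥) (X Y : E7) :
    (inner ℝ (A a X) Y : ℝ) = -inner ℝ X (A a Y) := skew_of_phi0 (h.phi0 a) X Y

theorem map_cross (h : IsToralFamily A u) (a : 𝔥) (X Y : E7) :
    A a (cross X Y) = cross (A a X) Y + cross X (A a Y) := map_cross_of_phi0 (h.phi0 a) X Y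

theorem map_cross_u (h : IsToralFamily A u) (a : 𝔥) (X : E7) :
    A a (cross u X) = cross u (A a X) := by
  rw [h.map_cross, h.map_eq_zero, ← zero_smul ℝ (0 : E7), smul_cross, zero_smul, zero_add]

theorem inner_u (h : IsToralFamily A u) (a : 𝔥) (X : E7) : (inner ℝ u (A a X) : ℝ) = 0 := by
  have := h.skew a u X
  rw [h.map_eq_zero, inner_zero_left] at this
  linarith

theorem inner_self_u (h : IsToralFamily A u) : (inner ℝ u u : ℝ) = 1 := by
  rw [real_inner_self_eq_norm_sq, h.norm_eq_one]; norm_num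

theorem cross_u_cross_u (h : IsToralFamily A u) {X : E7} (hX : (inner ℝ u X : ℝ) = 0) :
    cross u (cross u X) = -X := by
  rw [cross_cross_self, hX, h.inner_self_u]; simp

/-- Each `A a` is skew and commutes with the complex structure `u × ·`, so the operators `-(u × A a
·)` are symmetric and commute. A common eigenvector of these is a weight vector. -/
theorem exists_isWeightVector (h : IsToralFamily A u) (W : Submodule ℝ E7) (hW : W ≠ ⊥)
    (hWu : ∀ x ∈ W, (inner ℝ u x : ℝ) = 0) (hA : ∀ a, ∀ x ∈ W, A a x ∈ W)
    (hJ : ∀ x ∈ W, cross u x ∈ W) : ∃ v ∈ W, ∃ α, IsWeightVector A u v α := by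
  let T : 𝔥 → E7 →ₗ[ℝ] E7 := fun a => -(crossL u ∘ₗ A a)
  have hT : ∀ a x, T a x = -cross u (A a x) := fun a x => rfl
  have hneg : ∀ X, cross u (-X) = -cross u X := fun X => (crossL u).map_neg X
  obtain ⟨v, hv, h1, h2⟩ := exists_joint_eigenvector T
    (fun a X Y => by
      change inner ℝ (T a X) Y = inner ℝ X (T a Y)
      rw [hT, hT, inner_neg_left, inner_cross_comm, neg_neg, h.skew, h.map_cross_u,
        inner_neg_right])
    (fun a b x => by
      simp only [hT, map_neg, hneg, h.map_cross_u, h.comm a b]) W hW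
    (fun a x hx => W.neg_mem (hJ _ (hA a x hx)))
  have hvv : (inner ℝ v v : ℝ) = 1 := by rw [real_inner_self_eq_norm_sq, h1]; norm_num
  -- The eigenvalue is recovered as `⟪u × v, A a v⟫`, an expression that is visibly linear in `a`.
  refine ⟨v, hv, ((innerₗ E7 (cross u v)) ∘ₗ ((LinearMap.applyₗ v) ∘ₗ A)), h1, hWu v hv,
    fun a => ?_⟩
  obtain ⟨c, hc⟩ := h2 a
  have hAv : A a v = c • cross u v := by
    have h3 := h.cross_u_cross_u (h.inner_u a v)
    rw [hT] at hc
    rw [← cross_smul, ← hc, hneg, h3, neg_neg]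
  have hval : (inner ℝ (cross u v) (A a v) : ℝ) = c := by
    rw [hAv, inner_smul_right, inner_cross_cross, h.inner_self_u, hvv, hWu v hv]; ring
  change A a v = (inner ℝ (cross u v) (A a v) : ℝ) • cross u v
  rw [hval, hAv]

theorem apply_cross (h : IsToralFamily A u) {v : E7} {α : 𝔥 →ₗ[ℝ] ℝ}
    (hv : IsWeightVector A u v α) (a : 𝔥) : A a (cross u v) = -(α a) • v := by
  rw [h.map_cross_u, hv.apply_eq, cross_smul, h.cross_u_cross_u hv.inner_eq_zero, smul_neg,
    neg_smul]

/-- A linear map `ℝ ⊕ ℂ³ → ℝ⁷` built from a unit vector `u` and three vectors. -/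
def frameMap (u : E7) (v : Fin 3 → E7) : (ℝ × (Fin 3 → ℂ)) →ₗ[ℝ] E7 where
  toFun p := p.1 • u + ∑ j, ((p.2 j).re • v j + (p.2 j).im • cross u (v j))
  map_add' p q := by
    simp only [Prod.fst_add, Prod.snd_add, Pi.add_apply, Complex.add_re, Complex.add_im,
      Fin.sum_univ_three, add_smul]
    abel
  map_smul' c p := by
    simp only [Prod.smul_fst, Prod.smul_snd, Pi.smul_apply, Complex.real_smul, Complex.re_ofReal_mul,
      Complex.im_ofReal_mul, Fin.sum_univ_three, smul_eq_mul, mul_smul, RingHom.id_apply, smul_add]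

/-- Complete a unit weight vector `w` to a frame of weight vectors. -/
theorem exists_frame (h : IsToralFamily A u) {w : E7} {α₀ : 𝔥 →ₗ[ℝ] ℝ}
    (hw : IsWeightVector A u w α₀) :
    ∃ (v : Fin 3 → E7) (α : Fin 3 → 𝔥 →ₗ[ℝ] ℝ), v 0 = w ∧ α 0 = α₀ ∧ ∑ j, α j = 0 ∧
      (∀ j, IsWeightVector A u (v j) (α j)) ∧ Function.Bijective (frameMap u v) := by
  have huu := h.inner_self_u
  have hww : (inner ℝ w w : ℝ) = 1 := by
    rw [real_inner_self_eq_norm_sq, hw.norm_eq_one]; norm_num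
  have huw := hw.inner_eq_zero
  let W : Submodule ℝ E7 := (Submodule.span ℝ (range ![u, w, cross u w]))ᗮ
  have hmem : ∀ x, x ∈ W ↔ (inner ℝ u x : ℝ) = 0 ∧ (inner ℝ w x : ℝ) = 0 ∧
      (inner ℝ (cross u w) x : ℝ) = 0 := by
    intro x
    rw [Submodule.mem_orthogonal]
    constructor
    · intro hx
      exact ⟨hx _ (Submodule.subset_span ⟨0, rfl⟩), hx _ (Submodule.subset_span ⟨1, rfl⟩),
        hx _ (Submodule.subset_span ⟨2, rfl⟩)⟩
    · rintro ⟨h1, h2, h3⟩ y hy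
      induction hy using Submodule.span_induction with
      | mem y hy =>
        obtain ⟨i, rfl⟩ := hy
        fin_cases i
        · exact h1
        · exact h2
        · exact h3
      | zero => simp
      | add y z _ _ hy hz => rw [inner_add_left, hy, hz, add_zero]
      | smul c y _ hy => rw [inner_smul_left, hy, mul_zero]
  have hW : W ≠ ⊥ := by
    intro hbot
    have h1 := (Submodule.orthogonal_eq_bot_iff).1 hbot
    have h2 := finrank_range_le_card (R := ℝ) ![u, w, cross u w]
    rw [Set.finrank, h1, finrank_top, finrank_euclideanSpace] at h2
    simp at h2
  obtain ⟨v, hvW, β, hv⟩ := h.exists_isWeightVector W hW (fun x hx => ((hmem x).1 hx).1)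
    (fun a x hx => by
      obtain ⟨h1, h2, h3⟩ := (hmem x).1 hx
      refine (hmem _).2 ⟨h.inner_u a x, ?_, ?_⟩
      · have := h.skew a w x
        rw [hw.apply_eq, inner_smul_left, h3, mul_zero] at this
        linarith
      · have := h.skew a (cross u w) x
        rw [h.apply_cross hw, inner_smul_left, h2, mul_zero] at this
        linarith)
    (fun x hx => by
      obtain ⟨h1, h2, h3⟩ := (hmem x).1 hx
      refine (hmem _).2 ⟨?_, ?_, ?_⟩
      · rw [real_inner_comm, inner_cross_self_left]
      · have := inner_cross_comm u w x
        linarith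
      · rw [inner_cross_cross, h2, huw]; ring)
  obtain ⟨huv, hwv, hJwv⟩ := (hmem v).1 hvW
  have hvv : (inner ℝ v v : ℝ) = 1 := by
    rw [real_inner_self_eq_norm_sq, hv.norm_eq_one]; norm_num
  -- The third weight vector. Since `A a` is a derivation of the cross product and `u × z = -(w × (u
  -- × v)) = -((u × w) × v)`, its weight is minus the sum of the other two; the weights sum to zero
  -- by construction.
  set z := cross w v with hz
  have hzz : (inner ℝ z z : ℝ) = 1 := by
    rw [hz, inner_cross_cross, hww, hvv, hwv]; norm_num
  have huz : (inner ℝ u z : ℝ) = 0 := by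
    rw [real_inner_comm, hz, ← inner_cross_rotate, hJwv]
  have hwz : (inner ℝ w z : ℝ) = 0 := by rw [real_inner_comm, hz, inner_cross_self_left]
  have hvz : (inner ℝ v z : ℝ) = 0 := by rw [real_inner_comm, hz, inner_cross_self_right]
  -- the cross product anticommutes with `u × ·` in each slot
  have polar : ∀ X Y Z : E7, cross X (cross Y Z) + cross Y (cross X Z) =
      (inner ℝ X Z : ℝ) • Y + (inner ℝ Y Z : ℝ) • X - (2 * inner ℝ X Y : ℝ) • Z := by
    intro X Y Z
    have h1 := cross_cross_self (X + Y) Z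
    rw [add_cross, add_cross, cross_add, cross_add, cross_cross_self,
      cross_cross_self, inner_add_left, inner_add_left, inner_add_right, inner_add_right,
      real_inner_comm X Y] at h1
    rw [← sub_eq_zero] at h1 ⊢
    rw [← h1]
    module
  have hJz1 : cross u z = -cross w (cross u v) := by
    have := polar u w v
    rw [huv, hwv, huw] at this
    rw [hz, eq_neg_iff_add_eq_zero, this]; simp
  have hJz2 : cross u z = -cross (cross u w) v := by
    rw [hz, cross_swap w v, cross_swap (cross u w) v]
    have := polar u v w
    rw [huv, huw, real_inner_comm, hwv] at this
    have hneg : ∀ X Y, cross X (-Y) = -cross X Y := fun X Y => (crossL X).map_neg Y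
    rw [hneg, neg_neg, neg_eq_iff_add_eq_zero, this]; simp
  have hzw : IsWeightVector A u z (-(α₀ + β)) := by
    refine ⟨?_, huz, fun a => ?_⟩
    · rw [real_inner_self_eq_norm_sq] at hzz
      have := norm_nonneg z
      nlinarith
    · rw [hz, h.map_cross, hw.apply_eq, hv.apply_eq, smul_cross, cross_smul, ← hz,
        ← neg_eq_iff_eq_neg.2 hJz1, ← neg_eq_iff_eq_neg.2 hJz2]
      simp only [LinearMap.neg_apply, LinearMap.add_apply]
      module
  refine ⟨![w, v, z], ![α₀, β, -(α₀ + β)], rfl, rfl, ?_, ?_, ?_⟩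
  · simp [Fin.sum_univ_three]
  · intro j
    fin_cases j
    · exact hw
    · exact hv
    · exact hzw
  · have hvJw : (inner ℝ v (cross u w) : ℝ) = 0 := by rw [real_inner_comm, hJwv]
    have hJvw : (inner ℝ (cross u v) w : ℝ) = 0 := by rw [inner_cross_comm, hvJw, neg_zero]
    have hJzw : (inner ℝ (cross u z) w : ℝ) = 0 := by
      rw [hJz1, inner_neg_left, inner_cross_self_left, neg_zero]
    have hJzv : (inner ℝ (cross u z) v : ℝ) = 0 := by
      rw [hJz2, inner_neg_left, inner_cross_self_right, neg_zero]
    have hJwz : (inner ℝ (cross u w) z : ℝ) = 0 := by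
      rw [inner_cross_comm, real_inner_comm, hJzw, neg_zero]
    have hJvz : (inner ℝ (cross u v) z : ℝ) = 0 := by
      rw [inner_cross_comm, real_inner_comm, hJzv, neg_zero]
    -- The seven vectors `u, w, u×w, v, u×v, z, u×z` are orthonormal; pairing a null combination
    -- with each of them isolates its coefficients.
    have hinj : Function.Injective (frameMap u ![w, v, z]) := by
      rw [← LinearMap.ker_eq_bot, LinearMap.ker_eq_bot']
      rintro ⟨s, ζ⟩ hp
      have hp' : s • u + (((ζ 0).re • w + (ζ 0).im • cross u w) +
        ((ζ 1).re • v + (ζ 1).im • cross u v) + ((ζ 2).re • z + (ζ 2).im • cross u z)) = 0 := by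
        have : frameMap u ![w, v, z] (s, ζ) = _ := rfl
        simpa [frameMap, Fin.sum_univ_three] using hp
      have cu : ∀ X : E7, (inner ℝ (cross u X) u : ℝ) = 0 := fun X => inner_cross_self_left u X
      have cs : ∀ X : E7, (inner ℝ (cross u X) X : ℝ) = 0 := fun X => inner_cross_self_right u X
      have key : ∀ Y : E7, s * inner ℝ u Y + ((ζ 0).re * inner ℝ w Y +
        (ζ 0).im * inner ℝ (cross u w) Y + ((ζ 1).re * inner ℝ v Y +
        (ζ 1).im * inner ℝ (cross u v) Y) + ((ζ 2).re * inner ℝ z Y +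
        (ζ 2).im * inner ℝ (cross u z) Y)) = 0 := by
        intro Y
        have := congrArg (fun X : E7 => (inner ℝ X Y : ℝ)) hp'
        simpa [inner_add_left, inner_smul_left] using this
      have flip : ∀ X Y : E7, (inner ℝ X Y : ℝ) = 0 → (inner ℝ Y X : ℝ) = 0 := fun X Y hXY => by
        rw [real_inner_comm, hXY]
      have k0 := key u
      have k1 := key w
      have k2 := key (cross u w)
      have k3 := key v
      have k4 := key (cross u v)
      have k5 := key z
      have k6 := key (cross u z)
      simp only [inner_cross_cross, huu, hww, hvv, hzz, huw, huv, huz, hwv, hwz, hvz, hJwv, hvJw,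
        hJvw, hJzw, hJzv, hJwz, hJvz, cu, cs, flip _ _ (cu _), flip _ _ (cs _), flip _ _ huw,
        flip _ _ huv, flip _ _ huz, flip _ _ hwv, flip _ _ hwz, flip _ _ hvz,
        flip _ _ hJvw, flip _ _ hJzw, flip _ _ hJzv, flip _ _ hJwz, flip _ _ hJvz, mul_zero,
        add_zero, zero_add, mul_one, sub_zero] at k0 k1 k2 k3 k4 k5 k6
      refine Prod.ext k0 (funext fun j => ?_)
      fin_cases j
      · exact Complex.ext k1 k2
      · exact Complex.ext k3 k4
      · exact Complex.ext k5 k6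
    have hdim : finrank ℝ (ℝ × (Fin 3 → ℂ)) = finrank ℝ E7 := by
      simp [Module.finrank_prod, Module.finrank_pi_fintype, Complex.finrank_real_complex]
    exact ⟨hinj, (LinearMap.injective_iff_surjective_of_finrank_eq_finrank hdim).1 hinj⟩

theorem exists_isWeightVector_of_unit (h : IsToralFamily A u) : ∃ w α, IsWeightVector A u w α := by
  obtain ⟨v, -, α, hv⟩ := h.exists_isWeightVector (ℝ ∙ u)ᗮ (fun hbot => by
      have h1 := (Submodule.orthogonal_eq_bot_iff).1 hbot
      have h2 := finrank_span_le_card (R := ℝ) ({u} : Set E7)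
      rw [h1, finrank_top, finrank_euclideanSpace] at h2
      simp at h2)
    (fun x hx => (Submodule.mem_orthogonal_singleton_iff_inner_right).1 hx)
    (fun a x hx => (Submodule.mem_orthogonal_singleton_iff_inner_right).2 (h.inner_u a x))
    (fun x hx => (Submodule.mem_orthogonal_singleton_iff_inner_right).2
      (by rw [real_inner_comm, inner_cross_self_left]))
  exact ⟨v, α, hv⟩

/-- The family acts on the frame by its weights. -/
theorem apply_frameMap (h : IsToralFamily A u) {v : Fin 3 → E7} {α : Fin 3 → 𝔥 →ₗ[ℝ] ℝ}
    (hv : ∀ j, IsWeightVector A u (v j) (α j)) (a : 𝔥) (s : ℝ) (z : Fin 3 → ℂ) :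
    A a (frameMap u v (s, z)) = frameMap u v (0, fun j => Complex.I * α j a * z j) := by
  simp only [frameMap, LinearMap.coe_mk, AddHom.coe_mk, map_add, map_smul, map_sum,
    h.map_eq_zero, h.apply_cross (hv _), (hv _).apply_eq, smul_zero, zero_smul, zero_add]
  refine Finset.sum_congr rfl fun j _ => ?_
  simp [smul_smul]
  module

end IsToralFamily

end Weights

open Set Filter Module MeasureTheory

/-! ### Linearisation of a compact group action at a fixed point -/

section Linearization

variable {K : Type*} [CommGroup K] [TopologicalSpace K] [IsTopologicalGroup K] [CompactSpace K]
variable {E : Type*} [NormedAddCommGroup E] [NormedSpace ℝ E] [FiniteDimensional ℝ E]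

/-- Near a fixed point, a `C¹` action of a compact abelian group is conjugate to its derivative. -/
theorem exists_linearization {U : Set E} (hU : IsOpen U) {y₀ : E} (hy₀ : y₀ ∈ U)
    {θ : K → E → E} {D : K → E → E →L[ℝ] E}
    (hmul : ∀ k l, ∀ y ∈ U, θ (k * l) y = θ k (θ l y))
    (hone : ∀ y ∈ U, θ 1 y = y) (hfix : ∀ k, θ k y₀ = y₀)
    (hθ : ContinuousOn (fun x : K × E => θ x.1 x.2) (univ ×ˢ U))
    (hD : ContinuousOn (fun x : K × E => D x.1 x.2) (univ ×ˢ U))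
    (hder : ∀ k, ∀ y ∈ U, HasFDerivAt (θ k) (D k y) y) :
    ∃ L : E → E, ContDiffOn ℝ 1 L U ∧ L y₀ = 0 ∧
      HasFDerivAt L (ContinuousLinearMap.id ℝ E) y₀ ∧
      ∀ k, ∀ y ∈ U, L (θ k y) = D k y₀ (L y) := by
  borelize K
  let m : Measure K := Measure.haarMeasure ⊤
  have hm : m univ = 1 := by
    have := Measure.haarMeasure_self (K₀ := (⊤ : TopologicalSpace.PositiveCompacts K))
    simpa using this
  have : IsProbabilityMeasure m := ⟨hm⟩
  have hDmul : ∀ k l, D (k * l) y₀ = (D k y₀).comp (D l y₀) := fun k l => by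
    have h1 : HasFDerivAt (fun y => θ k (θ l y)) ((D k y₀).comp (D l y₀)) y₀ :=
      HasFDerivAt.comp y₀ (by rw [hfix]; exact hder k y₀ hy₀) (hder l y₀ hy₀)
    refine (hder (k * l) y₀ hy₀).unique (h1.congr_of_eventuallyEq ?_)
    filter_upwards [hU.mem_nhds hy₀] with y hy using hmul k l y hy
  have hDone : D 1 y₀ = ContinuousLinearMap.id ℝ E := by
    refine (hder 1 y₀ hy₀).unique ((hasFDerivAt_id y₀).congr_of_eventuallyEq ?_)
    filter_upwards [hU.mem_nhds hy₀] with y hy using hone y hy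
  have hcR : Continuous fun k : K => D k⁻¹ y₀ := by
    have : Continuous fun k : K => ((k⁻¹, y₀) : K × E) := by fun_prop
    exact hD.comp_continuous this fun k => ⟨trivial, hy₀⟩
  -- The conjugating map is the Haar average over `k` of "move by `k`, then undo its linear part".
  -- Its derivative at `y₀` averages `D k⁻¹ ∘ D k = id`.
  let F : E → K → E := fun y k => D k⁻¹ y₀ (θ k y - y₀)
  let F' : E → K → E →L[ℝ] E := fun y k => (D k⁻¹ y₀).comp (D k y)
  have hcF : ∀ y ∈ U, Continuous (F y) := fun y hy =>
    hcR.clm_apply ((hθ.comp_continuous (f := fun k : K => ((k, y) : K × E)) (by fun_prop)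
      fun k => ⟨trivial, hy⟩).sub continuous_const)
  have hcF' : ContinuousOn (fun x : K × E => F' x.2 x.1) (univ ×ˢ U) :=
    (hcR.comp continuous_fst).continuousOn.clm_comp hD
  have hcF'k : ∀ y ∈ U, Continuous (F' y) := fun y hy =>
    hcF'.comp_continuous (f := fun k : K => ((k, y) : K × E)) (by fun_prop) fun k => ⟨trivial, hy⟩
  have hbound : ∀ y ∈ U, ∃ ε > 0, ∃ C : ℝ, Metric.ball y ε ⊆ U ∧
      ∀ k, ∀ y' ∈ Metric.ball y ε, ‖F' y' k‖ ≤ C := by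
    intro y hy
    obtain ⟨ε, hε, hεU⟩ := Metric.isOpen_iff.1 hU y hy
    have hsub : Metric.closedBall y (ε / 2) ⊆ U :=
      (Metric.closedBall_subset_ball (by linarith)).trans hεU
    have hcomp : IsCompact ((univ : Set K) ×ˢ Metric.closedBall y (ε / 2)) :=
      isCompact_univ.prod (isCompact_closedBall y _)
    obtain ⟨C, hC⟩ := hcomp.exists_bound_of_continuousOn
      (hcF'.mono (prod_mono Subset.rfl hsub))
    exact ⟨ε / 2, by positivity, C, Metric.ball_subset_closedBall.trans hsub, fun k y' hy' =>
      hC (k, y') ⟨trivial, Metric.ball_subset_closedBall hy'⟩⟩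
  have hFder : ∀ k, ∀ y ∈ U, HasFDerivAt (fun y => F y k) (F' y k) y := fun k y hy =>
    (D k⁻¹ y₀).hasFDerivAt.comp y ((hder k y hy).sub_const y₀)
  let L : E → E := fun y => ∫ k, F y k ∂m
  have hL : ∀ y ∈ U, HasFDerivAt L (∫ k, F' y k ∂m) y := by
    intro y hy
    obtain ⟨ε, hε, C, hεU, hC⟩ := hbound y hy
    refine hasFDerivAt_integral_of_dominated_of_fderiv_le (bound := fun _ => C)
      (Metric.ball_mem_nhds y hε) ?_ ?_ ?_ ?_ (integrable_const C) ?_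
    · filter_upwards [hU.mem_nhds hy] with y' hy' using (hcF y' hy').aestronglyMeasurable
    · exact (hcF y hy).integrable_of_hasCompactSupport (HasCompactSupport.of_compactSpace _)
    · exact (hcF'k y hy).aestronglyMeasurable
    · exact Eventually.of_forall fun k y' hy' => hC k y' hy'
    · exact Eventually.of_forall fun k y' hy' => hFder k y' (hεU hy')
  have hLc : ContinuousOn (fun y => ∫ k, F' y k ∂m) U := by
    intro y hy
    obtain ⟨ε, hε, C, hεU, hC⟩ := hbound y hy
    refine ContinuousAt.continuousWithinAt (continuousAt_of_dominated (bound := fun _ => C)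
      ?_ ?_ (integrable_const C) ?_)
    · filter_upwards [hU.mem_nhds hy] with y' hy' using (hcF'k y' hy').aestronglyMeasurable
    · filter_upwards [Metric.ball_mem_nhds y hε] with y' hy' using
        Eventually.of_forall fun k => hC k y' hy'
    · refine Eventually.of_forall fun k => ?_
      have h1 : ContinuousOn (fun y => F' y k) U :=
        hcF'.comp (f := fun y : E => ((k, y) : K × E)) (by fun_prop) fun y hy => ⟨trivial, hy⟩
      exact h1.continuousAt (hU.mem_nhds hy)
  refine ⟨L, ?_, ?_, ?_, ?_⟩
  · rw [← zero_add (1 : ℕ∞ω), contDiffOn_succ_iff_fderiv_of_isOpen hU]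
    refine ⟨fun y hy => (hL y hy).differentiableAt.differentiableWithinAt, by simp, ?_⟩
    rw [contDiffOn_zero]
    exact hLc.congr fun y hy => (hL y hy).fderiv
  · simp [L, F, hfix]
  · have h1 := hL y₀ hy₀
    have h2 : ∀ k, F' y₀ k = ContinuousLinearMap.id ℝ E := fun k => by
      simp only [F']
      rw [← hDmul, inv_mul_cancel, hDone]
    simpa [h2] using h1
  · intro k y hy
    -- Equivariance is the change of variable `l ↦ k l`, under which Haar measure is invariant;
    -- commutativity turns the product `l k` into `k l`.
    have h1 : ∀ l, F (θ k y) l = D k y₀ (F y (k * l)) := fun l => by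
      simp only [F]
      rw [← hmul l k y hy, mul_comm l k, ← ContinuousLinearMap.comp_apply, ← hDmul, mul_inv,
        mul_inv_cancel_left]
    simp only [L, h1]
    have h2 : Integrable (fun l => F y (k * l)) m :=
      ((hcF y hy).comp (continuous_const_mul k)).integrable_of_hasCompactSupport
        (HasCompactSupport.of_compactSpace _)
    rw [ContinuousLinearMap.integral_comp_comm _ h2, integral_mul_left_eq_self (F y) k]

end Linearization

/-! ### The exponential map of the torus -/

theorem expT_add (s t : Fin 3 → ℝ) : expT (s + t) = expT s * expT t := by
  funext i; simp [expT, Circle.exp_add]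

theorem expT_zero : expT 0 = 1 := by
  funext i; simp [expT]

theorem isOpenQuotientMap_expT : IsOpenQuotientMap expT := by
  have : IsOpenQuotientMap (Circle.exp : ℝ → Circle) :=
    ⟨Circle.exp_surjective, Circle.exp.continuous, isLocalHomeomorph_circleExp.isOpenMap⟩
  exact IsOpenQuotientMap.piMap fun _ : Fin 3 => this

theorem continuous_expT : Continuous expT := isOpenQuotientMap_expT.continuous

/-! ### The tangent map of the chart -/

section ChartTangent

variable {M : Type*} [TopologicalSpace M] [ChartedSpace E7 M]

/-- The tangent map of the inverse of the preferred chart at `p`. -/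
noncomputable def chartTangent (p : M) (y : E7) : E7 →L[ℝ] E7 :=
  mfderiv 𝓘(ℝ, E7) (𝓡 7) (extChartAt (𝓡 7) p).symm y

variable [IsManifold (𝓡 7) ∞ M]

theorem hasMFDerivAt_extChartAt_symm {p : M} {y : E7} (hy : y ∈ (extChartAt (𝓡 7) p).target) :
    HasMFDerivAt 𝓘(ℝ, E7) (𝓡 7) (extChartAt (𝓡 7) p).symm y (chartTangent p y) := by
  have h1 : MDifferentiableAt 𝓘(ℝ, E7) (𝓡 7) (extChartAt (𝓡 7) p).symm y :=
    ((contMDiffOn_extChartAt_symm (n := ∞) p).mdifferentiableOn (by simp)).mdifferentiableAt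
      ((isOpen_extChartAt_target p).mem_nhds hy)
  exact h1.hasMFDerivAt

theorem chartTangent_injective {p : M} {y : E7} (hy : y ∈ (extChartAt (𝓡 7) p).target) :
    Function.Injective (chartTangent p y) := by
  have h1 := hasMFDerivAt_extChartAt_symm hy
  have hs := (extChartAt (𝓡 7) p).map_target hy
  have h2 : HasMFDerivAt (𝓡 7) 𝓘(ℝ, E7) (extChartAt (𝓡 7) p) ((extChartAt (𝓡 7) p).symm y)
      (mfderiv (𝓡 7) 𝓘(ℝ, E7) (extChartAt (𝓡 7) p) ((extChartAt (𝓡 7) p).symm y)) :=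
    (mdifferentiableAt_extChartAt (by rwa [extChartAt_source] at hs)).hasMFDerivAt
  have h3 := h2.comp y h1
  have h4 : HasMFDerivAt 𝓘(ℝ, E7) 𝓘(ℝ, E7) (extChartAt (𝓡 7) p ∘ (extChartAt (𝓡 7) p).symm) y
      (ContinuousLinearMap.id ℝ E7) := by
    refine (hasMFDerivAt_id (I := 𝓘(ℝ, E7)) y).congr_of_eventuallyEq ?_
    filter_upwards [(isOpen_extChartAt_target p).mem_nhds hy] with z hz
    exact (extChartAt (𝓡 7) p).right_inv hz
  have h5 := hasMFDerivAt_unique h3 h4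
  intro v w hvw
  have e1 := congrArg (fun f : E7 →L[ℝ] E7 => f v) h5
  have e2 := congrArg (fun f : E7 →L[ℝ] E7 => f w) h5
  have e3 : v = mfderiv (𝓡 7) 𝓘(ℝ, E7) (extChartAt (𝓡 7) p) ((extChartAt (𝓡 7) p).symm y)
    (chartTangent p y v) := e1.symm
  have e4 : w = mfderiv (𝓡 7) 𝓘(ℝ, E7) (extChartAt (𝓡 7) p) ((extChartAt (𝓡 7) p).symm y)
    (chartTangent p y w) := e2.symm
  rw [e3, e4, hvw]

end ChartTangent

/-! ### Coordinates -/

section Coordinates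

variable {M : Type*} [TopologicalSpace M] [ChartedSpace E7 M] [MulAction Torus3 M]

theorem continuousSMul_of_isSmoothAction (h : IsSmoothAction M) : ContinuousSMul Torus3 M := by
  have hq : IsOpenQuotientMap (Prod.map expT id : (Fin 3 → ℝ) × M → Torus3 × M) :=
    isOpenQuotientMap_expT.prodMap .id
  exact ⟨hq.continuous_comp_iff.1 h.continuous⟩

/-- A continuous action of a compact group on a Hausdorff space is proper, and the quotient by a
proper action is Hausdorff. -/
theorem t2Space_orbitSpace [T2Space M] (h : IsSmoothAction M) : T2Space (OrbitSpace M) := by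
  have hc := continuousSMul_of_isSmoothAction h
  have : ProperSMul Torus3 M := by
    rw [properSMul_iff_continuousSMul_ultrafilter_tendsto_t2]
    refine ⟨hc, fun 𝒰 x₁ x₂ _ => ?_⟩
    obtain ⟨g, -, hg⟩ := isCompact_univ.ultrafilter_le_nhds (𝒰.map (Prod.fst : Torus3 × M → Torus3))
      (by simp)
    exact ⟨g, hg⟩
  exact t2Space_quotient_mulAction_of_properSMul

/-- The action in the preferred chart at `p`. -/
noncomputable def coordAct (p : M) (g : Torus3) (y : E7) : E7 :=
  extChartAt (𝓡 7) p (g • (extChartAt (𝓡 7) p).symm y)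

/-- The domain of `coordAct`. -/
def coordDom (p : M) : Set (Torus3 × E7) :=
  {x | x.2 ∈ (extChartAt (𝓡 7) p).target ∧
    x.1 • (extChartAt (𝓡 7) p).symm x.2 ∈ (extChartAt (𝓡 7) p).source}

/-- The fundamental vector fields in the preferred chart at `p`. -/
noncomputable def coordField (p : M) (y : E7) : (Fin 3 → ℝ) →L[ℝ] E7 :=
  fderiv ℝ (fun t => coordAct p (expT t) y) 0

theorem one_mem_coordDom {p : M} {y : E7} (hy : y ∈ (extChartAt (𝓡 7) p).target) :
    ((1 : Torus3), y) ∈ coordDom p :=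
  ⟨hy, by rw [one_smul]; exact (extChartAt (𝓡 7) p).map_target hy⟩

theorem stabilizer_mem_coordDom {p : M} {g : Torus3} (hg : g • p = p) :
    (g, extChartAt (𝓡 7) p p) ∈ coordDom p := by
  refine ⟨mem_extChartAt_target p, ?_⟩
  simp only [extChartAt_to_inv, hg]
  exact mem_extChartAt_source p

theorem coordAct_one {p : M} {y : E7} (hy : y ∈ (extChartAt (𝓡 7) p).target) :
    coordAct p 1 y = y := by
  rw [coordAct, one_smul, (extChartAt (𝓡 7) p).right_inv hy]

theorem symm_coordAct {p : M} {g : Torus3} {y : E7} (h : (g, y) ∈ coordDom p) :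
    (extChartAt (𝓡 7) p).symm (coordAct p g y) = g • (extChartAt (𝓡 7) p).symm y :=
  (extChartAt (𝓡 7) p).left_inv h.2

theorem coordAct_mul {p : M} (k l : Torus3) {y : E7} (h : (l, y) ∈ coordDom p) :
    coordAct p (k * l) y = coordAct p k (coordAct p l y) := by
  simp only [coordAct, mul_smul]
  rw [(extChartAt (𝓡 7) p).left_inv h.2]

theorem coordAct_stabilizer {p : M} {g : Torus3} (hg : g • p = p) :
    coordAct p g (extChartAt (𝓡 7) p p) = extChartAt (𝓡 7) p p := by
  simp [coordAct, hg]

theorem isOpen_coordDom [ContinuousSMul Torus3 M] (p : M) : IsOpen (coordDom p) := by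
  have h1 : IsOpen {x : Torus3 × E7 | x.2 ∈ (extChartAt (𝓡 7) p).target} :=
    (isOpen_extChartAt_target p).preimage continuous_snd
  have h2 : ContinuousOn (fun x : Torus3 × E7 => x.1 • (extChartAt (𝓡 7) p).symm x.2)
      {x : Torus3 × E7 | x.2 ∈ (extChartAt (𝓡 7) p).target} :=
    continuousOn_fst.smul ((continuousOn_extChartAt_symm p).comp continuousOn_snd fun _ h => h)
  exact h2.isOpen_inter_preimage h1 (isOpen_extChartAt_source p)

theorem isOpen_expT_coordDom [ContinuousSMul Torus3 M] (p : M) :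
    IsOpen {x : (Fin 3 → ℝ) × E7 | (expT x.1, x.2) ∈ coordDom p} :=
  (isOpen_coordDom p).preimage (by have := continuous_expT; fun_prop)

theorem continuousOn_coordAct [ContinuousSMul Torus3 M] (p : M) :
    ContinuousOn (fun x : Torus3 × E7 => coordAct p x.1 x.2) (coordDom p) :=
  (continuousOn_extChartAt p).comp (continuousOn_fst.smul
    ((continuousOn_extChartAt_symm p).comp continuousOn_snd fun _ h => h.1)) fun _ h => h.2

theorem expT_zero_mem_coordDom {p : M} {y : E7} (hy : y ∈ (extChartAt (𝓡 7) p).target) :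
    (expT 0, y) ∈ coordDom p := expT_zero ▸ one_mem_coordDom hy

variable [IsManifold (𝓡 7) ∞ M]

theorem contDiffOn_coordAct (h : IsSmoothAction M) (p : M) :
    ContDiffOn ℝ ∞ (fun x : (Fin 3 → ℝ) × E7 => coordAct p (expT x.1) x.2)
      {x | (expT x.1, x.2) ∈ coordDom p} := by
  have h1 : ContMDiffOn (𝓘(ℝ, Fin 3 → ℝ).prod 𝓘(ℝ, E7)) (𝓘(ℝ, Fin 3 → ℝ).prod (𝓡 7)) ∞
      (fun x : (Fin 3 → ℝ) × E7 => (x.1, (extChartAt (𝓡 7) p).symm x.2))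
      {x | (expT x.1, x.2) ∈ coordDom p} :=
    contMDiffOn_fst.prodMk ((contMDiffOn_extChartAt_symm p).comp contMDiffOn_snd
      fun x hx => hx.1)
  have h2 : ContMDiffOn (𝓘(ℝ, Fin 3 → ℝ).prod 𝓘(ℝ, E7)) (𝓡 7) ∞
      (fun x : (Fin 3 → ℝ) × E7 => expT x.1 • (extChartAt (𝓡 7) p).symm x.2)
      {x | (expT x.1, x.2) ∈ coordDom p} :=
    h.contMDiffOn.comp (t := univ) h1 fun x hx => trivial
  have h3 : ContMDiffOn (𝓘(ℝ, Fin 3 → ℝ).prod 𝓘(ℝ, E7)) 𝓘(ℝ, E7) ∞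
      (fun x : (Fin 3 → ℝ) × E7 => coordAct p (expT x.1) x.2)
      {x | (expT x.1, x.2) ∈ coordDom p} :=
    contMDiffOn_extChartAt.comp h2 fun x hx => by
      have := hx.2
      rwa [extChartAt_source] at this
  rw [← contMDiffOn_iff_contDiffOn, modelWithCornersSelf_prod, ← chartedSpaceSelf_prod]
  exact h3

theorem contDiffAt_coordAct [ContinuousSMul Torus3 M] (h : IsSmoothAction M) {p : M}
    {t : Fin 3 → ℝ} {y : E7} (hty : (expT t, y) ∈ coordDom p) :
    ContDiffAt ℝ ∞ (fun x : (Fin 3 → ℝ) × E7 => coordAct p (expT x.1) x.2) (t, y) :=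
  (contDiffOn_coordAct h p).contDiffAt ((isOpen_expT_coordDom p).mem_nhds hty)

theorem fderiv_coordAct_eq [ContinuousSMul Torus3 M] (h : IsSmoothAction M) {p : M}
    {t : Fin 3 → ℝ} {y : E7} (hty : (expT t, y) ∈ coordDom p) :
    HasFDerivAt (coordAct p (expT t))
      ((fderiv ℝ (fun x : (Fin 3 → ℝ) × E7 => coordAct p (expT x.1) x.2) (t, y)).comp
        (ContinuousLinearMap.inr ℝ (Fin 3 → ℝ) E7)) y := by
  have h1 := ((contDiffAt_coordAct h hty).differentiableAt (by simp)).hasFDerivAt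
  exact h1.comp (f := fun y' : E7 => ((t, y') : (Fin 3 → ℝ) × E7)) y (hasFDerivAt_prodMk_right t y)

theorem hasFDerivAt_coordAct [ContinuousSMul Torus3 M] (h : IsSmoothAction M) {p : M}
    {g : Torus3} {y : E7} (hgy : (g, y) ∈ coordDom p) :
    HasFDerivAt (coordAct p g) (fderiv ℝ (coordAct p g) y) y := by
  obtain ⟨t, rfl⟩ := isOpenQuotientMap_expT.surjective g
  exact (fderiv_coordAct_eq h hgy).differentiableAt.hasFDerivAt

theorem contDiffOn_fderiv_coordAct [ContinuousSMul Torus3 M] (h : IsSmoothAction M) (p : M) :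
    ContDiffOn ℝ ∞ (fun x : (Fin 3 → ℝ) × E7 => fderiv ℝ (coordAct p (expT x.1)) x.2)
      {x | (expT x.1, x.2) ∈ coordDom p} := by
  have h1 : ContDiffOn ℝ ∞ (fderiv ℝ fun x : (Fin 3 → ℝ) × E7 => coordAct p (expT x.1) x.2)
      {x | (expT x.1, x.2) ∈ coordDom p} :=
    (contDiffOn_coordAct h p).fderiv_of_isOpen (isOpen_expT_coordDom p) (by simp)
  exact (h1.clm_comp contDiffOn_const).congr fun x hx => (fderiv_coordAct_eq h hx).fderiv

/-- Smoothness of the action is expressed in the Lie algebra variable; continuity in the group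
variable follows because `expT` is an open quotient map. -/
theorem continuousOn_fderiv_coordAct [ContinuousSMul Torus3 M] (h : IsSmoothAction M) (p : M) :
    ContinuousOn (fun x : Torus3 × E7 => fderiv ℝ (coordAct p x.1) x.2) (coordDom p) := by
  have hq : IsOpenQuotientMap (Prod.map expT id : (Fin 3 → ℝ) × E7 → Torus3 × E7) :=
    isOpenQuotientMap_expT.prodMap .id
  rintro ⟨g, y⟩ hgy
  obtain ⟨t, rfl⟩ := isOpenQuotientMap_expT.surjective g
  refine ContinuousAt.continuousWithinAt ?_
  have := ((contDiffOn_fderiv_coordAct h p).continuousOn.continuousAt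
    ((isOpen_expT_coordDom p).mem_nhds (x := (t, y)) hgy))
  exact (hq.continuousAt_comp_iff (x := (t, y))).1 this

theorem hasFDerivAt_coordField [ContinuousSMul Torus3 M] (h : IsSmoothAction M) {p : M}
    {y : E7} (hy : y ∈ (extChartAt (𝓡 7) p).target) :
    HasFDerivAt (fun t => coordAct p (expT t) y) (coordField p y) 0 := by
  have h1 := ((contDiffAt_coordAct h (expT_zero_mem_coordDom hy)).differentiableAt
    (by simp)).hasFDerivAt
  exact (h1.comp (f := fun t : Fin 3 → ℝ => ((t, y) : (Fin 3 → ℝ) × E7)) 0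
    (hasFDerivAt_prodMk_left 0 y)).differentiableAt.hasFDerivAt

theorem continuousOn_coordField [ContinuousSMul Torus3 M] (h : IsSmoothAction M) (p : M) :
    ContinuousOn (coordField p) (extChartAt (𝓡 7) p).target := by
  have h1 : ContinuousOn (fderiv ℝ fun x : (Fin 3 → ℝ) × E7 => coordAct p (expT x.1) x.2)
      {x | (expT x.1, x.2) ∈ coordDom p} :=
    (contDiffOn_coordAct h p).continuousOn_fderiv_of_isOpen (isOpen_expT_coordDom p) (by simp)
  have h2 : ContinuousOn (fun y : E7 => ((fderiv ℝ (fun x : (Fin 3 → ℝ) × E7 =>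
      coordAct p (expT x.1) x.2) (0, y)).comp (ContinuousLinearMap.inl ℝ (Fin 3 → ℝ) E7)))
      (extChartAt (𝓡 7) p).target :=
    (h1.comp (f := fun y : E7 => ((0, y) : (Fin 3 → ℝ) × E7)) (by fun_prop)
      fun y hy => expT_zero_mem_coordDom hy).clm_comp continuousOn_const
  refine h2.congr fun y hy => ?_
  have h3 := ((contDiffAt_coordAct h (expT_zero_mem_coordDom hy)).differentiableAt
    (by simp)).hasFDerivAt
  exact (h3.comp (f := fun t : Fin 3 → ℝ => ((t, y) : (Fin 3 → ℝ) × E7)) 0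
    (hasFDerivAt_prodMk_left 0 y)).fderiv

theorem infAct_symm [ContinuousSMul Torus3 M] (h : IsSmoothAction M) {p : M}
    {y : E7} (hy : y ∈ (extChartAt (𝓡 7) p).target) (a : Fin 3 → ℝ) :
    infAct ((extChartAt (𝓡 7) p).symm y) a = chartTangent p y (coordField p y a) := by
  have h1 := (hasFDerivAt_coordField h hy).hasMFDerivAt
  have h0 : coordAct p (expT 0) y = y := by rw [expT_zero, coordAct_one hy]
  have h2 : HasMFDerivAt 𝓘(ℝ, E7) (𝓡 7) (extChartAt (𝓡 7) p).symm (coordAct p (expT 0) y)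
      (chartTangent p y) := by
    rw [h0]; exact hasMFDerivAt_extChartAt_symm hy
  have h3 := h2.comp (0 : Fin 3 → ℝ) h1
  have h4 : HasMFDerivAt 𝓘(ℝ, Fin 3 → ℝ) (𝓡 7)
      (fun t => expT t • (extChartAt (𝓡 7) p).symm y) (0 : Fin 3 → ℝ)
      ((chartTangent p y).comp (coordField p y)) := by
    refine h3.congr_of_eventuallyEq ?_
    have : ∀ᶠ t in 𝓝 (0 : Fin 3 → ℝ), (expT t, y) ∈ coordDom p := by
      refine ContinuousAt.eventually_mem (f := fun t : Fin 3 → ℝ => (expT t, y))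
        ?_ ((isOpen_coordDom p).mem_nhds (expT_zero_mem_coordDom hy))
      have := continuous_expT
      fun_prop
    filter_upwards [this] with t ht using (symm_coordAct ht).symm
  have h5 := h4.mfderiv
  exact congrArg (fun f : (Fin 3 → ℝ) →L[ℝ] E7 => f a) h5

end Coordinates

/-! ### The isotropy representation and linearising coordinates -/

section Isotropy

variable {M : Type*} [TopologicalSpace M] [ChartedSpace E7 M] [MulAction Torus3 M]

/-- The isotropy representation at `p`, in the preferred chart. -/
noncomputable def isotropyRep (p : M) (g : Torus3) : E7 →L[ℝ] E7 :=
  fderiv ℝ (coordAct p g) (extChartAt (𝓡 7) p p)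

/-- The derivative of the isotropy representation. -/
noncomputable def isotropyGen (p : M) : (Fin 3 → ℝ) →L[ℝ] E7 →L[ℝ] E7 :=
  fderiv ℝ (fun t => isotropyRep p (expT t)) 0

/-- `Λ` parametrises a neighbourhood of `p`, in the preferred chart, in such a way that the
stabiliser of `p` acts linearly. -/
structure IsLinearization (p : M) (ε : ℝ) (Λ : E7 → E7) : Prop where
  pos : 0 < ε
  contDiffOn : ContDiffOn ℝ 1 Λ (Metric.ball 0 ε)
  map_zero : Λ 0 = extChartAt (𝓡 7) p p
  hasFDerivAt_zero : HasFDerivAt Λ (ContinuousLinearMap.id ℝ E7) 0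
  mem_target : ∀ v ∈ Metric.ball (0 : E7) ε, Λ v ∈ (extChartAt (𝓡 7) p).target
  mem_coordDom : ∀ g : Torus3, g • p = p → ∀ v ∈ Metric.ball (0 : E7) ε, (g, Λ v) ∈ coordDom p
  equivariant : ∀ g : Torus3, g • p = p → ∀ v ∈ Metric.ball (0 : E7) ε,
    isotropyRep p g v ∈ Metric.ball (0 : E7) ε → coordAct p g (Λ v) = Λ (isotropyRep p g v)

theorem isotropyRep_one (p : M) : isotropyRep p 1 = ContinuousLinearMap.id ℝ E7 := by
  refine ((hasFDerivAt_id (extChartAt (𝓡 7) p p)).congr_of_eventuallyEq ?_).fderiv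
  filter_upwards [(isOpen_extChartAt_target p).mem_nhds (mem_extChartAt_target p)] with y hy
    using coordAct_one hy

variable [IsManifold (𝓡 7) ∞ M] [ContinuousSMul Torus3 M]

theorem exists_isLinearization [T2Space M] (h : IsSmoothAction M) (p : M) :
    ∃ ε Λ, IsLinearization p ε Λ := by
  set y₀ := extChartAt (𝓡 7) p p with hy₀
  have hKcomp : IsCompact (MulAction.stabilizer Torus3 p : Set Torus3) := by
    refine IsClosed.isCompact ?_
    have : (MulAction.stabilizer Torus3 p : Set Torus3) = {g | g • p = p} := by
      ext g; simp
    rw [this]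
    exact isClosed_eq (by fun_prop) continuous_const
  have : CompactSpace (MulAction.stabilizer Torus3 p) := isCompact_iff_compactSpace.1 hKcomp
  have hst : ∀ {g : Torus3}, g ∈ MulAction.stabilizer Torus3 p → g • p = p := fun hg => hg
  -- The points whose whole orbit under the stabiliser stays in the chart. The set is open by the
  -- tube lemma, as the stabiliser is compact.
  let U : Set E7 := {y | ∀ k ∈ MulAction.stabilizer Torus3 p, (k, y) ∈ coordDom p}
  have htube : ∀ y ∈ U, ∀ P : E7 → Torus3 → Prop,
      (∀ k ∈ MulAction.stabilizer Torus3 p, ∀ᶠ z : E7 × Torus3 in 𝓝 (y, k), P z.1 z.2) →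
      ∀ᶠ y' in 𝓝 y, ∀ k ∈ MulAction.stabilizer Torus3 p, P y' k := fun y _ P hP =>
    hKcomp.eventually_forall_of_forall_eventually hP
  have hswap : ∀ (y : E7) (k : Torus3), Tendsto (fun z : E7 × Torus3 => (z.2, z.1)) (𝓝 (y, k))
      (𝓝 (k, y)) := fun y k => (continuous_swap.tendsto (y, k))
  have hUo : IsOpen U := by
    rw [isOpen_iff_mem_nhds]
    intro y hy
    exact htube y hy (fun y k => (k, y) ∈ coordDom p) fun k hk =>
      (hswap y k).eventually ((isOpen_coordDom p).mem_nhds (hy k hk))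
  have hyU : y₀ ∈ U := fun k hk => stabilizer_mem_coordDom (hst hk)
  have hUt : U ⊆ (extChartAt (𝓡 7) p).target := fun y hy => (hy 1 (one_mem _)).1
  obtain ⟨L, hL, hL0, hLd, hLeq⟩ := exists_linearization (K := MulAction.stabilizer Torus3 p)
    hUo hyU (θ := fun k y => coordAct p k y) (D := fun k y => fderiv ℝ (coordAct p (k : Torus3)) y)
    (fun k l y hy => coordAct_mul _ _ (hy l l.2)) (fun y hy => coordAct_one (hUt hy))
    (fun k => coordAct_stabilizer (hst k.2))
    ((continuousOn_coordAct p).comp (f := fun x : MulAction.stabilizer Torus3 p × E7 =>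
      ((x.1 : Torus3), x.2)) (by fun_prop) fun x hx => hx.2 x.1 x.1.2)
    ((continuousOn_fderiv_coordAct h p).comp (f := fun x : MulAction.stabilizer Torus3 p × E7 =>
      ((x.1 : Torus3), x.2)) (by fun_prop) fun x hx => hx.2 x.1 x.1.2)
    (fun k y hy => hasFDerivAt_coordAct h (hy k k.2))
  have hLat : ContDiffAt ℝ 1 L y₀ := hL.contDiffAt (hUo.mem_nhds hyU)
  have hLd' : HasFDerivAt L (ContinuousLinearEquiv.refl ℝ E7 : E7 →L[ℝ] E7) y₀ := hLd
  -- The averaged map `L` has identity derivative at the fixed point, hence a local inverse; this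
  -- inverse is the desired `Λ`.
  let e := hLat.toOpenPartialHomeomorph L hLd' one_ne_zero
  have heL : ∀ y, e y = L y := fun y => rfl
  have hy₀e : y₀ ∈ e.source := hLat.mem_toOpenPartialHomeomorph_source hLd' one_ne_zero
  have h0t : (0 : E7) ∈ e.target := by
    have := e.map_source hy₀e
    rwa [heL, hL0] at this
  have hes : e.symm 0 = y₀ := by
    have := e.left_inv hy₀e
    rwa [heL, hL0] at this
  have hec : ContDiffAt ℝ 1 e.symm 0 := by
    have := hLat.to_localInverse hLd' one_ne_zero
    rw [hL0] at this
    exact this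
  -- Equivariance of `Λ` is proved by applying `L` to both sides, so the translates by the
  -- stabiliser must lie where `L` is known to be injective. Compactness gives one neighbourhood for
  -- all `k`.
  have hV : ∀ᶠ y in 𝓝 y₀, ∀ k ∈ MulAction.stabilizer Torus3 p,
      (k, y) ∈ coordDom p ∧ coordAct p k y ∈ e.source := by
    refine htube y₀ hyU (fun y k => (k, y) ∈ coordDom p ∧ coordAct p k y ∈ e.source) fun k hk => ?_
    have h1 := stabilizer_mem_coordDom (hst hk)
    have h2 := (isOpen_coordDom p).mem_nhds h1
    have h3 : Tendsto (fun x : Torus3 × E7 => coordAct p x.1 x.2) (𝓝 (k, y₀)) (𝓝 y₀) := by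
      have := (continuousOn_coordAct p).continuousAt h2
      rw [ContinuousAt] at this
      simpa only [coordAct_stabilizer (hst hk)] using this
    exact (hswap y₀ k).eventually
      ((eventually_mem_set.2 h2).and (h3.eventually (e.open_source.mem_nhds hy₀e)))
  have hsymm : Tendsto e.symm (𝓝 0) (𝓝 y₀) := by
    have := hec.continuousAt
    rwa [ContinuousAt, hes] at this
  have hall : ∀ᶠ v in 𝓝 (0 : E7), v ∈ e.target ∧ ContDiffAt ℝ 1 e.symm v ∧
      ∀ k ∈ MulAction.stabilizer Torus3 p,
        (k, e.symm v) ∈ coordDom p ∧ coordAct p k (e.symm v) ∈ e.source :=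
    (eventually_mem_set.2 (e.open_target.mem_nhds h0t)).and ((hec.eventually (by simp)).and (hsymm.eventually hV))
  obtain ⟨ε, hε, hball⟩ := Metric.eventually_nhds_iff_ball.1 hall
  refine ⟨ε, e.symm, hε, fun v hv => (hball v hv).2.1.contDiffWithinAt, hes, ?_,
    fun v hv => ((hball v hv).2.2 1 (one_mem _)).1.1, fun g hg v hv => ((hball v hv).2.2 g hg).1,
    fun g hg v hv hv' => ?_⟩
  · exact e.hasFDerivAt_symm (f' := ContinuousLinearEquiv.refl ℝ E7) h0t (by rw [hes]; exact hLd')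
  · obtain ⟨h1, h2, h3⟩ := hball v hv
    have h4 : e.symm v ∈ U := fun k hk => (h3 k hk).1
    refine e.injOn (h3 g hg).2 (e.map_target (hball _ hv').1) ?_
    rw [e.right_inv (hball _ hv').1]
    have h5 := hLeq ⟨g, hg⟩ (e.symm v) h4
    rw [← heL, ← heL, e.right_inv h1] at h5
    exact h5

theorem isotropyRep_mul (h : IsSmoothAction M) {p : M} {k l : Torus3} (hk : k • p = p)
    (hl : l • p = p) : isotropyRep p (k * l) = (isotropyRep p k).comp (isotropyRep p l) := by
  have hd := stabilizer_mem_coordDom hl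
  have h1 : HasFDerivAt (fun y => coordAct p k (coordAct p l y))
      ((isotropyRep p k).comp (isotropyRep p l)) (extChartAt (𝓡 7) p p) := by
    have h2 : HasFDerivAt (coordAct p k) (isotropyRep p k)
        (coordAct p l (extChartAt (𝓡 7) p p)) := by
      rw [coordAct_stabilizer hl]
      exact hasFDerivAt_coordAct h (stabilizer_mem_coordDom hk)
    exact h2.comp _ (hasFDerivAt_coordAct h hd)
  refine (h1.congr_of_eventuallyEq ?_).fderiv
  have : ∀ᶠ y in 𝓝 (extChartAt (𝓡 7) p p), (l, y) ∈ coordDom p :=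
    ContinuousAt.eventually_mem (f := fun y : E7 => (l, y)) (by fun_prop)
      ((isOpen_coordDom p).mem_nhds hd)
  filter_upwards [this] with y hy using coordAct_mul k l hy

theorem hasFDerivAt_isotropyRep (h : IsSmoothAction M) (p : M) :
    HasFDerivAt (fun t => isotropyRep p (expT t)) (isotropyGen p) 0 := by
  have h1 := (contDiffOn_fderiv_coordAct h p).contDiffAt ((isOpen_expT_coordDom p).mem_nhds
    (x := (0, extChartAt (𝓡 7) p p)) (expT_zero_mem_coordDom (mem_extChartAt_target p)))
  have h2 : DifferentiableAt ℝ (fun t => isotropyRep p (expT t)) 0 :=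
    DifferentiableAt.comp (0 : Fin 3 → ℝ)
      (f := fun t : Fin 3 → ℝ => ((t, extChartAt (𝓡 7) p p) : (Fin 3 → ℝ) × E7))
      (h1.differentiableAt (by simp)) (by fun_prop)
  exact h2.hasFDerivAt

theorem coordField_eq_zero_iff (h : IsSmoothAction M) {p : M} {y : E7}
    (hy : y ∈ (extChartAt (𝓡 7) p).target) (a : Fin 3 → ℝ) :
    infAct ((extChartAt (𝓡 7) p).symm y) a = 0 ↔ coordField p y a = 0 := by
  rw [infAct_symm h hy]
  exact ⟨fun h0 => chartTangent_injective hy (h0.trans (map_zero _).symm),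
    fun h0 => by rw [h0]; exact map_zero _⟩

theorem infAct_eq_zero_iff (h : IsSmoothAction M) (p : M) (a : Fin 3 → ℝ) :
    infAct p a = 0 ↔ coordField p (extChartAt (𝓡 7) p p) a = 0 := by
  have := coordField_eq_zero_iff h (mem_extChartAt_target p) a
  rwa [extChartAt_to_inv] at this

theorem hasDerivAt_coordAct_smul (h : IsSmoothAction M) {p : M} {y : E7}
    (hy : y ∈ (extChartAt (𝓡 7) p).target) (a : Fin 3 → ℝ) :
    HasDerivAt (fun s : ℝ => coordAct p (expT (s • a)) y) (coordField p y a) 0 := by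
  have h1 : HasDerivAt (fun s : ℝ => s • a) a 0 := by
    simpa using (hasDerivAt_id (0 : ℝ)).smul_const a
  have h2 := hasFDerivAt_coordField h hy
  rw [← zero_smul ℝ a] at h2
  exact h2.comp_hasDerivAt (0 : ℝ) h1

/-- A one-parameter subgroup with vanishing velocity at `p` fixes `p`. -/
theorem expT_smul_eq_of_infAct_eq_zero (h : IsSmoothAction M) {p : M} {a : Fin 3 → ℝ}
    (ha : infAct p a = 0) (s : ℝ) : expT (s • a) • p = p := by
  set y₀ := extChartAt (𝓡 7) p p with hy₀
  have hc : ContinuousAt (fun s : ℝ => (expT (s • a), y₀)) 0 := by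
    have := continuous_expT
    fun_prop
  have hdom : ∀ᶠ s : ℝ in 𝓝 0, (expT (s • a), y₀) ∈ coordDom p := by
    refine hc.eventually_mem ((isOpen_coordDom p).mem_nhds ?_)
    rw [zero_smul]
    exact expT_zero_mem_coordDom (mem_extChartAt_target p)
  obtain ⟨ε, hε, hball⟩ := Metric.eventually_nhds_iff_ball.1 hdom
  have h0 := (infAct_eq_zero_iff h p a).1 ha
  -- The velocity of the orbit at time `s` is the image of the velocity at time `0` under the
  -- derivative of `expT (s • a)`, hence zero.
  have hder : ∀ s ∈ Metric.ball (0 : ℝ) ε,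
      HasDerivAt (fun s : ℝ => coordAct p (expT (s • a)) y₀) 0 s := by
    intro s hs
    have h1 := hasDerivAt_coordAct_smul h (mem_extChartAt_target p) a
    rw [h0] at h1
    have h2 : HasFDerivAt (coordAct p (expT (s • a))) (isotropyRep p (expT (s • a)))
        (coordAct p (expT ((0 : ℝ) • a)) y₀) := by
      rw [zero_smul, expT_zero, coordAct_one (mem_extChartAt_target p)]
      exact hasFDerivAt_coordAct h (hball s hs)
    have h3 := h2.comp_hasDerivAt (0 : ℝ) h1
    rw [map_zero] at h3
    have h4 : HasDerivAt (fun r : ℝ => coordAct p (expT (s • a))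
        (coordAct p (expT ((r - s) • a)) y₀)) 0 s := by
      have h5 : HasDerivAt (fun r : ℝ => r - s) 1 s := (hasDerivAt_id s).sub_const s
      have h6 := HasDerivAt.scomp_of_eq (h := fun r : ℝ => r - s) s h3 h5 (by simp)
      rw [one_smul] at h6
      exact h6
    refine h4.congr_of_eventuallyEq ?_
    have h7 : ∀ᶠ r in 𝓝 s, (expT ((r - s) • a), y₀) ∈ coordDom p := by
      have : Tendsto (fun r : ℝ => r - s) (𝓝 s) (𝓝 0) := by
        have : Continuous fun r : ℝ => r - s := by fun_prop
        simpa using this.tendsto s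
      exact this.eventually hdom
    filter_upwards [h7] with r hr
    rw [← coordAct_mul _ _ hr, ← expT_add, ← add_smul, add_sub_cancel]
  have hconst : ∀ s ∈ Metric.ball (0 : ℝ) ε, expT (s • a) • p = p := by
    intro s hs
    have h1 : coordAct p (expT (s • a)) y₀ = coordAct p (expT ((0 : ℝ) • a)) y₀ :=
      Metric.isOpen_ball.is_const_of_deriv_eq_zero (convex_ball (0 : ℝ) ε).isPreconnected
        (fun r hr => (hder r hr).differentiableAt.differentiableWithinAt)
        (fun r hr => (hder r hr).deriv) hs (Metric.mem_ball_self hε)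
    rw [zero_smul, expT_zero, coordAct_one (mem_extChartAt_target p)] at h1
    have h2 := symm_coordAct (hball s hs)
    rw [h1, hy₀, extChartAt_to_inv] at h2
    exact h2.symm
  -- An arbitrary time is a multiple of one short enough for the curve to stay in the chart.
  obtain ⟨n, hn⟩ := exists_nat_gt (|s| / ε)
  have hn0 : (0 : ℝ) < n := lt_of_le_of_lt (by positivity) hn
  have hs : s / n ∈ Metric.ball (0 : ℝ) ε := by
    rw [mem_ball_zero_iff, Real.norm_eq_abs, abs_div, Nat.abs_cast, div_lt_iff₀ hn0]
    rw [div_lt_iff₀ hε] at hn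
    linarith
  have hpow : ∀ m : ℕ, expT (((m : ℝ) * (s / n)) • a) • p = p := by
    intro m
    induction m with
    | zero => simp [expT_zero]
    | succ m ih =>
      rw [Nat.cast_succ, add_mul, one_mul, add_smul, expT_add, mul_smul, hconst _ hs, ih]
  have := hpow n
  rwa [mul_div_cancel₀ _ hn0.ne'] at this

theorem hasDerivAt_isotropyRep_smul (h : IsSmoothAction M) (p : M) (a : Fin 3 → ℝ) :
    HasDerivAt (fun s : ℝ => isotropyRep p (expT (s • a))) (isotropyGen p a) 0 := by
  have h1 : HasDerivAt (fun s : ℝ => s • a) a 0 := by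
    simpa using (hasDerivAt_id (0 : ℝ)).smul_const a
  have h2 := hasFDerivAt_isotropyRep h p
  rw [← zero_smul ℝ a] at h2
  exact h2.comp_hasDerivAt (0 : ℝ) h1

theorem hasDerivAt_isotropyRep_smul' (h : IsSmoothAction M) {p : M} {a : Fin 3 → ℝ}
    (ha : infAct p a = 0) (s : ℝ) :
    HasDerivAt (fun s : ℝ => isotropyRep p (expT (s • a)))
      ((isotropyRep p (expT (s • a))).comp (isotropyGen p a)) s := by
  have h1 : ∀ r : ℝ, isotropyRep p (expT (r • a)) =
      (isotropyRep p (expT (s • a))).comp (isotropyRep p (expT ((r - s) • a))) := fun r => by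
    rw [← isotropyRep_mul h (expT_smul_eq_of_infAct_eq_zero h ha s)
      (expT_smul_eq_of_infAct_eq_zero h ha _), ← expT_add, ← add_smul, add_sub_cancel]
  have h2 : HasDerivAt (fun r : ℝ => isotropyRep p (expT ((r - s) • a))) (isotropyGen p a) s := by
    have h5 : HasDerivAt (fun r : ℝ => r - s) 1 s := (hasDerivAt_id s).sub_const s
    have h6 := HasDerivAt.scomp_of_eq (h := fun r : ℝ => r - s) s
      (hasDerivAt_isotropyRep_smul h p a) h5 (by simp)
    rw [one_smul] at h6
    exact h6
  have h3 := (((ContinuousLinearMap.compL ℝ E7 E7 E7) (isotropyRep p (expT (s • a))))).hasFDerivAt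
    |>.comp_hasDerivAt s h2
  exact h3.congr_of_eventuallyEq (Eventually.of_forall h1)

namespace IsLinearization

/-- Differentiating the equivariance of `Λ` along the one-parameter group shows that the fundamental
field of an element of the isotropy algebra is linear in these coordinates. -/
theorem coordField_eq (h : IsSmoothAction M) {p : M} {ε : ℝ} {Λ : E7 → E7}
    (hΛ : IsLinearization p ε Λ) {a : Fin 3 → ℝ} (ha : infAct p a = 0) {v : E7}
    (hv : v ∈ Metric.ball (0 : E7) ε) :
    coordField p (Λ v) a = fderiv ℝ Λ v (isotropyGen p a v) := by
  have h1 := hasDerivAt_coordAct_smul h (hΛ.mem_target v hv) a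
  have h2 : HasDerivAt (fun s : ℝ => isotropyRep p (expT (s • a)) v) (isotropyGen p a v) 0 := by
    have := (hasDerivAt_isotropyRep_smul h p a).clm_apply (hasDerivAt_const (0 : ℝ) v)
    simpa using this
  have h0 : isotropyRep p (expT ((0 : ℝ) • a)) v = v := by
    rw [zero_smul, expT_zero, isotropyRep_one]; rfl
  have h3 : HasFDerivAt Λ (fderiv ℝ Λ v) (isotropyRep p (expT ((0 : ℝ) • a)) v) := by
    rw [h0]
    exact ((hΛ.contDiffOn.contDiffAt (Metric.isOpen_ball.mem_nhds hv)).differentiableAt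
      (by simp)).hasFDerivAt
  have h4 := h3.comp_hasDerivAt (0 : ℝ) h2
  refine h1.unique (h4.congr_of_eventuallyEq ?_)
  have h5 : ∀ᶠ s : ℝ in 𝓝 0, isotropyRep p (expT (s • a)) v ∈ Metric.ball (0 : E7) ε := by
    refine h2.continuousAt.eventually_mem (Metric.isOpen_ball.mem_nhds ?_)
    rw [h0]; exact hv
  filter_upwards [h5] with s hs
  exact hΛ.equivariant _ (expT_smul_eq_of_infAct_eq_zero h ha s) v hv hs

end IsLinearization

end Isotropy

/-! ### Faithfulness of the isotropy representations -/

section Effective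

variable {M : Type*} [TopologicalSpace M] [ChartedSpace E7 M] [MulAction Torus3 M]

theorem IsLinearization.hasStrictFDerivAt {p : M} {ε : ℝ} {Λ : E7 → E7}
    (hΛ : IsLinearization p ε Λ) :
    HasStrictFDerivAt Λ (ContinuousLinearMap.id ℝ E7) 0 :=
  (hΛ.contDiffOn.contDiffAt (Metric.ball_mem_nhds 0 hΛ.pos)).hasStrictFDerivAt'
    hΛ.hasFDerivAt_zero (by simp)

variable [IsManifold (𝓡 7) ∞ M] [ContinuousSMul Torus3 M] [T2Space M]

/-- In linearising coordinates the element acts by its isotropy representation, here the identity,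
and these coordinates fill a neighbourhood of `p`. -/
theorem eventually_smul_eq_of_isotropyRep (h : IsSmoothAction M) {p : M} {g : Torus3}
    (hg : g • p = p) (hrep : isotropyRep p g = ContinuousLinearMap.id ℝ E7) :
    ∀ᶠ q in 𝓝 p, g • q = q := by
  obtain ⟨ε, Λ, hΛ⟩ := exists_isLinearization h p
  have h1 : map Λ (𝓝 0) = 𝓝 (extChartAt (𝓡 7) p p) := by
    rw [← hΛ.map_zero]
    exact hΛ.hasStrictFDerivAt.map_nhds_eq_of_equiv (f' := ContinuousLinearEquiv.refl ℝ E7)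
  have h2 : Λ '' Metric.ball 0 ε ∈ 𝓝 (extChartAt (𝓡 7) p p) :=
    h1 ▸ image_mem_map (Metric.ball_mem_nhds 0 hΛ.pos)
  filter_upwards [(continuousAt_extChartAt p).preimage_mem_nhds h2,
    extChartAt_source_mem_nhds (I := 𝓡 7) p] with q hq hqs
  obtain ⟨v, hv, hvq⟩ := hq
  have h3 := hΛ.equivariant g hg v hv (by rw [hrep]; exact hv)
  have h4 := symm_coordAct (hΛ.mem_coordDom g hg v hv)
  rw [h3, hrep, ContinuousLinearMap.id_apply, hvq, (extChartAt (𝓡 7) p).left_inv hqs] at h4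
  exact h4.symm

/-- In an effective action on a connected manifold, the isotropy representations are faithful. -/
theorem eq_one_of_isotropyRep [ConnectedSpace M] (h : IsSmoothAction M)
    (heff : FaithfulSMul Torus3 M) {p : M} {g : Torus3} (hg : g • p = p)
    (hrep : isotropyRep p g = ContinuousLinearMap.id ℝ E7) : g = 1 := by
  -- This open set is also closed: `g` fixes a limit point `q`, and its derivative at `q` is a limit
  -- of derivatives equal to the identity, so `g` fixes a neighbourhood of `q`.
  let Z : Set M := interior {q | g • q = q}
  have hZs : ∀ q ∈ Z, g • q = q := fun q hq => by
    have : q ∈ {q : M | g • q = q} := interior_subset hq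
    exact this
  have hfc : IsClosed {q : M | g • q = q} := isClosed_eq (by fun_prop) continuous_id
  have hpZ : p ∈ Z := mem_interior_iff_mem_nhds.2 (eventually_smul_eq_of_isotropyRep h hg hrep)
  have hZc : IsClosed Z := by
    refine isClosed_of_closure_subset fun q hq => ?_
    have hgq : g • q = q := hfc.closure_subset_iff.2 interior_subset hq
    refine mem_interior_iff_mem_nhds.2 (eventually_smul_eq_of_isotropyRep h hgq ?_)
    have hf : ∃ᶠ y in 𝓝 (extChartAt (𝓡 7) q q),
        fderiv ℝ (coordAct q g) y = ContinuousLinearMap.id ℝ E7 := by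
      have h1 : ∃ᶠ q' in 𝓝 q, q' ∈ Z := mem_closure_iff_frequently.1 hq
      refine Tendsto.frequently (continuousAt_extChartAt q) ?_
      refine (h1.and_eventually (extChartAt_source_mem_nhds (I := 𝓡 7) q)).mono ?_
      rintro q' ⟨hq'Z, hq's⟩
      have hy := (extChartAt (𝓡 7) q).map_source hq's
      refine ((hasFDerivAt_id (extChartAt (𝓡 7) q q')).congr_of_eventuallyEq ?_).fderiv
      have hc := continuousAt_extChartAt_symm'' hy
      rw [ContinuousAt, (extChartAt (𝓡 7) q).left_inv hq's] at hc
      filter_upwards [hc.eventually (isOpen_interior.mem_nhds hq'Z),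
        (isOpen_extChartAt_target q).mem_nhds hy] with z hz hzt
      have : g • (extChartAt (𝓡 7) q).symm z = (extChartAt (𝓡 7) q).symm z :=
        hZs _ hz
      rw [coordAct, this, (extChartAt (𝓡 7) q).right_inv hzt]; rfl
    have hcont : ContinuousAt (fun y => fderiv ℝ (coordAct q g) y) (extChartAt (𝓡 7) q q) :=
      ((continuousOn_fderiv_coordAct h q).continuousAt ((isOpen_coordDom q).mem_nhds
        (stabilizer_mem_coordDom hgq))).comp (f := fun y : E7 => (g, y)) (by fun_prop)
    by_contra hne
    exact hf (hcont.eventually_ne hne)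
  have hZ : Z = univ := IsClopen.eq_univ ⟨hZc, isOpen_interior⟩ ⟨p, hpZ⟩
  refine heff.eq_of_smul_eq_smul (M := Torus3) (α := M) fun q => ?_
  rw [one_smul]
  exact hZs q (hZ ▸ mem_univ q)

end Effective

/-! ### The three-form in coordinates -/

section FormCoordinates

variable {M : Type*} [TopologicalSpace M] [ChartedSpace E7 M]

/-- The value of a form at a point, as a form on the model space. -/
def formAt (φ : Form 3 M) (q : M) : E7 [⋀^Fin 3]→L[ℝ] ℝ := φ q

theorem inChart_apply (φ : Form 3 M) (p : M) (y X Y Z : E7) :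
    Form.inChart φ p y ![X, Y, Z] = formAt φ ((extChartAt (𝓡 7) p).symm y)
      ![chartTangent p y X, chartTangent p y Y, chartTangent p y Z] := by
  have : ((chartTangent p y : E7 → E7) ∘ ![X, Y, Z]) =
      ![chartTangent p y X, chartTangent p y Y, chartTangent p y Z] := by
    funext i; fin_cases i <;> rfl
  exact congrArg (formAt φ ((extChartAt (𝓡 7) p).symm y)) this

theorem exists_coframe_inner_cross [IsManifold (𝓡 7) ∞ M] {φ : Form 3 M}
    (hφ : ∀ p, IsG2Form (φ p)) {p : M} {y : E7} (hy : y ∈ (extChartAt (𝓡 7) p).target) :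
    ∃ f : E7 ≃L[ℝ] E7, ∀ X Y Z : E7, Form.inChart φ p y ![X, Y, Z] =
      inner ℝ (cross (f X) (f Y)) (f Z) := by
  obtain ⟨f₀, hf₀⟩ := hφ ((extChartAt (𝓡 7) p).symm y)
  let T : E7 ≃L[ℝ] E7 := (LinearEquiv.ofInjectiveEndo (chartTangent p y : E7 →ₗ[ℝ] E7)
    (chartTangent_injective hy)).toContinuousLinearEquiv
  let f₁ : E7 ≃L[ℝ] (Fin 7 → ℝ) := f₀
  let f : E7 ≃L[ℝ] E7 := (T.trans f₁).trans (PiLp.continuousLinearEquiv 2 ℝ fun _ : Fin 7 => ℝ).symm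
  refine ⟨f, fun X Y Z => ?_⟩
  have hf₁ : formAt φ ((extChartAt (𝓡 7) p).symm y) =
      phi0.compContinuousLinearMap (f₁ : E7 →L[ℝ] (Fin 7 → ℝ)) := hf₀
  rw [inChart_apply, hf₁, ← phi0_eq_inner_cross,
    ContinuousAlternatingMap.compContinuousLinearMap_apply]
  congr 1
  funext i; fin_cases i <;> rfl

theorem continuousOn_inChart {φ : Form 3 M} (hφ : Form.IsSmooth φ) (p : M) :
    ContinuousOn (Form.inChart φ p) (extChartAt (𝓡 7) p).target := (hφ p).continuousOn

theorem alternating_vec_swap {E : Type*} [AddCommGroup E] [Module ℝ E] [TopologicalSpace E]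
    (α : E [⋀^Fin 3]→L[ℝ] ℝ) (v w X : E) : α ![w, v, X] = -α ![v, w, X] := by
  have := α.toAlternatingMap.map_swap ![v, w, X] (show (0 : Fin 3) ≠ 1 by decide)
  have h2 : ![v, w, X] ∘ Equiv.swap (0 : Fin 3) 1 = ![w, v, X] := by
    funext i; fin_cases i <;> rfl
  rw [h2] at this
  exact this

theorem alternating_vec_self {E : Type*} [AddCommGroup E] [Module ℝ E] [TopologicalSpace E]
    (α : E [⋀^Fin 3]→L[ℝ] ℝ) (v X : E) : α ![v, v, X] = 0 := by
  linarith [alternating_vec_swap α v v X]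

theorem alternating_vec_add {E : Type*} [AddCommGroup E] [Module ℝ E] [TopologicalSpace E]
    (α : E [⋀^Fin 3]→L[ℝ] ℝ) (v v' w X : E) :
    α ![v + v', w, X] = α ![v, w, X] + α ![v', w, X] :=
  α.toMultilinearMap.cons_add ![w, X] v v'

theorem alternating_vec_smul {E : Type*} [AddCommGroup E] [Module ℝ E] [TopologicalSpace E]
    (α : E [⋀^Fin 3]→L[ℝ] ℝ) (c : ℝ) (v w X : E) :
    α ![c • v, w, X] = c * α ![v, w, X] :=
  α.toMultilinearMap.cons_smul ![w, X] c v

/-- A two-form on `ℝ³` is a linear functional of the cross product. This packages the three defining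
equations of `ν` into a single identity valid for all pairs `a, b`. -/
theorem alternating_vec_expand {E : Type*} [AddCommGroup E] [Module ℝ E] [TopologicalSpace E]
    (α : E [⋀^Fin 3]→L[ℝ] ℝ) (η : (Fin 3 → ℝ) →ₗ[ℝ] E) (a b : Fin 3 → ℝ) (X : E) :
    α ![η a, η b, X] = ∑ i, crossProduct a b i *
      α ![η (Pi.single (i + 1) 1), η (Pi.single (i + 2) 1), X] := by
  have hη : ∀ a : Fin 3 → ℝ, η a = a 0 • η (Pi.single 0 1) + (a 1 • η (Pi.single 1 1) +
      a 2 • η (Pi.single 2 1)) := fun a => by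
    rw [← map_smul, ← map_smul, ← map_smul, ← map_add, ← map_add]
    congr 1
    funext i; fin_cases i <;> simp
  have hfst : ∀ (a : Fin 3 → ℝ) Y, α ![η a, Y, X] = a 0 * α ![η (Pi.single 0 1), Y, X] +
      (a 1 * α ![η (Pi.single 1 1), Y, X] + a 2 * α ![η (Pi.single 2 1), Y, X]) := fun a Y => by
    conv_lhs => rw [hη a, alternating_vec_add, alternating_vec_add, alternating_vec_smul,
      alternating_vec_smul, alternating_vec_smul]
  have e1 : (1 : Fin 3) + 1 = 2 := rfl
  have e2 : (1 : Fin 3) + 2 = 0 := rfl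
  have e3 : (2 : Fin 3) + 1 = 0 := rfl
  have e4 : (2 : Fin 3) + 2 = 1 := rfl
  have c0 : crossProduct a b 0 = a 1 * b 2 - a 2 * b 1 := rfl
  have c1 : crossProduct a b 1 = a 2 * b 0 - a 0 * b 2 := rfl
  have c2 : crossProduct a b 2 = a 0 * b 1 - a 1 * b 0 := rfl
  rw [hfst a, alternating_vec_swap α (η b) (η (Pi.single 0 1)),
    alternating_vec_swap α (η b) (η (Pi.single 1 1)),
    alternating_vec_swap α (η b) (η (Pi.single 2 1)), hfst b, hfst b, hfst b, Fin.sum_univ_three,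
    c0, c1, c2, e1, e2, e3, e4, zero_add, zero_add, alternating_vec_self, alternating_vec_self,
    alternating_vec_self, alternating_vec_swap α (η (Pi.single 1 1)) (η (Pi.single 2 1)),
    alternating_vec_swap α (η (Pi.single 2 1)) (η (Pi.single 0 1)),
    alternating_vec_swap α (η (Pi.single 0 1)) (η (Pi.single 1 1))]
  ring

end FormCoordinates

/-! ### Multi-moment maps in coordinates -/

section Charts

variable {M : Type*} [TopologicalSpace M] [ChartedSpace E7 M] [IsManifold (𝓡 7) ∞ M]

theorem contDiffOn_comp_symm {F : Type*} [NormedAddCommGroup F] [NormedSpace ℝ F] {f : M → F}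
    (hf : ContMDiff (𝓡 7) 𝓘(ℝ, F) ∞ f) (p : M) :
    ContDiffOn ℝ ∞ (fun y => f ((extChartAt (𝓡 7) p).symm y)) (extChartAt (𝓡 7) p).target := by
  rw [← contMDiffOn_iff_contDiffOn]
  exact hf.contMDiffOn.comp (t := univ) (contMDiffOn_extChartAt_symm p) fun _ _ => trivial

theorem fderiv_comp_symm {F : Type*} [NormedAddCommGroup F] [NormedSpace ℝ F] {f : M → F}
    (hf : ContMDiff (𝓡 7) 𝓘(ℝ, F) ∞ f) {p : M} {y : E7}
    (hy : y ∈ (extChartAt (𝓡 7) p).target) (X : E7) :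
    fderiv ℝ (fun y => f ((extChartAt (𝓡 7) p).symm y)) y X =
      mfderiv (𝓡 7) 𝓘(ℝ, F) f ((extChartAt (𝓡 7) p).symm y) (chartTangent p y X) := by
  have h1 := ((hf.mdifferentiable (by simp)) ((extChartAt (𝓡 7) p).symm y)).hasMFDerivAt
  let D : E7 →L[ℝ] F := mfderiv (𝓡 7) 𝓘(ℝ, F) f ((extChartAt (𝓡 7) p).symm y)
  have h2 : HasFDerivAt (fun y => f ((extChartAt (𝓡 7) p).symm y)) (D.comp (chartTangent p y)) y :=
    hasMFDerivAt_iff_hasFDerivAt.1 (h1.comp y (hasMFDerivAt_extChartAt_symm hy))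
  rw [h2.fderiv]; rfl

end Charts

/-! ### Gram matrix, differentials of the moment maps, and invariance of the form -/

section Moment

variable {M : Type*} [TopologicalSpace M] [ChartedSpace E7 M] [MulAction Torus3 M]

/-- A nonzero `a` with `ξ a = 0` is a null vector of the Gram matrix, whatever the bilinear form. -/
theorem gram_rank_le (φ : Form 3 M) {p : M} (hp : p ∉ regularSet M) :
    (gram φ p).rank ≤ 2 := by
  have h1 : ∃ a, infAct p a = 0 ∧ a ≠ 0 := by
    by_contra! hcon
    refine hp ((injective_iff_map_eq_zero (infAct p)).2 fun a ha => hcon a ha)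
  obtain ⟨a, ha, ha0⟩ := h1
  have h3 : infAct p a = a 0 • gen 0 p + a 1 • gen 1 p + a 2 • gen 2 p := by
    simp only [gen]
    rw [← map_smul, ← map_smul, ← map_smul, ← map_add, ← map_add]
    congr 1
    funext i; fin_cases i <;> simp
  have hmet : ∀ X, a 0 * metricOf (φ p) X (gen 0 p) + a 1 * metricOf (φ p) X (gen 1 p) +
      a 2 * metricOf (φ p) X (gen 2 p) = 0 := by
    intro X
    simp only [metricOf]
    split_ifs with hG
    · have := congrArg (fun Y => hG.choose X ⬝ᵥ hG.choose Y) (h3.symm.trans ha)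
      simpa only [map_add, map_smul, dotProduct_add, dotProduct_smul, smul_eq_mul, map_zero,
        dotProduct_zero] using this
    · simp
  have hker : (gram φ p).mulVec a = 0 := by
    funext i
    have := hmet (gen i p)
    simp only [Matrix.mulVec, dotProduct, Fin.sum_univ_three, gram, Matrix.of_apply, Pi.zero_apply]
    linarith
  have hrn := LinearMap.finrank_range_add_finrank_ker (gram φ p).mulVecLin
  have hpos : 0 < finrank ℝ (LinearMap.ker (gram φ p).mulVecLin) := by
    refine finrank_pos_iff.2 (Submodule.nontrivial_iff_ne_bot.2 fun hbot => ha0 ?_)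
    have : a ∈ LinearMap.ker (gram φ p).mulVecLin := hker
    rw [hbot] at this
    exact (Submodule.mem_bot ℝ).1 this
  have h7 : finrank ℝ (Fin 3 → ℝ) = 3 := by simp
  rw [Matrix.rank]
  omega

variable [IsManifold (𝓡 7) ∞ M]

theorem cross_dotProduct_fderiv_nu [ContinuousSMul Torus3 M] (h : IsSmoothAction M) {φ : Form 3 M}
    {ν : M → Fin 3 → ℝ} (hν : IsMultiMomentPhi φ ν) {p : M} {y : E7}
    (hy : y ∈ (extChartAt (𝓡 7) p).target) (a b : Fin 3 → ℝ) (X : E7) :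
    crossProduct a b ⬝ᵥ fderiv ℝ (fun y => ν ((extChartAt (𝓡 7) p).symm y)) y X =
      Form.inChart φ p y ![coordField p y a, coordField p y b, X] := by
  have hd : DifferentiableAt ℝ (fun y => ν ((extChartAt (𝓡 7) p).symm y)) y :=
    ((contDiffOn_comp_symm hν.smooth p).contDiffAt
      ((isOpen_extChartAt_target p).mem_nhds hy)).differentiableAt (by simp)
  have hcomp : ∀ i, fderiv ℝ (fun y => ν ((extChartAt (𝓡 7) p).symm y)) y X i =
      Form.inChart φ p y ![coordField p y (Pi.single (i + 1) 1),
        coordField p y (Pi.single (i + 2) 1), X] := fun i => by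
    have hi : ContMDiff (𝓡 7) 𝓘(ℝ, ℝ) ∞ (fun q => ν q i) := contMDiff_pi_space.1 hν.smooth i
    have h1 := fderiv_comp_symm hi hy X
    have h2 := hν.deriv ((extChartAt (𝓡 7) p).symm y) i (chartTangent p y X)
    have h3 : fderiv ℝ (fun y => ν ((extChartAt (𝓡 7) p).symm y) i) y X =
        fderiv ℝ (fun y => ν ((extChartAt (𝓡 7) p).symm y)) y X i := by
      have h4 := (ContinuousLinearMap.proj (R := ℝ) (φ := fun _ : Fin 3 => ℝ) i).hasFDerivAt.comp y
        hd.hasFDerivAt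
      exact congrArg (fun g : E7 →L[ℝ] ℝ => g X) h4.fderiv
    rw [← h3, h1, inChart_apply, ← infAct_symm h hy, ← infAct_symm h hy]
    exact h2
  have hexp := alternating_vec_expand (Form.inChart φ p y) (coordField p y : (Fin 3 → ℝ) →ₗ[ℝ] E7)
    a b X
  simp only [ContinuousLinearMap.coe_coe] at hexp
  rw [hexp, dotProduct]
  simp only [hcomp]

/-- The four arguments of `*φ` include the linearly dependent vectors `U₁, U₂, U₃`. -/
theorem fderiv_mu_eq_zero [ContinuousSMul Torus3 M] (h : IsSmoothAction M) {φ : Form 3 M}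
    {μ : M → ℝ} (hμ : IsMultiMomentStar φ μ) {p : M} {y : E7}
    (hy : y ∈ (extChartAt (𝓡 7) p).target) {a : Fin 3 → ℝ} (ha0 : a ≠ 0)
    (ha : coordField p y a = 0) :
    fderiv ℝ (fun y => μ ((extChartAt (𝓡 7) p).symm y)) y = 0 := by
  ext X
  have h0 := (coordField_eq_zero_iff h hy a).2 ha
  have h1 := hμ.deriv ((extChartAt (𝓡 7) p).symm y) (chartTangent p y X)
  have h2 := fderiv_comp_symm hμ.smooth hy X
  rw [h2]
  refine Eq.trans h1 ?_
  refine AlternatingMap.map_linearDependent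
    (starForm φ ((extChartAt (𝓡 7) p).symm y)).toAlternatingMap _ fun hli => ha0 ?_
  rw [Fintype.linearIndependent_iff] at hli
  have h3 : ∀ q : M, infAct q a = a 0 • gen 0 q + a 1 • gen 1 q + a 2 • gen 2 q := fun q => by
    simp only [gen]
    rw [← map_smul, ← map_smul, ← map_smul, ← map_add, ← map_add]
    congr 1
    funext i; fin_cases i <;> simp
  have h4 := hli ![a 0, a 1, a 2, 0] (by
    rw [Fin.sum_univ_four]
    exact (congrArg₂ (· + ·) ((h3 _).symm.trans h0) (zero_smul ℝ _)).trans (add_zero _))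
  funext i
  fin_cases i
  · exact h4 0
  · exact h4 1
  · exact h4 2

/-- The isotropy representation preserves the three-form. -/
theorem inChart_isotropyRep [ContinuousSMul Torus3 M] {φ : Form 3 M}
    (hφ : IsG2WithTorusSymmetry φ) {p : M} {g : Torus3} (hg : g • p = p) (X Y Z : E7) :
    Form.inChart φ p (extChartAt (𝓡 7) p p)
      ![isotropyRep p g X, isotropyRep p g Y, isotropyRep p g Z] =
    Form.inChart φ p (extChartAt (𝓡 7) p p) ![X, Y, Z] := by
  set y₀ := extChartAt (𝓡 7) p p
  have hy₀ : y₀ ∈ (extChartAt (𝓡 7) p).target := mem_extChartAt_target p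
  have hsymm : (extChartAt (𝓡 7) p).symm y₀ = p := extChartAt_to_inv p
  have hsm : ContMDiff (𝓡 7) (𝓡 7) ∞ (fun q : M => g • q) := by
    obtain ⟨t, rfl⟩ := isOpenQuotientMap_expT.surjective g
    exact hφ.smooth_action.comp (contMDiff_const.prodMk contMDiff_id)
  let G : E7 →L[ℝ] E7 := mfderiv (𝓡 7) (𝓡 7) (fun q : M => g • q) p
  have hG : HasMFDerivAt (𝓡 7) (𝓡 7) (fun q : M => g • q) ((extChartAt (𝓡 7) p).symm y₀) G := by
    rw [hsymm]
    exact ((hsm.mdifferentiable (by simp)) p).hasMFDerivAt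
  have h1 := hG.comp y₀ (hasMFDerivAt_extChartAt_symm hy₀)
  have h2 : HasMFDerivAt 𝓘(ℝ, E7) (𝓡 7) (extChartAt (𝓡 7) p).symm (coordAct p g y₀)
      (chartTangent p y₀) := by
    rw [coordAct_stabilizer hg]; exact hasMFDerivAt_extChartAt_symm hy₀
  have h3 := h2.comp y₀
    (hasFDerivAt_coordAct hφ.smooth_action (stabilizer_mem_coordDom hg)).hasMFDerivAt
  have h4 : G.comp (chartTangent p y₀) = (chartTangent p y₀).comp (isotropyRep p g) := by
    refine hasMFDerivAt_unique h1 (h3.congr_of_eventuallyEq ?_)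
    have : ∀ᶠ y in 𝓝 y₀, (g, y) ∈ coordDom p :=
      ContinuousAt.eventually_mem (f := fun y : E7 => (g, y)) (by fun_prop)
        ((isOpen_coordDom p).mem_nhds (stabilizer_mem_coordDom hg))
    filter_upwards [this] with y hy using (symm_coordAct hy).symm
  have h5 : ∀ X, G (chartTangent p y₀ X) = chartTangent p y₀ (isotropyRep p g X) := fun X =>
    congrArg (fun f : E7 →L[ℝ] E7 => f X) h4
  have h6 : (formAt φ (g • p)).compContinuousLinearMap G = formAt φ p := hφ.preserves g p
  rw [hg] at h6
  rw [inChart_apply, inChart_apply, hsymm, ← h5, ← h5, ← h5]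
  conv_rhs => rw [← h6]
  rw [ContinuousAlternatingMap.compContinuousLinearMap_apply]
  congr 1
  funext i; fin_cases i <;> rfl

/-- Because the torus is abelian, a stabilising element fixes every point of the orbit, hence its
tangent vectors. Orbit directions are thus null vectors of the isotropy algebra. -/
theorem isotropyRep_coordField [ContinuousSMul Torus3 M] (h : IsSmoothAction M) {p : M}
    {g : Torus3} (hg : g • p = p) (b : Fin 3 → ℝ) :
    isotropyRep p g (coordField p (extChartAt (𝓡 7) p p) b) =
      coordField p (extChartAt (𝓡 7) p p) b := by
  set y₀ := extChartAt (𝓡 7) p p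
  have hy₀ : y₀ ∈ (extChartAt (𝓡 7) p).target := mem_extChartAt_target p
  have h1 := hasFDerivAt_coordField h hy₀
  have h2 : HasFDerivAt (coordAct p g) (isotropyRep p g) (coordAct p (expT 0) y₀) := by
    rw [expT_zero, coordAct_one hy₀]
    exact hasFDerivAt_coordAct h (stabilizer_mem_coordDom hg)
  have h3 := h2.comp (0 : Fin 3 → ℝ) h1
  have hev : ∀ᶠ t in 𝓝 (0 : Fin 3 → ℝ), (expT t, y₀) ∈ coordDom p := by
    refine ContinuousAt.eventually_mem (f := fun t : Fin 3 → ℝ => (expT t, y₀))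
      ?_ ((isOpen_coordDom p).mem_nhds (expT_zero_mem_coordDom hy₀))
    have := continuous_expT
    fun_prop
  have h4 := h1.unique (h3.congr_of_eventuallyEq (by
    filter_upwards [hev] with t ht
    rw [Function.comp_apply, ← coordAct_mul g _ ht, mul_comm,
      coordAct_mul _ g (stabilizer_mem_coordDom hg), coordAct_stabilizer hg]))
  exact (congrArg (fun f : (Fin 3 → ℝ) →L[ℝ] E7 => f b) h4).symm

/-- The cross product as a continuous bilinear map. -/
noncomputable def crossCL : E7 →L[ℝ] E7 →L[ℝ] E7 :=
  LinearMap.toContinuousLinearMap ((LinearMap.toContinuousLinearMap :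
    (E7 →ₗ[ℝ] E7) ≃ₗ[ℝ] (E7 →L[ℝ] E7)).toLinearMap ∘ₗ
    LinearMap.mk₂ ℝ cross add_cross smul_cross cross_add cross_smul)

theorem crossCL_apply (X Y : E7) : crossCL X Y = cross X Y := rfl

/-- Read in an adapted coframe, the isotropy representation of the Lie algebra of the stabiliser
consists of infinitesimal symmetries of `φ₀`. -/
theorem phi0_isotropyGen [ContinuousSMul Torus3 M] {φ : Form 3 M}
    (hφ : IsG2WithTorusSymmetry φ) {p : M} {f : E7 ≃L[ℝ] E7}
    (hf : ∀ X Y Z : E7, Form.inChart φ p (extChartAt (𝓡 7) p p) ![X, Y, Z] =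
      inner ℝ (cross (f X) (f Y)) (f Z)) {a : Fin 3 → ℝ} (ha : infAct p a = 0) (X Y Z : E7) :
    (inner ℝ (cross (f (isotropyGen p a X)) (f Y)) (f Z) : ℝ) +
      inner ℝ (cross (f X) (f (isotropyGen p a Y))) (f Z) +
      inner ℝ (cross (f X) (f Y)) (f (isotropyGen p a Z)) = 0 := by
  let R : ℝ → E7 →L[ℝ] E7 := fun s => isotropyRep p (expT (s • a))
  have hR0 : R 0 = ContinuousLinearMap.id ℝ E7 := by
    simp only [R]; rw [zero_smul, expT_zero, isotropyRep_one]
  have hder : ∀ X, HasDerivAt (fun s => f (R s X)) (f (isotropyGen p a X)) 0 := fun X => by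
    have h1 := (hasDerivAt_isotropyRep_smul hφ.smooth_action p a).clm_apply
      (hasDerivAt_const (0 : ℝ) X)
    have h2 : HasDerivAt (fun s => R s X) (isotropyGen p a X) 0 := by simpa using h1
    exact (f : E7 →L[ℝ] E7).hasFDerivAt.comp_hasDerivAt (0 : ℝ) h2
  have h1 : HasDerivAt (fun s => (inner ℝ (crossCL (f (R s X)) (f (R s Y))) (f (R s Z)) : ℝ)) _ 0 :=
    (((crossCL.hasFDerivAt.comp_hasDerivAt (0 : ℝ) (hder X)).clm_apply (hder Y))).inner ℝ (hder Z)
  -- The isotropy representation preserves the form, so this function is constant; the claim is the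
  -- vanishing of its derivative by the product rule.
  have h2 : (fun s => (inner ℝ (crossCL (f (R s X)) (f (R s Y))) (f (R s Z)) : ℝ)) =
      fun _ => (inner ℝ (cross (f X) (f Y)) (f Z) : ℝ) := by
    funext s
    rw [crossCL_apply, ← hf, ← hf]
    exact inChart_isotropyRep hφ (expT_smul_eq_of_infAct_eq_zero hφ.smooth_action ha s) X Y Z
  rw [h2] at h1
  have h3 := h1.unique (hasDerivAt_const 0 _)
  simp only [hR0, ContinuousLinearMap.id_apply, crossCL_apply, Function.comp_apply,
    inner_add_left] at h3
  linarith

end Moment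

/-! ### The Lie algebra of the stabiliser and its weights -/

section IsotropyAlg

variable {M : Type*} [TopologicalSpace M] [ChartedSpace E7 M] [MulAction Torus3 M]

/-- The Lie algebra of the stabiliser of `p`. -/
noncomputable def isotropyAlg (p : M) : Submodule ℝ (Fin 3 → ℝ) :=
  LinearMap.ker (infAct p).toLinearMap

theorem mem_isotropyAlg {p : M} {a : Fin 3 → ℝ} : a ∈ isotropyAlg p ↔ infAct p a = 0 := Iff.rfl

variable [IsManifold (𝓡 7) ∞ M] [ContinuousSMul Torus3 M]

theorem expT_smul_of_mem (h : IsSmoothAction M) {p : M} {a : Fin 3 → ℝ}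
    (ha : a ∈ isotropyAlg p) : expT a • p = p := by
  have := expT_smul_eq_of_infAct_eq_zero h ha 1
  rwa [one_smul] at this

/-- A description by the group alone, which makes the algebra visibly constant along orbits and lets
it descend to the orbit space. -/
theorem mem_isotropyAlg_iff (h : IsSmoothAction M) {p : M} {a : Fin 3 → ℝ} :
    a ∈ isotropyAlg p ↔ ∀ s : ℝ, expT (s • a) • p = p := by
  refine ⟨fun ha s => expT_smul_eq_of_infAct_eq_zero h ha s, fun ha => ?_⟩
  refine (infAct_eq_zero_iff h p a).2 ?_
  refine (hasDerivAt_coordAct_smul h (mem_extChartAt_target p) a).unique ?_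
  refine (hasDerivAt_const (0 : ℝ) (extChartAt (𝓡 7) p p)).congr_of_eventuallyEq ?_
  exact Eventually.of_forall fun s => coordAct_stabilizer (ha s)

theorem isotropyAlg_smul (h : IsSmoothAction M) (g : Torus3) (p : M) :
    isotropyAlg (g • p) = isotropyAlg p := by
  ext a
  rw [mem_isotropyAlg_iff h, mem_isotropyAlg_iff h]
  refine forall_congr' fun s => ?_
  rw [← mul_smul, mul_comm, mul_smul, smul_left_cancel_iff]

theorem isotropyGen_comm (h : IsSmoothAction M) {p : M} {a b : Fin 3 → ℝ}
    (ha : a ∈ isotropyAlg p) (hb : b ∈ isotropyAlg p) (x : E7) :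
    isotropyGen p a (isotropyGen p b x) = isotropyGen p b (isotropyGen p a x) := by
  have hR : ∀ s t : ℝ, ∀ x, isotropyRep p (expT (s • a)) (isotropyRep p (expT (t • b)) x) =
      isotropyRep p (expT (t • b)) (isotropyRep p (expT (s • a)) x) := fun s t x => by
    have h1 := isotropyRep_mul h (expT_smul_eq_of_infAct_eq_zero h ha s)
      (expT_smul_eq_of_infAct_eq_zero h hb t)
    rw [mul_comm, isotropyRep_mul h (expT_smul_eq_of_infAct_eq_zero h hb t)
      (expT_smul_eq_of_infAct_eq_zero h ha s)] at h1
    exact (congrArg (fun f : E7 →L[ℝ] E7 => f x) h1).symm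
  have hd : ∀ (a : Fin 3 → ℝ) (x : E7),
      HasDerivAt (fun s : ℝ => isotropyRep p (expT (s • a)) x) (isotropyGen p a x) 0 := fun a x => by
    have := (hasDerivAt_isotropyRep_smul h p a).clm_apply (hasDerivAt_const (0 : ℝ) x)
    simpa using this
  have h1 : ∀ (t : ℝ) (x : E7), isotropyGen p a (isotropyRep p (expT (t • b)) x) =
      isotropyRep p (expT (t • b)) (isotropyGen p a x) := fun t x =>
    (hd a (isotropyRep p (expT (t • b)) x)).unique
      (((isotropyRep p (expT (t • b))).hasFDerivAt.comp_hasDerivAt (0 : ℝ) (hd a x)).congr_of_eventuallyEq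
        (Eventually.of_forall fun s => hR s t x))
  exact ((isotropyGen p a).hasFDerivAt.comp_hasDerivAt (0 : ℝ) (hd b x)).unique
    ((hd b (isotropyGen p a x)).congr_of_eventuallyEq (Eventually.of_forall fun t => h1 t x))

theorem isotropyGen_coordField (h : IsSmoothAction M) {p : M} {a : Fin 3 → ℝ}
    (ha : a ∈ isotropyAlg p) (b : Fin 3 → ℝ) :
    isotropyGen p a (coordField p (extChartAt (𝓡 7) p p) b) = 0 := by
  have h1 := (hasDerivAt_isotropyRep_smul h p a).clm_apply
    (hasDerivAt_const (0 : ℝ) (coordField p (extChartAt (𝓡 7) p p) b))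
  rw [map_zero, add_zero] at h1
  exact h1.unique ((hasDerivAt_const (0 : ℝ) (coordField p (extChartAt (𝓡 7) p p) b)).congr_of_eventuallyEq
    (Eventually.of_forall fun s =>
      isotropyRep_coordField h (expT_smul_eq_of_infAct_eq_zero h ha s) b))

theorem expT_eq_one_iff (a : Fin 3 → ℝ) :
    expT ((2 * Real.pi) • a) = 1 ↔ ∃ n : Fin 3 → ℤ, a = realVec n := by
  have hpi := Real.two_pi_pos.ne'
  constructor
  · intro h
    have h1 : ∀ i, ∃ n : ℤ, a i = n := fun i => by
      have h2 : Circle.exp (2 * Real.pi * a i) = 1 := congrFun h i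
      obtain ⟨n, hn⟩ := Circle.exp_eq_one.1 h2
      exact ⟨n, by rw [mul_comm] at hn; exact mul_right_cancel₀ hpi hn⟩
    choose n hn using h1
    exact ⟨n, funext hn⟩
  · rintro ⟨n, rfl⟩
    funext i
    exact Circle.exp_eq_one.2 ⟨n i, by simp [realVec]; ring⟩

theorem eq_zero_of_expT_eq_one {a : Fin 3 → ℝ} (h : ∀ s : ℝ, expT (s • a) = 1) : a = 0 := by
  by_contra hne
  obtain ⟨i, hi⟩ := Function.ne_iff.1 hne
  have h2 := congrFun (h (Real.pi / a i)) i
  have h3 : Circle.exp Real.pi = 1 := by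
    simpa [expT, div_mul_cancel₀ _ hi] using h2
  obtain ⟨n, hn⟩ := Circle.exp_eq_one.1 h3
  have h4 : (1 : ℝ) = 2 * n := by
    have := Real.pi_pos.ne'
    field_simp at hn
    linarith
  have h5 : (1 : ℤ) = 2 * n := by exact_mod_cast h4
  omega

variable [T2Space M] [ConnectedSpace M]

/-- If the generator vanishes, the isotropy representation is trivial along the one-parameter group,
which by faithfulness is itself trivial; and `expT (s • a) = 1` for all `s` forces `a = 0`. -/
theorem eq_zero_of_isotropyGen_eq_zero (h : IsSmoothAction M) (heff : FaithfulSMul Torus3 M)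
    {p : M} {a : Fin 3 → ℝ} (ha : a ∈ isotropyAlg p) (h0 : isotropyGen p a = 0) : a = 0 := by
  refine eq_zero_of_expT_eq_one fun s =>
    eq_one_of_isotropyRep h heff (expT_smul_eq_of_infAct_eq_zero h ha s) ?_
  have h1 : ∀ s, HasDerivAt (fun s : ℝ => isotropyRep p (expT (s • a))) 0 s := fun s => by
    have := hasDerivAt_isotropyRep_smul' h ha s
    rwa [h0, ContinuousLinearMap.comp_zero] at this
  have h2 := is_const_of_deriv_eq_zero (fun s => (h1 s).differentiableAt)
    (fun s => (h1 s).deriv) s 0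
  rw [h2, zero_smul, expT_zero, isotropyRep_one]

end IsotropyAlg

/-! ### Complex frames adapted to the isotropy algebra -/

section Frames

variable {M : Type*} [TopologicalSpace M] [ChartedSpace E7 M] [MulAction Torus3 M]

/-- A linear identification of `ℝ ⊕ ℂ³` with the tangent space at `p`, in the preferred chart,
under which the Lie algebra of the stabiliser acts diagonally on `ℂ³`, with weights `α`. -/
structure IsIsotropyFrame (φ : Form 3 M) (p : M) (G : (ℝ × (Fin 3 → ℂ)) ≃L[ℝ] E7)
    (α : Fin 3 → isotropyAlg p →ₗ[ℝ] ℝ) : Prop where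
  sum_eq_zero : ∑ j, α j = 0
  gen_eq : ∀ (a : isotropyAlg p) s z, isotropyGen p (a : Fin 3 → ℝ) (G (s, z)) =
    G (0, fun j => Complex.I * α j a * z j)
  form_eq : ∀ j, Form.inChart φ p (extChartAt (𝓡 7) p p)
    ![G (1, 0), G (0, Pi.single j 1), G (0, Pi.single j Complex.I)] = 1
  form_eq' : ∀ j, Form.inChart φ p (extChartAt (𝓡 7) p p)
    ![G (0, Pi.single j Complex.I), G (1, 0), G (0, Pi.single j 1)] = 1

/-- The isotropy representation of the Lie algebra of the stabiliser, in a coframe. -/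
noncomputable def isotropyFamily (f : E7 ≃L[ℝ] E7) (p : M) : isotropyAlg p →ₗ[ℝ] E7 →ₗ[ℝ] E7 where
  toFun a := (f : E7 →ₗ[ℝ] E7) ∘ₗ (isotropyGen p (a : Fin 3 → ℝ) : E7 →ₗ[ℝ] E7) ∘ₗ
    (f.symm : E7 →ₗ[ℝ] E7)
  map_add' a b := by ext x; simp
  map_smul' c a := by ext x; simp

theorem isotropyFamily_apply (f : E7 ≃L[ℝ] E7) (p : M) (a : isotropyAlg p) (x : E7) :
    isotropyFamily f p a x = f (isotropyGen p (a : Fin 3 → ℝ) (f.symm x)) := rfl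

theorem exists_isIsotropyFrame_of_isWeightVector {φ : Form 3 M} {p : M} {f : E7 ≃L[ℝ] E7}
    (hf : ∀ X Y Z : E7, Form.inChart φ p (extChartAt (𝓡 7) p p) ![X, Y, Z] =
      inner ℝ (cross (f X) (f Y)) (f Z)) {u w : E7} {α₀ : isotropyAlg p →ₗ[ℝ] ℝ}
    (hu : IsToralFamily (isotropyFamily f p) u) (hw : IsWeightVector (isotropyFamily f p) u w α₀) :
    ∃ G α, IsIsotropyFrame φ p G α ∧ α 0 = α₀ ∧ f (G (1, 0)) = u ∧
      f (G (0, Pi.single 0 1)) = w := by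
  obtain ⟨v, α, hv0, hα0, hsum, hv, hbij⟩ := hu.exists_frame hw
  let F : (ℝ × (Fin 3 → ℂ)) ≃L[ℝ] E7 :=
    (LinearEquiv.ofBijective (IsToralFamily.frameMap u v) hbij).toContinuousLinearEquiv
  have hF : ∀ x, F x = IsToralFamily.frameMap u v x := fun x => rfl
  let G := F.trans f.symm
  have hfG : ∀ x, f (G x) = IsToralFamily.frameMap u v x := fun x => f.apply_symm_apply _
  have h1 : IsToralFamily.frameMap u v (1, 0) = u := by simp [IsToralFamily.frameMap]
  have h2 : ∀ j, IsToralFamily.frameMap u v (0, Pi.single j 1) = v j := fun j => by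
    fin_cases j <;> simp [IsToralFamily.frameMap, Fin.sum_univ_three]
  have h3 : ∀ j, IsToralFamily.frameMap u v (0, Pi.single j Complex.I) = cross u (v j) := fun j => by
    fin_cases j <;> simp [IsToralFamily.frameMap, Fin.sum_univ_three]
  have hval : ∀ j, (inner ℝ (cross u (v j)) (cross u (v j)) : ℝ) = 1 := fun j => by
    rw [inner_cross_cross, hu.inner_self_u, real_inner_self_eq_norm_sq, (hv j).norm_eq_one,
      (hv j).inner_eq_zero]
    norm_num
  refine ⟨G, α, ⟨hsum, fun a s z => ?_, fun j => ?_, fun j => ?_⟩, hα0, ?_, ?_⟩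
  · apply f.injective
    have := hu.apply_frameMap hv a s z
    rw [isotropyFamily_apply] at this
    rw [hfG, ← this]
    rfl
  · rw [hf, hfG, hfG, hfG, h1, h2, h3, hval]
  · rw [hf, hfG, hfG, hfG, h1, h2, h3, inner_cross_rotate, hval]
  · rw [hfG, h1]
  · rw [hfG, h2, hv0]

variable [IsManifold (𝓡 7) ∞ M] [ContinuousSMul Torus3 M] {φ : Form 3 M}
  (hφ : IsG2WithTorusSymmetry φ) {p : M}
include hφ

theorem isotropyFamily_phi0 {f : E7 ≃L[ℝ] E7}
    (hf : ∀ X Y Z : E7, Form.inChart φ p (extChartAt (𝓡 7) p p) ![X, Y, Z] =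
      inner ℝ (cross (f X) (f Y)) (f Z)) (a : isotropyAlg p) (X Y Z : E7) :
    (inner ℝ (cross (isotropyFamily f p a X) Y) Z : ℝ) +
      inner ℝ (cross X (isotropyFamily f p a Y)) Z +
      inner ℝ (cross X Y) (isotropyFamily f p a Z) = 0 := by
  have := phi0_isotropyGen hφ hf a.2 (f.symm X) (f.symm Y) (f.symm Z)
  simpa only [isotropyFamily_apply, ContinuousLinearEquiv.apply_symm_apply] using this

theorem isotropyFamily_comm (f : E7 ≃L[ℝ] E7) (a b : isotropyAlg p) (x : E7) :
    isotropyFamily f p a (isotropyFamily f p b x) =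
      isotropyFamily f p b (isotropyFamily f p a x) := by
  simp only [isotropyFamily_apply, ContinuousLinearEquiv.symm_apply_apply]
  rw [isotropyGen_comm hφ.smooth_action a.2 b.2]

theorem isToralFamily_isotropyFamily {f : E7 ≃L[ℝ] E7}
    (hf : ∀ X Y Z : E7, Form.inChart φ p (extChartAt (𝓡 7) p p) ![X, Y, Z] =
      inner ℝ (cross (f X) (f Y)) (f Z)) {u : E7} (hu : ‖u‖ = 1)
    (hAu : ∀ a, isotropyFamily f p a u = 0) : IsToralFamily (isotropyFamily f p) u :=
  ⟨isotropyFamily_comm hφ f, isotropyFamily_phi0 hφ hf, hu, hAu⟩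

theorem isotropyFamily_coordField (f : E7 ≃L[ℝ] E7) (a : isotropyAlg p) (b : Fin 3 → ℝ) :
    isotropyFamily f p a (f (coordField p (extChartAt (𝓡 7) p p) b)) = 0 := by
  rw [isotropyFamily_apply, ContinuousLinearEquiv.symm_apply_apply,
    isotropyGen_coordField hφ.smooth_action a.2, map_zero]

end Frames

/-! ### Weights, dimension bound and the integral lattice -/

namespace IsIsotropyFrame

variable {M : Type*} [TopologicalSpace M] [ChartedSpace E7 M] [MulAction Torus3 M]
  {φ : Form 3 M} {p : M} {G : (ℝ × (Fin 3 → ℂ)) ≃L[ℝ] E7} {α : Fin 3 → isotropyAlg p →ₗ[ℝ] ℝ}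

theorem gen_eq_zero_iff (hG : IsIsotropyFrame φ p G α) (a : isotropyAlg p) (s : ℝ)
    (z : Fin 3 → ℂ) :
    isotropyGen p (a : Fin 3 → ℝ) (G (s, z)) = 0 ↔ ∀ j, α j a = 0 ∨ z j = 0 := by
  rw [hG.gen_eq, map_eq_zero_iff G G.injective, Prod.mk_eq_zero]
  simp only [true_and]
  rw [funext_iff]
  simp

theorem sum_apply (hG : IsIsotropyFrame φ p G α) (a : isotropyAlg p) :
    α 0 a + α 1 a + α 2 a = 0 := by
  have := congrArg (fun β : isotropyAlg p →ₗ[ℝ] ℝ => β a) hG.sum_eq_zero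
  simpa [Fin.sum_univ_three] using this

variable [IsManifold (𝓡 7) ∞ M] [ContinuousSMul Torus3 M]

/-- The infinitesimal action is integrated by composing the representation at time `t` with the
explicit inverse flow `y z t`: the composite has zero derivative in `t`, so it equals its value at
`0`. -/
theorem rep_eq (hG : IsIsotropyFrame φ p G α) (h : IsSmoothAction M) (a : isotropyAlg p) (s : ℝ)
    (z : Fin 3 → ℂ) : isotropyRep p (expT (a : Fin 3 → ℝ)) (G (s, z)) =
      G (s, fun j => Complex.exp (Complex.I * α j a) * z j) := by
  let y : (Fin 3 → ℂ) → ℝ → Fin 3 → ℂ := fun z t j => Complex.exp (-(t * (Complex.I * α j a))) * z j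
  have hy : ∀ z t, HasDerivAt (fun t => G (s, y z t))
      (-isotropyGen p (a : Fin 3 → ℝ) (G (s, y z t))) t := by
    intro z t
    have h1 : HasDerivAt (y z) (fun j => -(Complex.I * α j a * y z t j)) t := by
      refine hasDerivAt_pi.2 fun j => ?_
      have h2 : HasDerivAt (fun t : ℝ => (-((t : ℂ) * (Complex.I * α j a)))) (-(1 * (Complex.I * α j a))) t :=
        ((Complex.ofRealCLM.hasDerivAt (x := t)).mul_const _).neg
      have h3 := (h2.cexp).mul_const (z j)
      exact h3.congr_deriv (by simp only [y]; ring)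
    have h4 := (G : (ℝ × (Fin 3 → ℂ)) →L[ℝ] E7).hasFDerivAt.comp_hasDerivAt t
      ((hasDerivAt_const t s).prodMk h1)
    have h5 : -isotropyGen p (a : Fin 3 → ℝ) (G (s, y z t)) =
        G (0, fun j => -(Complex.I * α j a * y z t j)) := by
      rw [hG.gen_eq, ← map_neg, Prod.neg_mk, neg_zero]; rfl
    rw [h5]
    exact h4
  have hk : ∀ z t, HasDerivAt (fun t : ℝ => isotropyRep p (expT (t • (a : Fin 3 → ℝ))) (G (s, y z t)))
      0 t := fun z t => by
    have h5 := (hasDerivAt_isotropyRep_smul' h a.2 t).clm_apply (hy z t)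
    rw [ContinuousLinearMap.comp_apply, map_neg, add_neg_cancel] at h5
    exact h5
  have hc : ∀ z, isotropyRep p (expT (a : Fin 3 → ℝ)) (G (s, y z 1)) = G (s, z) := fun z => by
    have h6 := is_const_of_deriv_eq_zero (fun t => (hk z t).differentiableAt)
      (fun t => (hk z t).deriv) 1 0
    have h7 : y z 0 = z := by funext j; simp [y]
    simp only [zero_smul, one_smul, expT_zero, isotropyRep_one, h7] at h6
    exact h6
  have h8 : y (fun j => Complex.exp (Complex.I * α j a) * z j) 1 = z := by
    funext j
    simp only [y, Complex.ofReal_one, one_mul, ← mul_assoc, ← Complex.exp_add, neg_add_cancel,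
      Complex.exp_zero]
  have h9 := hc (fun j => Complex.exp (Complex.I * α j a) * z j)
  rwa [h8] at h9

variable [T2Space M] [ConnectedSpace M] (hφ : IsG2WithTorusSymmetry φ)
include hφ

theorem eq_zero (hG : IsIsotropyFrame φ p G α) {a : isotropyAlg p} (ha : ∀ j, α j a = 0) :
    a = 0 := by
  refine Subtype.ext (eq_zero_of_isotropyGen_eq_zero hφ.smooth_action hφ.effective a.2 ?_)
  ext1 x
  obtain ⟨⟨s, z⟩, rfl⟩ := G.surjective x
  exact (hG.gen_eq_zero_iff a s z).2 fun j => Or.inl (ha j)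

theorem injective_prod (hG : IsIsotropyFrame φ p G α) :
    Function.Injective ((α 0).prod (α 1)) := by
  refine (injective_iff_map_eq_zero _).2 fun a ha => hG.eq_zero hφ ?_
  have h0 : α 0 a = 0 := congrArg Prod.fst ha
  have h1 : α 1 a = 0 := congrArg Prod.snd ha
  have h2 := hG.sum_apply a
  intro j
  fin_cases j
  · exact h0
  · exact h1
  · change α 2 a = 0; linarith

/-- Since the weights sum to zero, two of them already separate the elements of the isotropy
algebra, so it embeds in `ℝ²`. -/
theorem finrank_le_two (hG : IsIsotropyFrame φ p G α) : finrank ℝ (isotropyAlg p) ≤ 2 := by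
  have := LinearMap.finrank_le_finrank_of_injective (hG.injective_prod hφ)
  simpa using this

/-- The integral lattice of the Lie algebra of the stabiliser is cut out by the weights. -/
theorem integral_iff (hG : IsIsotropyFrame φ p G α) (a : isotropyAlg p) :
    (∃ n, (a : Fin 3 → ℝ) = realVec n) ↔ ∀ j, ∃ n : ℤ, α j a = n := by
  have hval : ∀ j, α j ((2 * Real.pi) • a) = 2 * Real.pi * α j a := fun j => by simp
  have hrep := hG.rep_eq hφ.smooth_action ((2 * Real.pi) • a)
  have hfix := expT_smul_of_mem hφ.smooth_action ((2 * Real.pi) • a).2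
  have hpi := Real.two_pi_pos.ne'
  have hexp : ∀ j, Complex.exp (Complex.I * α j ((2 * Real.pi) • a)) = 1 ↔ ∃ n : ℤ, α j a = n := by
    intro j
    rw [Complex.exp_eq_one_iff, hval]
    refine exists_congr fun n => ?_
    constructor
    · intro hn
      have h1 : ((2 * Real.pi * α j a : ℝ) : ℂ) = ((2 * Real.pi * n : ℝ) : ℂ) := by
        apply mul_left_cancel₀ Complex.I_ne_zero
        rw [hn]; push_cast; ring
      exact mul_left_cancel₀ hpi (Complex.ofReal_injective h1)
    · intro hn
      rw [hn]; push_cast; ring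
  -- Integrality of `a` means `expT (2π a) = 1`. By faithfulness this holds exactly when its
  -- isotropy representation is trivial, and that has eigenvalues `exp(2πi α j a)`.
  rw [← expT_eq_one_iff]
  constructor
  · intro h1 j
    rw [← hexp]
    have h2 := hrep 0 1
    rw [Submodule.coe_smul, h1, isotropyRep_one] at h2
    have h3 := congrFun (congrArg Prod.snd (G.injective h2)) j
    simpa using h3.symm
  · intro h1
    refine eq_one_of_isotropyRep hφ.smooth_action hφ.effective hfix ?_
    ext1 x
    obtain ⟨⟨s, z⟩, rfl⟩ := G.surjective x
    have h2 : (fun j => Complex.exp (Complex.I * α j ((2 * Real.pi) • a)) * z j) = z := by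
      funext j
      rw [(hexp j).2 (h1 j), one_mul]
    have h3 := hrep s z
    rw [h2] at h3
    exact h3

/-- If `d` divides the integral vector, then `a / d` is integral too, so its weight `1/d` must be an
integer. -/
theorem exists_isPrimitive (hG : IsIsotropyFrame φ p G α) {a : isotropyAlg p}
    (ha : ∀ j, ∃ n : ℤ, α j a = n) {j : Fin 3} (hj : α j a = 1) :
    ∃ v, IsPrimitive v ∧ (a : Fin 3 → ℝ) = realVec v := by
  obtain ⟨v, hv⟩ := (hG.integral_iff hφ a).2 ha
  refine ⟨v, fun d hd => ?_, hv⟩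
  choose w hw using hd
  have hav : (a : Fin 3 → ℝ) = (d : ℝ) • realVec w := by
    rw [hv]; funext i; simp [realVec, hw]
  have hd0 : (d : ℝ) ≠ 0 := by
    intro h0
    rw [h0, zero_smul] at hav
    have : a = 0 := Subtype.ext hav
    rw [this, map_zero] at hj
    exact zero_ne_one hj
  have hb : realVec w = ((d : ℝ)⁻¹ • a : isotropyAlg p) := by
    rw [Submodule.coe_smul, hav, smul_smul, inv_mul_cancel₀ hd0, one_smul]
  obtain ⟨n, hn⟩ := (hG.integral_iff hφ ((d : ℝ)⁻¹ • a)).1 ⟨w, hb.symm⟩ j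
  rw [map_smul, hj, smul_eq_mul, mul_one] at hn
  refine IsUnit.of_mul_eq_one n ?_
  have : (d : ℝ) * n = 1 := by rw [← hn, mul_inv_cancel₀ hd0]
  exact_mod_cast this

end IsIsotropyFrame

/-! ### Slices -/

section Slices

variable {M : Type*} [TopologicalSpace M] [ChartedSpace E7 M] [MulAction Torus3 M]
variable {N : Type*} [NormedAddCommGroup N] [NormedSpace ℝ N]

/-- An invariant complement to the tangent space of the orbit through `p`. -/
structure IsSlice (p : M) (ι : N →L[ℝ] E7) : Prop where
  exists_eq : ∀ X, ∃ b n, X = coordField p (extChartAt (𝓡 7) p p) b + ι n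
  eq_zero : ∀ b n, coordField p (extChartAt (𝓡 7) p p) b + ι n = 0 →
    coordField p (extChartAt (𝓡 7) p p) b = 0 ∧ n = 0
  invariant : ∀ a ∈ isotropyAlg p, ∀ n, ∃ n', isotropyGen p a (ι n) = ι n'

/-- The point of the manifold with given slice coordinates. -/
noncomputable def slicePoint (p : M) (Λ : E7 → E7) (ι : N →L[ℝ] E7) (n : N) : M :=
  (extChartAt (𝓡 7) p).symm (Λ (ι n))

/-- The orbit with given slice coordinates. -/
noncomputable def sliceMap (p : M) (Λ : E7 → E7) (ι : N →L[ℝ] E7) (n : N) : OrbitSpace M :=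
  Quotient.mk (MulAction.orbitRel Torus3 M) (slicePoint p Λ ι n)

/-- The slice coordinates of size less than `δ` describe the orbits near `p`. -/
structure IsSliceRadius (p : M) (ε : ℝ) (Λ : E7 → E7) (ι : N →L[ℝ] E7) (δ : ℝ) : Prop where
  pos : 0 < δ
  mem_ball : ∀ n ∈ Metric.ball (0 : N) δ, ι n ∈ Metric.ball (0 : E7) ε
  mem_isotropyAlg : ∀ n ∈ Metric.ball (0 : N) δ, ∀ b,
    b ∈ isotropyAlg (slicePoint p Λ ι n) ↔ b ∈ isotropyAlg p ∧ isotropyGen p b (ι n) = 0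
  isOpen_image : ∀ V ⊆ Metric.ball (0 : N) δ, IsOpen V → IsOpen (sliceMap p Λ ι '' V)

namespace IsLinearization

variable {p : M} {ε : ℝ} {Λ : E7 → E7}

theorem slicePoint_zero (hΛ : IsLinearization p ε Λ) (ι : N →L[ℝ] E7) :
    slicePoint p Λ ι 0 = p := by
  rw [slicePoint, _root_.map_zero, hΛ.map_zero, extChartAt_to_inv]

theorem continuousOn_fderiv (hΛ : IsLinearization p ε Λ) :
    ContinuousOn (fderiv ℝ Λ) (Metric.ball 0 ε) :=
  hΛ.contDiffOn.continuousOn_fderiv_of_isOpen Metric.isOpen_ball le_rfl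

theorem fderiv_zero (hΛ : IsLinearization p ε Λ) : fderiv ℝ Λ 0 = ContinuousLinearMap.id ℝ E7 :=
  hΛ.hasFDerivAt_zero.fderiv

theorem hasStrictFDerivAt_of_mem (hΛ : IsLinearization p ε Λ) {v : E7}
    (hv : v ∈ Metric.ball (0 : E7) ε) : HasStrictFDerivAt Λ (fderiv ℝ Λ v) v :=
  (hΛ.contDiffOn.contDiffAt (Metric.isOpen_ball.mem_nhds hv)).hasStrictFDerivAt (by simp)

theorem continuousOn_sliceMap (hΛ : IsLinearization p ε Λ) {ι : N →L[ℝ] E7} {δ : ℝ}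
    (hδ : IsSliceRadius p ε Λ ι δ) : ContinuousOn (sliceMap p Λ ι) (Metric.ball 0 δ) := by
  have h1 : ContinuousOn (slicePoint p Λ ι) (Metric.ball 0 δ) :=
    (continuousOn_extChartAt_symm p).comp
      (hΛ.contDiffOn.continuousOn.comp ι.continuous.continuousOn hδ.mem_ball)
      fun n hn => hΛ.mem_target _ (hδ.mem_ball n hn)
  exact continuous_quotient_mk'.comp_continuousOn h1

variable [IsManifold (𝓡 7) ∞ M] [ContinuousSMul Torus3 M]

/-- The derivative of the action restricted to the slice. -/
theorem hasStrictFDerivAt_coordAct_slice (h : IsSmoothAction M) (hΛ : IsLinearization p ε Λ)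
    {ι : N →L[ℝ] E7} {n : N} (hn : ι n ∈ Metric.ball (0 : E7) ε) :
    HasStrictFDerivAt (fun x : (Fin 3 → ℝ) × N => coordAct p (expT x.1) (Λ (ι x.2)))
      ((coordField p (Λ (ι n))).coprod ((fderiv ℝ Λ (ι n)).comp ι)) (0, n) := by
  have hy := hΛ.mem_target _ hn
  have hdom := expT_zero_mem_coordDom hy
  have hC := (contDiffAt_coordAct h hdom).hasStrictFDerivAt (n := ∞) (by simp)
  have h1 : HasStrictFDerivAt (fun x : (Fin 3 → ℝ) × N => Λ (ι x.2))
      ((fderiv ℝ Λ (ι n)).comp (ι.comp (ContinuousLinearMap.snd ℝ _ _))) ((0 : Fin 3 → ℝ), n) :=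
    HasStrictFDerivAt.comp (f := fun x : (Fin 3 → ℝ) × N => ι x.2) ((0 : Fin 3 → ℝ), n)
      (hΛ.hasStrictFDerivAt_of_mem hn) (ι.hasStrictFDerivAt.comp _ hasStrictFDerivAt_snd)
  have h2 := HasStrictFDerivAt.comp (f := fun x : (Fin 3 → ℝ) × N => (x.1, Λ (ι x.2)))
    ((0 : Fin 3 → ℝ), n) hC (hasStrictFDerivAt_fst.prodMk h1)
  refine h2.congr_fderiv ?_
  have h3 : ∀ t, fderiv ℝ (fun x : (Fin 3 → ℝ) × E7 => coordAct p (expT x.1) x.2) (0, Λ (ι n))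
      (t, 0) = coordField p (Λ (ι n)) t := fun t =>
    (congrArg (fun f : (Fin 3 → ℝ) →L[ℝ] E7 => f t) ((hC.hasFDerivAt.comp
      (f := fun t : Fin 3 → ℝ => ((t, Λ (ι n)) : (Fin 3 → ℝ) × E7)) 0
      (hasFDerivAt_prodMk_left 0 (Λ (ι n)))).fderiv)).symm
  have h4 : ∀ w, fderiv ℝ (fun x : (Fin 3 → ℝ) × E7 => coordAct p (expT x.1) x.2) (0, Λ (ι n))
      (0, w) = w := fun w => by
    have h5 : HasFDerivAt (coordAct p (expT 0)) (ContinuousLinearMap.id ℝ E7) (Λ (ι n)) := by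
      refine (hasFDerivAt_id _).congr_of_eventuallyEq ?_
      filter_upwards [(isOpen_extChartAt_target p).mem_nhds hy] with z hz
      rw [expT_zero, coordAct_one hz]; rfl
    exact congrArg (fun f : E7 →L[ℝ] E7 => f w) ((fderiv_coordAct_eq h hdom).unique h5)
  ext : 1
  · ext1 t
    simpa using h3 t
  · ext1 w
    simpa using h4 _

/-- The action map from Lie algebra times slice is a submersion at these points, hence open, and its
image near `Λ (ι n)` meets only orbits through `V`. The quotient map is open as well. -/
theorem isOpen_image_sliceMap (h : IsSmoothAction M) (hΛ : IsLinearization p ε Λ)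
    {ι : N →L[ℝ] E7} [CompleteSpace N] {V : Set N} (hV : IsOpen V)
    (hVε : ∀ n ∈ V, ι n ∈ Metric.ball (0 : E7) ε)
    (hsurj : ∀ n ∈ V, ∀ X, ∃ b n', X = coordField p (Λ (ι n)) b + fderiv ℝ Λ (ι n) (ι n')) :
    IsOpen (sliceMap p Λ ι '' V) := by
  rw [isOpen_iff_mem_nhds]
  rintro _ ⟨n, hn, rfl⟩
  have hy := hΛ.mem_target _ (hVε n hn)
  have h1 := (hasStrictFDerivAt_coordAct_slice h hΛ (hVε n hn)).map_nhds_eq_of_surj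
    (LinearMap.range_eq_top.2 fun X => by
      obtain ⟨b, n', rfl⟩ := hsurj n hn X
      exact ⟨(b, n'), rfl⟩)
  have h0 : coordAct p (expT 0) (Λ (ι n)) = Λ (ι n) := by rw [expT_zero, coordAct_one hy]
  simp only [h0] at h1
  have hΛc : ContinuousAt (fun x : (Fin 3 → ℝ) × N => (x.1, Λ (ι x.2))) (0, n) := by
    have h2 : ContinuousAt (fun x : (Fin 3 → ℝ) × N => Λ (ι x.2)) (0, n) :=
      (hΛ.hasStrictFDerivAt_of_mem (hVε n hn)).continuousAt.comp
        (f := fun x : (Fin 3 → ℝ) × N => ι x.2) (by fun_prop)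
    exact continuousAt_fst.prodMk h2
  have h3 : {x : (Fin 3 → ℝ) × N | x.2 ∈ V ∧ (expT x.1, Λ (ι x.2)) ∈ coordDom p} ∈
      𝓝 ((0 : Fin 3 → ℝ), n) :=
    Filter.inter_mem ((hV.preimage continuous_snd).mem_nhds hn)
      (hΛc.preimage_mem_nhds ((isOpen_expT_coordDom p).mem_nhds (expT_zero_mem_coordDom hy)))
  have h4 := h1 ▸ image_mem_map h3
  have hsrc := (extChartAt (𝓡 7) p).map_target hy
  have h5 : ContinuousAt (extChartAt (𝓡 7) p) (slicePoint p Λ ι n) :=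
    (continuousOn_extChartAt p).continuousAt ((isOpen_extChartAt_source p).mem_nhds hsrc)
  have h6 : extChartAt (𝓡 7) p (slicePoint p Λ ι n) = Λ (ι n) := (extChartAt (𝓡 7) p).right_inv hy
  rw [ContinuousAt, h6] at h5
  have h7 : ∀ᶠ q in 𝓝 (slicePoint p Λ ι n), ∃ n' ∈ V,
      Quotient.mk (MulAction.orbitRel Torus3 M) q = sliceMap p Λ ι n' := by
    filter_upwards [h5 h4, (isOpen_extChartAt_source p).mem_nhds hsrc] with q hq hqs
    obtain ⟨⟨t, n'⟩, ⟨hn', hdom⟩, hx⟩ := hq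
    refine ⟨n', hn', Quotient.sound ⟨expT t, ?_⟩⟩
    have h8 := symm_coordAct hdom
    have h9 : coordAct p (expT t) (Λ (ι n')) = extChartAt (𝓡 7) p q := hx
    rw [h9, (extChartAt (𝓡 7) p).left_inv hqs] at h8
    exact h8.symm
  have hop : IsOpenMap (Quotient.mk (MulAction.orbitRel Torus3 M)) :=
    isOpenMap_quotient_mk'_mul
  refine mem_of_superset (hop.image_mem_nhds h7) ?_
  rintro _ ⟨q, ⟨n', hn', hq⟩, rfl⟩
  exact ⟨n', hn', hq.symm⟩

theorem exists_isSliceRadius [FiniteDimensional ℝ N] (h : IsSmoothAction M)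
    (hΛ : IsLinearization p ε Λ) {ι : N →L[ℝ] E7} (hι : IsSlice p ι) :
    ∃ δ, IsSliceRadius p ε Λ ι δ := by
  obtain ⟨𝔪, h𝔪⟩ := Submodule.exists_isCompl (isotropyAlg p)
  have := FiniteDimensional.complete ℝ N
  set y₀ := extChartAt (𝓡 7) p p
  have hker : ∀ b, b ∈ isotropyAlg p ↔ coordField p y₀ b = 0 := infAct_eq_zero_iff h p
  -- Restricting to a complement `𝔪` of the isotropy algebra makes the map from orbit and slice
  -- directions bijective at `n = 0`, and bijectivity persists for small `n`.
  let E : N → (𝔪 × N) →L[ℝ] E7 := fun n =>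
    ((coordField p (Λ (ι n))).comp 𝔪.subtypeL).coprod ((fderiv ℝ Λ (ι n)).comp ι)
  have hE : ∀ n (x : 𝔪 × N), E n x =
      coordField p (Λ (ι n)) (x.1 : Fin 3 → ℝ) + fderiv ℝ Λ (ι n) (ι x.2) := fun n x => rfl
  have hΛ0 : Λ (ι 0) = y₀ := by rw [_root_.map_zero, hΛ.map_zero]
  have hE0 : ∀ x : 𝔪 × N, E 0 x = coordField p y₀ (x.1 : Fin 3 → ℝ) + ι x.2 := fun x => by
    rw [hE, hΛ0, _root_.map_zero, hΛ.fderiv_zero]; rfl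
  have hbij : Function.Bijective (E 0) := by
    constructor
    · refine (injective_iff_map_eq_zero (E 0)).2 fun x hx => ?_
      rw [hE0] at hx
      obtain ⟨h1, h2⟩ := hι.eq_zero _ _ hx
      have h3 : (x.1 : Fin 3 → ℝ) ∈ isotropyAlg p ⊓ 𝔪 := ⟨(hker _).2 h1, x.1.2⟩
      rw [h𝔪.inf_eq_bot, Submodule.mem_bot] at h3
      exact Prod.ext (Subtype.ext h3) h2
    · intro X
      obtain ⟨b, n, rfl⟩ := hι.exists_eq X
      obtain ⟨a, ha, m, hm, rfl⟩ := Submodule.mem_sup.1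
        (h𝔪.sup_eq_top ▸ Submodule.mem_top : b ∈ isotropyAlg p ⊔ 𝔪)
      refine ⟨(⟨m, hm⟩, n), ?_⟩
      rw [hE0, map_add, (hker a).1 ha, zero_add]
  let e : (𝔪 × N) ≃L[ℝ] E7 :=
    (LinearEquiv.ofBijective (E 0 : (𝔪 × N) →ₗ[ℝ] E7) hbij).toContinuousLinearEquiv
  have heE : (e : (𝔪 × N) →L[ℝ] E7) = E 0 := ContinuousLinearMap.ext fun x => rfl
  have hball : ∀ᶠ n in 𝓝 (0 : N), ι n ∈ Metric.ball (0 : E7) ε := by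
    refine ι.continuous.continuousAt.eventually_mem ?_
    rw [_root_.map_zero]
    exact Metric.ball_mem_nhds 0 hΛ.pos
  have hΛc : ContinuousAt Λ (ι 0) := by
    rw [_root_.map_zero]
    exact hΛ.hasFDerivAt_zero.continuousAt
  have hc1 : ContinuousAt (fun n => coordField p (Λ (ι n))) 0 :=
    ContinuousAt.comp (g := coordField p) (f := fun n => Λ (ι n)) (by
      rw [hΛ0]
      exact (continuousOn_coordField h p).continuousAt
        ((isOpen_extChartAt_target p).mem_nhds (mem_extChartAt_target p)))
      (ContinuousAt.comp (f := fun n => ι n) hΛc (by fun_prop))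
  have hc2 : ContinuousAt (fun n => fderiv ℝ Λ (ι n)) 0 :=
    ContinuousAt.comp (f := fun n => ι n) (by
      rw [_root_.map_zero]
      exact hΛ.continuousOn_fderiv.continuousAt (Metric.ball_mem_nhds 0 hΛ.pos)) (by fun_prop)
  have hEc : ContinuousAt E 0 := by
    have h1 : ContinuousAt (fun n => ((coordField p (Λ (ι n))).comp 𝔪.subtypeL).comp
        (ContinuousLinearMap.fst ℝ 𝔪 N) + ((fderiv ℝ Λ (ι n)).comp ι).comp
        (ContinuousLinearMap.snd ℝ 𝔪 N)) 0 :=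
      ((hc1.clm_comp continuousAt_const).clm_comp continuousAt_const).add
        ((hc2.clm_comp continuousAt_const).clm_comp continuousAt_const)
    exact h1.congr (Eventually.of_forall fun n => by ext x <;> simp [E])
  have hEb : ∀ᶠ n in 𝓝 (0 : N), Function.Bijective (E n) := by
    have h1 : range ((↑) : ((𝔪 × N) ≃L[ℝ] E7) → (𝔪 × N) →L[ℝ] E7) ∈ 𝓝 (E 0) :=
      heE ▸ ContinuousLinearEquiv.nhds e
    filter_upwards [hEc h1] with n hn
    obtain ⟨e', he'⟩ := hn
    rw [← he']
    exact e'.bijective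
  obtain ⟨δ, hδ, hall⟩ := Metric.eventually_nhds_iff_ball.1 (hball.and hEb)
  refine ⟨δ, hδ, fun n hn => (hall n hn).1, fun n hn b => ?_, fun V hV hVo => ?_⟩
  · obtain ⟨hnε, hnb⟩ := hall n hn
    have h1 : b ∈ isotropyAlg (slicePoint p Λ ι n) ↔ coordField p (Λ (ι n)) b = 0 :=
      coordField_eq_zero_iff h (hΛ.mem_target _ hnε) b
    rw [h1]
    constructor
    -- Split `b = a + m` along `𝔥 ⊕ 𝔪`. The field of `a` is tangent to the slice, so vanishing of
    -- the total field says that `E n` kills a pair whose first entry is `m`; hence `m = 0`, and `a`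
    -- annihilates the slice vector.
    · intro hb
      obtain ⟨a, ha, m, hm, rfl⟩ := Submodule.mem_sup.1
        (h𝔪.sup_eq_top ▸ Submodule.mem_top : b ∈ isotropyAlg p ⊔ 𝔪)
      obtain ⟨n', hn'⟩ := hι.invariant a ha n
      rw [map_add, hΛ.coordField_eq h ha hnε, hn', add_comm] at hb
      have h2 : ((⟨m, hm⟩, n') : 𝔪 × N) = 0 := hnb.1 (by rw [hE, _root_.map_zero]; exact hb)
      have hm0 : m = 0 := congrArg (fun x : 𝔪 × N => (x.1 : Fin 3 → ℝ)) h2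
      have hn0 : n' = 0 := congrArg Prod.snd h2
      rw [hm0, add_zero, hn', hn0, _root_.map_zero]
      exact ⟨ha, rfl⟩
    · rintro ⟨hb, hb0⟩
      rw [hΛ.coordField_eq h hb hnε, hb0, _root_.map_zero]
  · refine hΛ.isOpen_image_sliceMap h hVo (fun n hn => (hall n (hV hn)).1) fun n hn X => ?_
    obtain ⟨⟨m, n'⟩, rfl⟩ := (hall n (hV hn)).2.2 X
    exact ⟨m, n', rfl⟩

end IsLinearization

end Slices

/-! ### Singular orbits -/

section Singular

variable {M : Type*} [TopologicalSpace M] [ChartedSpace E7 M] [MulAction Torus3 M]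

theorem mem_regularSet_iff {p : M} : p ∈ regularSet M ↔ isotropyAlg p = ⊥ :=
  (LinearMap.ker_eq_bot (f := (infAct p).toLinearMap)).symm

variable [IsManifold (𝓡 7) ∞ M] [ContinuousSMul Torus3 M]

theorem mk_mem_singularImage_iff (h : IsSmoothAction M) {p : M} :
    Quotient.mk (MulAction.orbitRel Torus3 M) p ∈ singularImage M ↔ isotropyAlg p ≠ ⊥ := by
  constructor
  · rintro ⟨q, hq, hqp⟩
    obtain ⟨g, hg⟩ : ∃ g : Torus3, g • p = q := Quotient.exact hqp
    rw [← hg, mem_compl_iff, mem_regularSet_iff, isotropyAlg_smul h] at hq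
    exact hq
  · intro hp
    exact ⟨p, by rwa [mem_compl_iff, mem_regularSet_iff], rfl⟩

theorem mk_mem_vertexSet_iff (h : IsSmoothAction M) {p : M} :
    Quotient.mk (MulAction.orbitRel Torus3 M) p ∈ vertexSet M ↔
      finrank ℝ (isotropyAlg p) = 2 := by
  constructor
  · rintro ⟨q, hq, hqp⟩
    obtain ⟨g, hg⟩ : ∃ g : Torus3, g • p = q := Quotient.exact hqp
    rw [← isotropyAlg_smul h g, hg]
    exact hq
  · intro hp
    exact ⟨p, hp, rfl⟩

theorem vertexSet_subset_singularImage (h : IsSmoothAction M) :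
    vertexSet M ⊆ singularImage M := by
  rintro ⟨p⟩ hp
  refine (mk_mem_singularImage_iff h).2 fun hbot => ?_
  have := (mk_mem_vertexSet_iff h).1 hp
  rw [hbot, finrank_bot] at this
  exact absurd this (by norm_num)

theorem isOpen_regularSet (h : IsSmoothAction M) : IsOpen (regularSet M) := by
  rw [isOpen_iff_mem_nhds]
  intro p hp
  have hker : ∀ y ∈ (extChartAt (𝓡 7) p).target,
      ((extChartAt (𝓡 7) p).symm y ∈ regularSet M ↔ Function.Injective (coordField p y)) := by
    intro y hy
    rw [mem_regularSet_iff, Submodule.eq_bot_iff, injective_iff_map_eq_zero]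
    exact forall_congr' fun a => imp_congr (coordField_eq_zero_iff h hy a) Iff.rfl
  have hy₀ : extChartAt (𝓡 7) p p ∈ (extChartAt (𝓡 7) p).target := mem_extChartAt_target p
  have h0 : Function.Injective (coordField p (extChartAt (𝓡 7) p p)) :=
    (hker _ hy₀).1 (by rwa [extChartAt_to_inv])
  have h1 : ∀ᶠ y in 𝓝 (extChartAt (𝓡 7) p p), Function.Injective (coordField p y) :=
    ((continuousOn_coordField h p).continuousAt
      ((isOpen_extChartAt_target p).mem_nhds hy₀)).eventually_mem
      (ContinuousLinearMap.isOpen_injective.mem_nhds h0)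
  filter_upwards [(continuousAt_extChartAt (I := 𝓡 7) p).eventually h1,
    extChartAt_source_mem_nhds (I := 𝓡 7) p] with q hq hqs
  have := (hker _ ((extChartAt (𝓡 7) p).map_source hqs)).2 hq
  rwa [(extChartAt (𝓡 7) p).left_inv hqs] at this

theorem isClosed_singularImage (h : IsSmoothAction M) : IsClosed (singularImage M) := by
  have hop : IsOpenMap (Quotient.mk (MulAction.orbitRel Torus3 M)) := isOpenMap_quotient_mk'_mul
  have h1 : singularImage M = (Quotient.mk (MulAction.orbitRel Torus3 M) '' regularSet M)ᶜ := by
    ext ⟨p⟩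
    change Quotient.mk (MulAction.orbitRel Torus3 M) p ∈ singularImage M ↔
      Quotient.mk (MulAction.orbitRel Torus3 M) p ∈ _
    rw [mk_mem_singularImage_iff h, mem_compl_iff, not_iff_not]
    constructor
    · intro hp
      exact ⟨p, mem_regularSet_iff.2 hp, rfl⟩
    · rintro ⟨q, hq, hqp⟩
      obtain ⟨g, hg⟩ : ∃ g : Torus3, g • p = q := Quotient.exact hqp
      rw [← isotropyAlg_smul h g, hg]
      exact mem_regularSet_iff.1 hq
  rw [h1]
  exact (hop _ (isOpen_regularSet h)).isClosed_compl

variable [T2Space M] [ConnectedSpace M] {φ : Form 3 M}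

/-- The stabilisers are at most two-dimensional. -/
theorem finrank_isotropyAlg_le_two (hφ : IsG2WithTorusSymmetry φ) (p : M) :
    finrank ℝ (isotropyAlg p) ≤ 2 := by
  obtain ⟨f, hf⟩ := exists_coframe_inner_cross hφ.isG2 (mem_extChartAt_target (I := 𝓡 7) p)
  obtain ⟨𝔪, h𝔪⟩ := Submodule.exists_isCompl (isotropyAlg p)
  -- Projecting the standard basis gives three generators of the isotropy algebra whatever its
  -- dimension. A common null vector therefore exists even if `p` were a fixed point, and the weight
  -- argument then excludes that case.
  let P : (Fin 3 → ℝ) →ₗ[ℝ] isotropyAlg p := (isotropyAlg p).projectionOnto 𝔪 h𝔪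
  obtain ⟨u, hu, hu0⟩ := exists_common_null_vector
    (fun i => isotropyFamily f p (P (Pi.single i 1)))
    (fun i => skew_of_phi0 (isotropyFamily_phi0 hφ hf _))
    (fun i j => isotropyFamily_comm hφ f _ _)
    (by rw [finrank_euclideanSpace]; exact ⟨3, rfl⟩)
  have hAu : ∀ a, isotropyFamily f p a u = 0 := by
    intro a
    have h1 : ∀ b : Fin 3 → ℝ, isotropyFamily f p (P b) u = 0 := by
      intro b
      have h2 : b = b 0 • Pi.single 0 1 + b 1 • Pi.single 1 1 + b 2 • Pi.single 2 1 := by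
        funext i; fin_cases i <;> simp
      rw [h2]
      simp only [map_add, map_smul, LinearMap.add_apply, LinearMap.smul_apply, hu0, smul_zero,
        add_zero]
    have h3 := h1 a
    have h4 : P a = a := Submodule.projectionOnto_apply_left h𝔪 a
    rwa [h4] at h3
  have htor := isToralFamily_isotropyFamily hφ hf hu hAu
  obtain ⟨w, α₀, hw⟩ := htor.exists_isWeightVector_of_unit
  obtain ⟨G, α, hG, -⟩ := exists_isIsotropyFrame_of_isWeightVector hf htor hw
  exact hG.finrank_le_two hφ

end Singular

/-! ### The multi-moment maps along a slice -/

section SliceMoment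

variable {M : Type*} [TopologicalSpace M] [ChartedSpace E7 M]
variable {N : Type*} [NormedAddCommGroup N] [NormedSpace ℝ N]
variable {φ : Form 3 M} {ν : M → Fin 3 → ℝ} {μ : M → ℝ} {p : M} {ε : ℝ} {Λ : E7 → E7}

theorem exists_smul_eq_of_cross {a w : Fin 3 → ℝ} (ha : a ≠ 0)
    (h : ∀ b, crossProduct a b ⬝ᵥ w = 0) : ∃ r : ℝ, w = r • a := by
  have h0 := h (Pi.single 0 1)
  have h1 := h (Pi.single 1 1)
  have h2 := h (Pi.single 2 1)
  simp [cross_apply, dotProduct, Fin.sum_univ_three] at h0 h1 h2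
  obtain ⟨i, hi⟩ := Function.ne_iff.1 ha
  refine ⟨w i / a i, ?_⟩
  have key : ∀ j, w j * a i = w i * a j := by
    intro j
    fin_cases i <;> fin_cases j <;> simp <;> linarith
  funext j
  have := key j
  simp only [Pi.smul_apply, smul_eq_mul]
  field_simp [show a i ≠ 0 from hi]
  linarith

theorem continuousAt_inChart_apply {X : Type*} [TopologicalSpace X] (hφ : Form.IsSmooth φ)
    {y V₁ V₂ V₃ : X → E7} {x : X} (hx : y x ∈ (extChartAt (𝓡 7) p).target)
    (hy : ContinuousAt y x) (h₁ : ContinuousAt V₁ x) (h₂ : ContinuousAt V₂ x)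
    (h₃ : ContinuousAt V₃ x) :
    ContinuousAt (fun x => Form.inChart φ p (y x) ![V₁ x, V₂ x, V₃ x]) x := by
  have h1 : ContinuousAt (fun x => Form.inChart φ p (y x)) x :=
    ((continuousOn_inChart hφ p).continuousAt
      ((isOpen_extChartAt_target p).mem_nhds hx)).comp hy
  have h2 : ContinuousAt (fun x => (![V₁ x, V₂ x, V₃ x] : Fin 3 → E7)) x := by
    refine continuousAt_pi.2 fun i => ?_
    fin_cases i
    · exact h₁
    · exact h₂
    · exact h₃
  have h3 : ContinuousAt (fun x => (Form.inChart φ p (y x)).toContinuousMultilinearMap) x :=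
    ContinuousAlternatingMap.continuous_toContinuousMultilinearMap.continuousAt.comp h1
  exact h3.eval h2

variable [MulAction Torus3 M]

theorem continuousAt_slice_lambda (hΛ : IsLinearization p ε Λ) (ι : N →L[ℝ] E7) (n : N) :
    ContinuousAt (fun r : ℝ => Λ (ι (r • n))) 0 := by
  have h1 : ContinuousAt Λ (ι ((0 : ℝ) • n)) := by
    rw [zero_smul, map_zero]
    exact hΛ.hasFDerivAt_zero.continuousAt
  exact h1.comp (f := fun r : ℝ => ι (r • n)) (by fun_prop)

theorem continuousAt_slice_fderiv (hΛ : IsLinearization p ε Λ) (ι : N →L[ℝ] E7) (n : N) (X : E7) :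
    ContinuousAt (fun r : ℝ => fderiv ℝ Λ (ι (r • n)) X) 0 := by
  have h1 : ContinuousAt (fderiv ℝ Λ) (ι ((0 : ℝ) • n)) := by
    rw [zero_smul, map_zero]
    exact hΛ.continuousOn_fderiv.continuousAt (Metric.ball_mem_nhds 0 hΛ.pos)
  exact (h1.comp (f := fun r : ℝ => ι (r • n)) (by fun_prop)).clm_apply continuousAt_const

variable [IsManifold (𝓡 7) ∞ M]

theorem hasDerivAt_slice (hΛ : IsLinearization p ε Λ) {F : Type*} [NormedAddCommGroup F]
    [NormedSpace ℝ F] {f : M → F} (hf : ContMDiff (𝓡 7) 𝓘(ℝ, F) ∞ f) (ι : N →L[ℝ] E7) (n : N)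
    {r : ℝ} (hr : ι (r • n) ∈ Metric.ball (0 : E7) ε) :
    HasDerivAt (fun r : ℝ => f (slicePoint p Λ ι (r • n)))
      (fderiv ℝ (fun y => f ((extChartAt (𝓡 7) p).symm y)) (Λ (ι (r • n)))
        (fderiv ℝ Λ (ι (r • n)) (ι n))) r := by
  have h1 : HasDerivAt (fun r : ℝ => ι (r • n)) (ι n) r := by
    have h2 : HasDerivAt (fun r : ℝ => r • n) n r := by
      simpa using (hasDerivAt_id r).smul_const n
    exact ι.hasFDerivAt.comp_hasDerivAt r h2
  have h2 : HasDerivAt (fun r : ℝ => Λ (ι (r • n))) (fderiv ℝ Λ (ι (r • n)) (ι n)) r :=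
    (hΛ.hasStrictFDerivAt_of_mem hr).hasFDerivAt.comp_hasDerivAt r h1
  have h3 : HasFDerivAt (fun y => f ((extChartAt (𝓡 7) p).symm y)) _ (Λ (ι (r • n))) :=
    (((contDiffOn_comp_symm hf p).contDiffAt
      ((isOpen_extChartAt_target p).mem_nhds (hΛ.mem_target _ hr))).differentiableAt
        (by simp)).hasFDerivAt
  exact h3.comp_hasDerivAt r h2

variable [ContinuousSMul Torus3 M]

theorem hasDerivAt_nu_slice (h : IsSmoothAction M) (hν : IsMultiMomentPhi φ ν)
    (hΛ : IsLinearization p ε Λ) (ι : N →L[ℝ] E7) (n : N) (a b : Fin 3 → ℝ)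
    {r : ℝ} (hr : ι (r • n) ∈ Metric.ball (0 : E7) ε) :
    HasDerivAt (fun r : ℝ => crossProduct a b ⬝ᵥ ν (slicePoint p Λ ι (r • n)))
      (Form.inChart φ p (Λ (ι (r • n))) ![coordField p (Λ (ι (r • n))) a,
        coordField p (Λ (ι (r • n))) b, fderiv ℝ Λ (ι (r • n)) (ι n)]) r := by
  rw [← cross_dotProduct_fderiv_nu h hν (hΛ.mem_target _ hr)]
  have h1 := hasDerivAt_pi.1 (hasDerivAt_slice hΛ hν.smooth ι n hr)
  exact HasDerivAt.fun_sum fun i _ => (h1 i).const_mul _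

/-- The field of `a` vanishes along the whole segment from `0` to `n`. There `μ` has zero
derivative, and so has `(a × b) · ν` for each `b`; the increment of `ν` is orthogonal to all `a ×
b`, hence a multiple of `a`. -/
theorem moment_eq_on_slice (h : IsSmoothAction M) (hν : IsMultiMomentPhi φ ν)
    (hμ : IsMultiMomentStar φ μ) (hΛ : IsLinearization p ε Λ) {ι : N →L[ℝ] E7} {δ : ℝ}
    (hδ : IsSliceRadius p ε Λ ι δ) {n : N} (hn : n ∈ Metric.ball (0 : N) δ) {a : Fin 3 → ℝ}
    (ha : a ∈ isotropyAlg p) (ha0 : a ≠ 0) (han : isotropyGen p a (ι n) = 0) :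
    μ (slicePoint p Λ ι n) = μ p ∧ ∃ r : ℝ, ν (slicePoint p Λ ι n) = ν p + r • a := by
  have hball : ∀ r ∈ Icc (0 : ℝ) 1, r • n ∈ Metric.ball (0 : N) δ := by
    intro r hr
    rw [mem_ball_zero_iff] at hn ⊢
    rw [norm_smul, Real.norm_eq_abs, abs_of_nonneg hr.1]
    exact (mul_le_of_le_one_left (norm_nonneg n) hr.2).trans_lt hn
  have hfield : ∀ r ∈ Icc (0 : ℝ) 1, coordField p (Λ (ι (r • n))) a = 0 := by
    intro r hr
    rw [hΛ.coordField_eq h ha (hδ.mem_ball _ (hball r hr)), map_smul, map_smul, han, smul_zero,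
      map_zero]
  have hconst : ∀ f : ℝ → ℝ, (∀ r ∈ Icc (0 : ℝ) 1, HasDerivAt f 0 r) → f 1 = f 0 := by
    intro f hf
    refine (convex_Icc (0 : ℝ) 1).is_const_of_fderivWithin_eq_zero (𝕜 := ℝ)
      (fun r hr => (hf r hr).differentiableAt.differentiableWithinAt) (fun r hr => ?_)
      (right_mem_Icc.2 zero_le_one) (left_mem_Icc.2 zero_le_one)
    have := (hf r hr).hasFDerivAt.hasFDerivWithinAt (s := Icc 0 1)
    rw [this.fderivWithin (uniqueDiffOn_Icc zero_lt_one r hr)]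
    ext; simp
  constructor
  · have h1 := hconst (fun r : ℝ => μ (slicePoint p Λ ι (r • n))) fun r hr => by
      have h2 := hasDerivAt_slice hΛ hμ.smooth ι n (hδ.mem_ball _ (hball r hr))
      rwa [fderiv_mu_eq_zero h hμ (hΛ.mem_target _ (hδ.mem_ball _ (hball r hr))) ha0
        (hfield r hr)] at h2
    simpa only [one_smul, zero_smul, hΛ.slicePoint_zero] using h1
  · obtain ⟨r, hr⟩ := exists_smul_eq_of_cross (w := ν (slicePoint p Λ ι n) - ν p) ha0 fun b => by
      have h1 := hconst (fun r : ℝ => crossProduct a b ⬝ᵥ ν (slicePoint p Λ ι (r • n)))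
        fun r hr => by
          have h2 := hasDerivAt_nu_slice h hν hΛ ι n a b (hδ.mem_ball _ (hball r hr))
          rw [hfield r hr, ← zero_smul ℝ (0 : E7), alternating_vec_smul, zero_mul] at h2
          exact h2
      simp only [one_smul, zero_smul, hΛ.slicePoint_zero] at h1
      rw [dotProduct_sub, h1, sub_self]
    exact ⟨r, by rw [← hr, add_sub_cancel]⟩

theorem continuousAt_slice_coordField (h : IsSmoothAction M) (hΛ : IsLinearization p ε Λ)
    (ι : N →L[ℝ] E7) (n : N) (b : Fin 3 → ℝ) :
    ContinuousAt (fun r : ℝ => coordField p (Λ (ι (r • n))) b) 0 := by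
  have h1 : ContinuousAt (coordField p) (Λ (ι ((0 : ℝ) • n))) := by
    rw [zero_smul, map_zero, hΛ.map_zero]
    exact (continuousOn_coordField h p).continuousAt
        ((isOpen_extChartAt_target p).mem_nhds (mem_extChartAt_target p))
  exact (ContinuousAt.comp (f := fun r : ℝ => Λ (ι (r • n))) h1
    (continuousAt_slice_lambda hΛ ι n)).clm_apply continuousAt_const

end SliceMoment

/-! ### Frames adapted to the orbits -/

section AdaptedFrames

variable {M : Type*} [TopologicalSpace M] [ChartedSpace E7 M] [MulAction Torus3 M]
  {φ : Form 3 M}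

/-- The normal space of an orbit of dimension two. -/
noncomputable def edgeIncl : (ℝ × ℂ × ℂ) →L[ℝ] ℝ × (Fin 3 → ℂ) :=
  LinearMap.toContinuousLinearMap
    { toFun := fun n => (0, ![Complex.I * n.1, n.2.1, n.2.2])
      map_add' := fun m n => by
        refine Prod.ext (by simp) (funext fun j => ?_)
        fin_cases j <;> simp [mul_add]
      map_smul' := fun c n => by
        refine Prod.ext (by simp) (funext fun j => ?_)
        fin_cases j <;> simp [mul_left_comm] }

variable {p : M} {G : (ℝ × (Fin 3 → ℂ)) ≃L[ℝ] E7} {α : Fin 3 → isotropyAlg p →ₗ[ℝ] ℝ}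

/-- The orbit occupies the real factor and the real part of the zero-weight coordinate; the
imaginary part of that coordinate and the two other complex coordinates form an invariant
complement. -/
theorem isSlice_edge (hG : IsIsotropyFrame φ p G α) (hα : α 0 = 0) {b₁ b₂ : Fin 3 → ℝ}
    (h₁ : coordField p (extChartAt (𝓡 7) p p) b₁ = G (1, 0))
    (h₂ : coordField p (extChartAt (𝓡 7) p p) b₂ = G (0, Pi.single 0 1))
    (hb : ∀ b, ∃ s t : ℝ, coordField p (extChartAt (𝓡 7) p p) b = G (s, Pi.single 0 (t : ℂ))) :
    IsSlice p ((G : (ℝ × (Fin 3 → ℂ)) →L[ℝ] E7).comp edgeIncl) := by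
  have hι : ∀ s z w, (G : (ℝ × (Fin 3 → ℂ)) →L[ℝ] E7).comp edgeIncl (s, z, w) =
      G (0, ![Complex.I * s, z, w]) := fun s z w => rfl
  refine ⟨fun X => ?_, ?_, ?_⟩
  · obtain ⟨⟨s, z⟩, rfl⟩ := G.surjective X
    refine ⟨s • b₁ + (z 0).re • b₂, ((z 0).im, z 1, z 2), ?_⟩
    rw [map_add, map_smul, map_smul, h₁, h₂, hι, ← map_smul, ← map_smul, ← map_add, ← map_add]
    congr 1
    refine Prod.ext (by simp) (funext fun j => ?_)
    fin_cases j
    · simp only [Fin.zero_eta, Prod.snd_add, Prod.smul_snd, Pi.add_apply, Pi.smul_apply,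
        Pi.single_eq_same, smul_zero, zero_add, Matrix.cons_val_zero,
        Complex.real_smul, mul_one]
      rw [mul_comm, Complex.re_add_im]
    · simp [Matrix.vecHead, Matrix.vecTail]
    · simp [Matrix.vecHead, Matrix.vecTail]
  · rintro b ⟨s, z, w⟩ h0
    obtain ⟨s', t, hb'⟩ := hb b
    rw [hι, hb', ← map_add, map_eq_zero_iff G G.injective] at h0
    have e0 : s' = 0 := by simpa using congrArg Prod.fst h0
    have e1 : (t : ℂ) + Complex.I * s = 0 := by
      simpa [Matrix.vecHead, Matrix.vecTail] using congrFun (congrArg Prod.snd h0) 0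
    have e2 : z = 0 := by
      simpa [Matrix.vecHead, Matrix.vecTail] using congrFun (congrArg Prod.snd h0) 1
    have e3 : w = 0 := by
      simpa [Matrix.vecHead, Matrix.vecTail] using congrFun (congrArg Prod.snd h0) 2
    have e4 : t = 0 := by simpa using congrArg Complex.re e1
    have e5 : s = 0 := by simpa using congrArg Complex.im e1
    refine ⟨?_, by rw [e2, e3, e5]; rfl⟩
    rw [hb', e0, e4, Complex.ofReal_zero, Pi.single_zero]
    exact map_zero G
  · rintro a ha ⟨s, z, w⟩
    refine ⟨(0, Complex.I * α 1 ⟨a, ha⟩ * z, Complex.I * α 2 ⟨a, ha⟩ * w), ?_⟩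
    rw [hι, hι, hG.gen_eq ⟨a, ha⟩]
    congr 2
    funext j
    fin_cases j <;> simp [hα]

theorem isSlice_vertex (hG : IsIsotropyFrame φ p G α) {b₁ : Fin 3 → ℝ}
    (h₁ : coordField p (extChartAt (𝓡 7) p p) b₁ = G (1, 0))
    (hb : ∀ b, ∃ s : ℝ, coordField p (extChartAt (𝓡 7) p p) b = G (s, 0)) :
    IsSlice p ((G : (ℝ × (Fin 3 → ℂ)) →L[ℝ] E7).comp (ContinuousLinearMap.inr ℝ ℝ (Fin 3 → ℂ))) := by
  have hι : ∀ z, (G : (ℝ × (Fin 3 → ℂ)) →L[ℝ] E7).comp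
      (ContinuousLinearMap.inr ℝ ℝ (Fin 3 → ℂ)) z = G (0, z) := fun z => rfl
  refine ⟨fun X => ?_, ?_, ?_⟩
  · obtain ⟨⟨s, z⟩, rfl⟩ := G.surjective X
    refine ⟨s • b₁, z, ?_⟩
    rw [map_smul, h₁, hι, ← map_smul, ← map_add]
    congr 1
    simp
  · intro b z h0
    obtain ⟨s, hb'⟩ := hb b
    rw [hι, hb', ← map_add, map_eq_zero_iff G G.injective] at h0
    have e0 : s = 0 := by simpa using congrArg Prod.fst h0
    have e1 : z = 0 := by simpa using congrArg Prod.snd h0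
    refine ⟨?_, e1⟩
    rw [hb', e0]
    exact map_zero G
  · intro a ha z
    refine ⟨fun j => Complex.I * α j ⟨a, ha⟩ * z j, ?_⟩
    rw [hι, hι, hG.gen_eq ⟨a, ha⟩]

variable [IsManifold (𝓡 7) ∞ M] [ContinuousSMul Torus3 M]

theorem exists_orthonormalBasis_orbit (h : IsSmoothAction M) (f : E7 ≃L[ℝ] E7) (p : M) {d : ℕ}
    (hd : finrank ℝ (isotropyAlg p) + d = 3) : ∃ (e : Fin d → E7) (b : Fin d → Fin 3 → ℝ),
      Orthonormal ℝ e ∧ (∀ i, f (coordField p (extChartAt (𝓡 7) p p) (b i)) = e i) ∧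
      ∀ b, ∃ c : Fin d → ℝ, f (coordField p (extChartAt (𝓡 7) p p) b) = ∑ i, c i • e i := by
  let T : (Fin 3 → ℝ) →ₗ[ℝ] E7 :=
    (f : E7 →ₗ[ℝ] E7) ∘ₗ (coordField p (extChartAt (𝓡 7) p p) : (Fin 3 → ℝ) →ₗ[ℝ] E7)
  have hker : LinearMap.ker T = isotropyAlg p := by
    ext b
    rw [LinearMap.mem_ker, mem_isotropyAlg, infAct_eq_zero_iff h]
    exact map_eq_zero_iff f f.injective
  have hrn := LinearMap.finrank_range_add_finrank_ker T
  rw [hker, finrank_fin_fun] at hrn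
  have hR : finrank ℝ (LinearMap.range T) = d := by omega
  let B := (stdOrthonormalBasis ℝ (LinearMap.range T)).reindex (finCongr hR)
  have hB : ∀ i, ∃ b, T b = B i := fun i => (B i).2
  choose b hb using hB
  refine ⟨fun i => B i, b, ?_, hb, fun b => ⟨fun i => B.repr ⟨T b, b, rfl⟩ i, ?_⟩⟩
  · exact B.orthonormal.comp_linearIsometry (LinearMap.range T).subtypeₗᵢ
  · have h1 := congrArg (Subtype.val) (B.sum_repr ⟨T b, b, rfl⟩)
    rw [Submodule.coe_sum] at h1
    exact h1.symm

/-- Both directions of a two-dimensional orbit are annihilated by the isotropy algebra: one serves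
as `u`, the other as a weight vector of weight zero. -/
theorem exists_edge_frame (hφ : IsG2WithTorusSymmetry φ) {p : M}
    (hp : finrank ℝ (isotropyAlg p) = 1) : ∃ G α b₁ b₂, IsIsotropyFrame φ p G α ∧ α 0 = 0 ∧
      coordField p (extChartAt (𝓡 7) p p) b₁ = G (1, 0) ∧
      coordField p (extChartAt (𝓡 7) p p) b₂ = G (0, Pi.single 0 1) ∧
      ∀ b, ∃ s t : ℝ, coordField p (extChartAt (𝓡 7) p p) b = G (s, Pi.single 0 (t : ℂ)) := by
  obtain ⟨f, hf⟩ := exists_coframe_inner_cross hφ.isG2 (mem_extChartAt_target (I := 𝓡 7) p)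
  obtain ⟨e, b, he, hb, hspan⟩ := exists_orthonormalBasis_orbit hφ.smooth_action f p (d := 2)
    (by omega)
  have hA : ∀ i a, isotropyFamily f p a (e i) = 0 := fun i a => by
    rw [← hb, isotropyFamily_coordField hφ]
  have hu := isToralFamily_isotropyFamily hφ hf (he.1 0) (hA 0)
  have hw : IsWeightVector (isotropyFamily f p) (e 0) (e 1) 0 :=
    ⟨he.1 1, he.2 (by decide), fun a => by rw [hA, LinearMap.zero_apply, zero_smul]⟩
  obtain ⟨G, α, hG, hα, hG1, hG2⟩ := exists_isIsotropyFrame_of_isWeightVector hf hu hw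
  refine ⟨G, α, b 0, b 1, hG, hα, f.injective ((hb 0).trans hG1.symm),
    f.injective ((hb 1).trans hG2.symm), fun b' => ?_⟩
  obtain ⟨c, hc⟩ := hspan b'
  refine ⟨c 0, c 1, f.injective ?_⟩
  have h1 : ((c 0, Pi.single 0 (c 1 : ℂ)) : ℝ × (Fin 3 → ℂ)) =
      c 0 • (1, 0) + c 1 • (0, Pi.single 0 1) := by
    refine Prod.ext (by simp) (funext fun j => ?_)
    fin_cases j <;> simp
  rw [hc, h1, map_add, map_smul, map_smul, map_add, map_smul, map_smul, hG1, hG2,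
    Fin.sum_univ_two]

/-- The single orbit direction is annihilated by the isotropy algebra and serves as `u`, so the
normal space is all of `ℂ³`. -/
theorem exists_vertex_frame (hφ : IsG2WithTorusSymmetry φ) {p : M}
    (hp : finrank ℝ (isotropyAlg p) = 2) : ∃ G α b₁, IsIsotropyFrame φ p G α ∧
      coordField p (extChartAt (𝓡 7) p p) b₁ = G (1, 0) ∧
      ∀ b, ∃ s : ℝ, coordField p (extChartAt (𝓡 7) p p) b = G (s, 0) := by
  obtain ⟨f, hf⟩ := exists_coframe_inner_cross hφ.isG2 (mem_extChartAt_target (I := 𝓡 7) p)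
  obtain ⟨e, b, he, hb, hspan⟩ := exists_orthonormalBasis_orbit hφ.smooth_action f p (d := 1)
    (by omega)
  have hA : ∀ i a, isotropyFamily f p a (e i) = 0 := fun i a => by
    rw [← hb, isotropyFamily_coordField hφ]
  have hu := isToralFamily_isotropyFamily hφ hf (he.1 0) (hA 0)
  obtain ⟨w, α₀, hw⟩ := hu.exists_isWeightVector_of_unit
  obtain ⟨G, α, hG, -, hG1, -⟩ := exists_isIsotropyFrame_of_isWeightVector hf hu hw
  refine ⟨G, α, b 0, hG, f.injective ((hb 0).trans hG1.symm), fun b' => ?_⟩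
  obtain ⟨c, hc⟩ := hspan b'
  refine ⟨c 0, f.injective ?_⟩
  have h1 : ((c 0, 0) : ℝ × (Fin 3 → ℂ)) = c 0 • (1, 0) := by simp
  rw [hc, h1, map_smul, map_smul, hG1, Fin.sum_univ_one]

end AdaptedFrames

/-! ### Edges -/

section Edges

variable {M : Type*} [TopologicalSpace M] [ChartedSpace E7 M] [MulAction Torus3 M]
  [IsManifold (𝓡 7) ∞ M] [ContinuousSMul Torus3 M] [T2Space M] [ConnectedSpace M] {φ : Form 3 M}
  {ν : M → Fin 3 → ℝ} {μ : M → ℝ} {p : M} {G : (ℝ × (Fin 3 → ℂ)) ≃L[ℝ] E7}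
  {α : Fin 3 → isotropyAlg p →ₗ[ℝ] ℝ}

/-- With one weight zero the others are opposite and nonzero, so the element with weights `0, 1, -1`
is integral and primitive. -/
theorem exists_primitive_edge_generator (hφ : IsG2WithTorusSymmetry φ)
    (hG : IsIsotropyFrame φ p G α) (hα : α 0 = 0) (hp : finrank ℝ (isotropyAlg p) = 1) :
    ∃ v, IsPrimitive v ∧ isotropyAlg p = Submodule.span ℝ {realVec v} := by
  have hsum := hG.sum_apply
  simp only [hα, LinearMap.zero_apply, zero_add] at hsum
  have hinj : ∀ a, α 1 a = 0 → a = 0 := fun a ha => hG.eq_zero hφ fun j => by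
    have := hsum a
    fin_cases j
    · simp [hα]
    · exact ha
    · change α 2 a = 0; linarith
  have : Nontrivial (isotropyAlg p) := Module.nontrivial_of_finrank_pos (R := ℝ) (by omega)
  obtain ⟨a, ha⟩ := exists_ne (0 : isotropyAlg p)
  have hα1 : α 1 a ≠ 0 := fun h0 => ha (hinj a h0)
  have h1 : α 1 ((α 1 a)⁻¹ • a) = 1 := by simp [hα1]
  obtain ⟨v, hv, hav⟩ := hG.exists_isPrimitive hφ (a := (α 1 a)⁻¹ • a) (fun j => by
    fin_cases j
    · exact ⟨0, by simp [hα]⟩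
    · exact ⟨1, by simpa using h1⟩
    · exact ⟨-1, by have := hsum ((α 1 a)⁻¹ • a); push_cast; change α 2 _ = -1; linarith⟩) h1
  refine ⟨v, hv, le_antisymm (fun x hx => ?_) ?_⟩
  · obtain ⟨c, hc⟩ := (finrank_eq_one_iff_of_nonzero' ((α 1 a)⁻¹ • a)
      (fun h0 => by rw [h0, map_zero] at h1; exact zero_ne_one h1)).1 hp ⟨x, hx⟩
    refine Submodule.mem_span_singleton.2 ⟨c, ?_⟩
    rw [← hav]
    exact congrArg Subtype.val hc
  · rw [Submodule.span_singleton_le_iff_mem, ← hav]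
    exact Subtype.property _

theorem eventually_deriv_pos_strictMonoOn {f f' : ℝ → ℝ} {ρ : ℝ} (hρ : 0 < ρ)
    (hf : ∀ r ∈ Ioo (-ρ) ρ, HasDerivAt f (f' r) r) (hc : ContinuousAt f' 0) (h0 : 0 < f' 0) :
    ∃ ρ' ∈ Ioc 0 ρ, StrictMonoOn f (Ioo (-ρ') ρ') := by
  obtain ⟨η, hη, hball⟩ := Metric.eventually_nhds_iff_ball.1 (hc.eventually (lt_mem_nhds h0))
  have hsub1 : Ioo (-(min η ρ)) (min η ρ) ⊆ Ioo (-ρ) ρ :=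
    Ioo_subset_Ioo (neg_le_neg (min_le_right _ _)) (min_le_right _ _)
  refine ⟨min η ρ, ⟨lt_min hη hρ, min_le_right _ _⟩,
    strictMonoOn_of_deriv_pos (convex_Ioo _ _)
      (fun r hr => (hf r (hsub1 hr)).continuousAt.continuousWithinAt) fun r hr => ?_⟩
  rw [interior_Ioo] at hr
  rw [(hf r (hsub1 hr)).deriv]
  refine hball r ?_
  rw [Real.ball_eq_Ioo, zero_sub, zero_add]
  exact Ioo_subset_Ioo (neg_le_neg (min_le_left _ _)) (min_le_left _ _) hr

/-- Slice vectors with nontrivial isotropy are those with vanishing `ℂ²`-part, which leaves the line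
`i ℝ` in the zero-weight coordinate. Along it `(b₁ × b₂) · ν` has derivative `φ(u, e, u × e) = 1` at
`p`, where `e` is the other unit orbit direction. -/
theorem exists_isEdgeArc (hφ : IsG2WithTorusSymmetry φ) (hν : IsMultiMomentPhi φ ν)
    (hμ : IsMultiMomentStar φ μ) (hp : finrank ℝ (isotropyAlg p) = 1) :
    (∃ v, IsPrimitive v ∧ isotropyAlg p = Submodule.span ℝ {realVec v}) ∧
    ∃ τ, IsEdgeArc (singularImage M) (vertexSet M) (orbitLift ν hν.invariant)
      (orbitLift isotropyAlg (isotropyAlg_smul hφ.smooth_action)) (orbitLift μ hμ.invariant)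
      (Quotient.mk (MulAction.orbitRel Torus3 M) p) τ := by
  have h := hφ.smooth_action
  obtain ⟨G, α, b₁, b₂, hG, hα, h₁, h₂, hb⟩ := exists_edge_frame hφ hp
  refine ⟨exists_primitive_edge_generator hφ hG hα hp, ?_⟩
  obtain ⟨ε, Λ, hΛ⟩ := exists_isLinearization h p
  have hsl := isSlice_edge hG hα h₁ h₂ hb
  set ι := (G : (ℝ × (Fin 3 → ℂ)) →L[ℝ] E7).comp edgeIncl with hιdef
  have hι : ∀ s z w, ι (s, z, w) = G (0, ![Complex.I * s, z, w]) := fun s z w => rfl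
  obtain ⟨δ, hδ⟩ := hΛ.exists_isSliceRadius h hsl
  have hsum := hG.sum_apply
  simp only [hα, LinearMap.zero_apply, zero_add] at hsum
  have : Nontrivial (isotropyAlg p) := Module.nontrivial_of_finrank_pos (R := ℝ) (by omega)
  obtain ⟨⟨a, ha⟩, ha0⟩ := exists_ne (0 : isotropyAlg p)
  have ha0' : a ≠ 0 := fun h0 => ha0 (Subtype.ext h0)
  have hα0 : ∀ a, α 0 a = 0 := fun a => by rw [hα]; rfl
  have hα1 : ∀ a : isotropyAlg p, a ≠ 0 → α 1 a ≠ 0 := fun a ha0 h0 =>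
    ha0 (hG.eq_zero hφ fun j => by
      have := hsum a
      fin_cases j
      · exact hα0 a
      · exact h0
      · change α 2 a = 0; linarith)
  have hgen : ∀ (a : isotropyAlg p) s, isotropyGen p (a : Fin 3 → ℝ) (ι (s, 0, 0)) = 0 :=
    fun a s => by
      rw [hι, hG.gen_eq_zero_iff]
      intro j
      fin_cases j
      · exact Or.inl (hα0 a)
      · exact Or.inr rfl
      · exact Or.inr rfl
  have hgen' : ∀ (a : isotropyAlg p) s z w, a ≠ 0 →
      isotropyGen p (a : Fin 3 → ℝ) (ι (s, z, w)) = 0 → z = 0 ∧ w = 0 := by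
    intro a s z w ha0 h0
    rw [hι, hG.gen_eq_zero_iff] at h0
    refine ⟨(h0 1).resolve_left (hα1 a ha0), (h0 2).resolve_left fun h2 => hα1 a ha0 ?_⟩
    have := hsum a
    linarith
  have hball : ∀ {ρ : ℝ} {s : ℝ}, s ∈ Ioo (-ρ) ρ → ((s, 0, 0) : ℝ × ℂ × ℂ) ∈ Metric.ball 0 ρ := by
    intro ρ s hs
    rw [mem_ball_zero_iff, Prod.norm_def, Prod.norm_def, norm_zero, max_self, Real.norm_eq_abs,
      max_eq_left (abs_nonneg s), abs_lt]
    exact hs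
  have hsmul : ∀ s : ℝ, s • ((1, 0, 0) : ℝ × ℂ × ℂ) = (s, 0, 0) := fun s => by simp
  -- the moment map is strictly monotone along the arc
  obtain ⟨ρ, hρ, hmono⟩ := eventually_deriv_pos_strictMonoOn hδ.pos
    (fun r hr => hasDerivAt_nu_slice h hν hΛ ι (1, 0, 0) b₁ b₂
      (hδ.mem_ball _ (by rw [hsmul]; exact hball hr)))
    (continuousAt_inChart_apply hφ.smooth (by
        rw [zero_smul, map_zero, hΛ.map_zero]; exact mem_extChartAt_target p)
      (continuousAt_slice_lambda hΛ ι _) (continuousAt_slice_coordField h hΛ ι _ _)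
      (continuousAt_slice_coordField h hΛ ι _ _) (continuousAt_slice_fderiv hΛ ι _ _)) (by
    rw [zero_smul, map_zero, hΛ.map_zero, hΛ.fderiv_zero, h₁, h₂, ContinuousLinearMap.id_apply, hι]
    have h3 : (![Complex.I * ((1 : ℝ) : ℂ), 0, 0] : Fin 3 → ℂ) = Pi.single 0 Complex.I := by
      funext j; fin_cases j <;> simp
    rw [h3, hG.form_eq]
    exact zero_lt_one)
  simp only [hsmul] at hmono
  have hρδ : Metric.ball (0 : ℝ × ℂ × ℂ) ρ ⊆ Metric.ball 0 δ := Metric.ball_subset_ball hρ.2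
  have hscale : ∀ s ∈ Ioo (-1 : ℝ) 1, ρ * s ∈ Ioo (-ρ) ρ := fun s hs =>
    ⟨by nlinarith [hs.1, hρ.1], by nlinarith [hs.2, hρ.1]⟩
  have hmem : ∀ s ∈ Ioo (-1 : ℝ) 1, ((ρ * s, 0, 0) : ℝ × ℂ × ℂ) ∈ Metric.ball 0 δ :=
    fun s hs => hρδ (hball (hscale s hs))
  have hzero : sliceMap p Λ ι 0 = Quotient.mk (MulAction.orbitRel Torus3 M) p := by
    rw [sliceMap, hΛ.slicePoint_zero]
  have hzero' : (((ρ * 0 : ℝ), 0, 0) : ℝ × ℂ × ℂ) = 0 := by rw [mul_zero]; rfl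
  have hmom := fun s hs => moment_eq_on_slice h hν hμ hΛ hδ (hmem s hs) ha ha0' (hgen ⟨a, ha⟩ _)
  refine ⟨fun s => sliceMap p Λ ι (ρ * s, 0, 0), ?_, ?_, ?_, ?_, ?_, ?_, ?_⟩
  · exact (hΛ.continuousOn_sliceMap hδ).comp (by fun_prop) hmem
  · rw [hzero', hzero]
  · refine ⟨sliceMap p Λ ι '' Metric.ball 0 ρ, hδ.isOpen_image _ hρδ Metric.isOpen_ball, ?_, ?_⟩
    · ext x
      constructor
      · rintro ⟨s, hs, rfl⟩
        refine ⟨⟨_, hball (hscale s hs), rfl⟩, (mk_mem_singularImage_iff h).2 fun hbot => ?_⟩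
        have h4 := (hδ.mem_isotropyAlg _ (hmem s hs) a).2 ⟨ha, hgen ⟨a, ha⟩ _⟩
        rw [hbot, Submodule.mem_bot] at h4
        exact ha0' h4
      · rintro ⟨⟨⟨s, z, w⟩, hn, rfl⟩, hS⟩
        obtain ⟨c, hc, hc0⟩ := Submodule.exists_mem_ne_zero_of_ne_bot
          ((mk_mem_singularImage_iff h).1 hS)
        obtain ⟨hc1, hc2⟩ := (hδ.mem_isotropyAlg _ (hρδ hn) c).1 hc
        obtain ⟨rfl, rfl⟩ := hgen' ⟨c, hc1⟩ s z w (fun h0 => hc0 (congrArg Subtype.val h0)) hc2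
        have hs : |s| < ρ := by
          rw [mem_ball_zero_iff, Prod.norm_def] at hn
          exact (le_max_left _ _).trans_lt hn
        rw [abs_lt] at hs
        refine ⟨s / ρ, ⟨?_, ?_⟩, ?_⟩
        · rw [lt_div_iff₀ hρ.1]; linarith
        · rw [div_lt_iff₀ hρ.1]; linarith
        · simp only [mul_div_cancel₀ s hρ.1.ne']
    · rw [Set.eq_empty_iff_forall_notMem]
      -- Nearby isotropy algebras are contained in that of `p`, so none of them is two-dimensional.
      rintro _ ⟨⟨n, hn, rfl⟩, hW⟩
      have h5 := (mk_mem_vertexSet_iff h).1 hW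
      have h6 : isotropyAlg (slicePoint p Λ ι n) ≤ isotropyAlg p := fun b hb =>
        ((hδ.mem_isotropyAlg n (hρδ hn) b).1 hb).1
      have h7 := Submodule.finrank_mono h6
      omega
  · intro s hs t ht hst
    have h8 : ν (slicePoint p Λ ι (ρ * s, 0, 0)) = ν (slicePoint p Λ ι (ρ * t, 0, 0)) := hst
    have h9 := hmono.injOn (hscale s hs) (hscale t ht) (by simp only [h8])
    exact mul_left_cancel₀ hρ.1.ne' h9
  · intro s hs
    obtain ⟨r, hr⟩ := (hmom s hs).2
    change ν (slicePoint p Λ ι (ρ * s, 0, 0)) - ν p ∈ isotropyAlg p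
    rw [hr, add_sub_cancel_left]
    exact (isotropyAlg p).smul_mem r ha
  · intro s hs
    change isotropyAlg (slicePoint p Λ ι (ρ * s, 0, 0)) = isotropyAlg p
    ext b
    rw [hδ.mem_isotropyAlg _ (hmem s hs)]
    exact ⟨fun hb => hb.1, fun hb => ⟨hb, hgen ⟨b, hb⟩ _⟩⟩
  · intro s hs
    exact (hmom s hs).1

end Edges

/-! ### Vertices -/

section Vertices

variable {M : Type*} [TopologicalSpace M] [ChartedSpace E7 M] [MulAction Torus3 M] {φ : Form 3 M}
  {ν : M → Fin 3 → ℝ} {μ : M → ℝ} {p : M} {G : (ℝ × (Fin 3 → ℂ)) ≃L[ℝ] E7}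
  {α : Fin 3 → isotropyAlg p →ₗ[ℝ] ℝ}

/-- The inclusion of the normal space of an orbit of dimension one. -/
noncomputable def vertexIncl (G : (ℝ × (Fin 3 → ℂ)) ≃L[ℝ] E7) : (Fin 3 → ℂ) →L[ℝ] E7 :=
  (G : (ℝ × (Fin 3 → ℂ)) →L[ℝ] E7).comp (ContinuousLinearMap.inr ℝ ℝ (Fin 3 → ℂ))

theorem vertexIncl_apply (G : (ℝ × (Fin 3 → ℂ)) ≃L[ℝ] E7) (z : Fin 3 → ℂ) :
    vertexIncl G z = G (0, z) := rfl

theorem smul_single_one (i : Fin 3) (r : ℝ) :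
    r • (Pi.single i 1 : Fin 3 → ℂ) = Pi.single i (r : ℂ) := by
  funext j
  by_cases hj : j = i
  · subst hj; simp
  · simp [Pi.single_eq_of_ne hj]

theorem single_mem_ball {i : Fin 3} {r ρ : ℝ} (hr : |r| < ρ) :
    (Pi.single i (r : ℂ) : Fin 3 → ℂ) ∈ Metric.ball 0 ρ := by
  rw [mem_ball_zero_iff, pi_norm_lt_iff ((abs_nonneg r).trans_lt hr)]
  intro j
  by_cases hj : j = i
  · subst hj; simpa using hr
  · simpa [Pi.single_eq_of_ne hj] using (abs_nonneg r).trans_lt hr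

theorem isotropyGen_vertexIncl_single (hG : IsIsotropyFrame φ p G α) (a : isotropyAlg p)
    (i : Fin 3) (r : ℝ) : isotropyGen p (a : Fin 3 → ℝ) (vertexIncl G (Pi.single i (r : ℂ))) =
      (r * α i a) • G (0, Pi.single i Complex.I) := by
  rw [vertexIncl_apply, hG.gen_eq, ← map_smul]
  congr 1
  refine Prod.ext (by simp) (funext fun j => ?_)
  by_cases hj : j = i
  · subst hj
    simp
    ring
  · simp [Pi.single_eq_of_ne hj]

variable [IsManifold (𝓡 7) ∞ M] [ContinuousSMul Torus3 M]

/-- Along each leg of the star, the moment map moves monotonically on a line. -/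
theorem exists_height (hφ : IsG2WithTorusSymmetry φ) (hν : IsMultiMomentPhi φ ν)
    (hμ : IsMultiMomentStar φ μ) (hG : IsIsotropyFrame φ p G α) {ε : ℝ} {Λ : E7 → E7}
    (hΛ : IsLinearization p ε Λ) {δ : ℝ} (hδ : IsSliceRadius p ε Λ (vertexIncl G) δ)
    {b₁ : Fin 3 → ℝ} (h₁ : coordField p (extChartAt (𝓡 7) p p) b₁ = G (1, 0)) (i : Fin 3)
    (a v : isotropyAlg p) (hv : α i v = 0)
    (hpos : 0 < (crossProduct (a : Fin 3 → ℝ) b₁ ⬝ᵥ (v : Fin 3 → ℝ)) * α i a) :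
    ∃ ρ ∈ Ioc 0 δ, ∃ H : ℝ → ℝ, StrictMonoOn H (Ico 0 ρ) ∧ H 0 = 0 ∧ ∀ r ∈ Ico 0 ρ,
      ν (slicePoint p Λ (vertexIncl G) (Pi.single i (r : ℂ))) = ν p + H r • (v : Fin 3 → ℝ) ∧
      μ (slicePoint p Λ (vertexIncl G) (Pi.single i (r : ℂ))) = μ p := by
  have h := hφ.smooth_action
  set ι := vertexIncl G with hι
  set D := crossProduct (a : Fin 3 → ℝ) b₁ ⬝ᵥ (v : Fin 3 → ℝ) with hD
  have hD0 : D ≠ 0 := fun h0 => by rw [h0, zero_mul] at hpos; exact hpos.false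
  have hv0 : (v : Fin 3 → ℝ) ≠ 0 := fun h0 => hD0 (by rw [hD, h0, dotProduct_zero])
  let e : Fin 3 → ℂ := Pi.single i 1
  have he : ∀ r : ℝ, r • e = Pi.single i (r : ℂ) := smul_single_one i
  -- On the `i`-th axis the field of `a` is `r α i a` times the image of the rotation direction.
  -- With this factor removed, the derivative of `(a × b₁) · ν` becomes the continuous function `ψ`,
  -- and `ψ 0 = 1` by the normalisation of the frame.
  let ψ : ℝ → ℝ := fun r => Form.inChart φ p (Λ (ι (r • e)))
    ![fderiv ℝ Λ (ι (r • e)) (G (0, Pi.single i Complex.I)), coordField p (Λ (ι (r • e))) b₁,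
      fderiv ℝ Λ (ι (r • e)) (ι e)]
  have hψc : ContinuousAt ψ 0 := continuousAt_inChart_apply hφ.smooth (by
        rw [zero_smul, map_zero, hΛ.map_zero]; exact mem_extChartAt_target p)
      (continuousAt_slice_lambda hΛ ι _) (continuousAt_slice_fderiv hΛ ι _ _)
      (continuousAt_slice_coordField h hΛ ι _ _) (continuousAt_slice_fderiv hΛ ι _ _)
  have hψ0 : 0 < ψ 0 := by
    have : ψ 0 = 1 := by
      simp only [ψ]
      rw [zero_smul, map_zero, hΛ.map_zero, hΛ.fderiv_zero, h₁, ContinuousLinearMap.id_apply,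
        ContinuousLinearMap.id_apply]
      exact hG.form_eq' i
    rw [this]; exact zero_lt_one
  obtain ⟨η, hη, hball⟩ := Metric.eventually_nhds_iff_ball.1 (hψc.eventually (lt_mem_nhds hψ0))
  let k : ℝ → ℝ := fun r => crossProduct (a : Fin 3 → ℝ) b₁ ⬝ᵥ ν (slicePoint p Λ ι (r • e))
  have hmem : ∀ r ∈ Ico 0 (min η δ), r • e ∈ Metric.ball (0 : Fin 3 → ℂ) δ := fun r hr => by
    rw [he]
    refine single_mem_ball ?_
    rw [abs_of_nonneg hr.1]
    exact hr.2.trans_le (min_le_right _ _)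
  have hk : ∀ r ∈ Ico 0 (min η δ), HasDerivAt k (r * α i a * ψ r) r := fun r hr => by
    have h2 := hasDerivAt_nu_slice h hν hΛ ι e a b₁ (hδ.mem_ball _ (hmem r hr))
    rw [hΛ.coordField_eq h a.2 (hδ.mem_ball _ (hmem r hr)), he, hι,
      isotropyGen_vertexIncl_single hG, map_smul, alternating_vec_smul, ← hι, ← he] at h2
    exact h2
  have hmom := fun r hr => moment_eq_on_slice h hν hμ hΛ hδ (hmem r hr) v.2 hv0 (by
    rw [he, hι, isotropyGen_vertexIncl_single hG, hv, mul_zero, zero_smul])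
  refine ⟨min η δ, ⟨lt_min hη hδ.pos, min_le_right _ _⟩, fun r => (k r - k 0) / D, ?_, by simp,
    fun r hr => ⟨?_, ?_⟩⟩
  · refine strictMonoOn_of_deriv_pos (convex_Ico _ _)
      (fun r hr => ((hk r hr).continuousAt.continuousWithinAt.sub
        continuousWithinAt_const).div_const D) fun r hr => ?_
    rw [interior_Ico] at hr
    rw [(((hk r ⟨hr.1.le, hr.2⟩).sub_const (k 0)).div_const D).deriv]
    have hψr : 0 < ψ r := hball r (by
      rw [Real.ball_eq_Ioo, zero_sub, zero_add]
      exact ⟨by linarith [hr.1], hr.2.trans_le (min_le_left _ _)⟩)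
    -- Dividing by `D = (a × b₁) · v` turns the change of `(a × b₁) · ν` into the coefficient of
    -- `v`. The hypothesis that `D * α i a` is positive makes that coefficient increase with `r`,
    -- although its derivative vanishes at `r = 0`.
    have h3 : r * α i a * ψ r / D = r * ψ r * (D * α i a) / D ^ 2 := by field_simp
    rw [h3]
    exact div_pos (mul_pos (mul_pos hr.1 hψr) hpos) (by positivity)
  · obtain ⟨t, ht⟩ := (hmom r hr).2
    have h4 : k r - k 0 = t * D := by
      simp only [k]
      rw [ht, zero_smul, hΛ.slicePoint_zero, dotProduct_add, dotProduct_smul, smul_eq_mul,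
        add_sub_cancel_left]
    simp only [h4, mul_div_cancel_right₀ _ hD0]
    rw [← he, ht]
  · rw [← he]
    exact (hmom r hr).1

/-- The stabiliser acts linearly on the slice, by phases in the frame, without changing orbits. It
is used to make the only nonzero coordinate of a singular slice vector real and nonnegative. -/
theorem sliceMap_rotate (h : IsSmoothAction M) (hG : IsIsotropyFrame φ p G α) {ε : ℝ}
    {Λ : E7 → E7} (hΛ : IsLinearization p ε Λ) {δ : ℝ}
    (hδ : IsSliceRadius p ε Λ (vertexIncl G) δ) {z : Fin 3 → ℂ}
    (hz : z ∈ Metric.ball (0 : Fin 3 → ℂ) δ) (a : isotropyAlg p) :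
    sliceMap p Λ (vertexIncl G) (fun j => Complex.exp (Complex.I * α j a) * z j) =
      sliceMap p Λ (vertexIncl G) z := by
  have hz' : (fun j => Complex.exp (Complex.I * α j a) * z j) ∈ Metric.ball (0 : Fin 3 → ℂ) δ := by
    rw [mem_ball_zero_iff, pi_norm_lt_iff hδ.pos] at hz ⊢
    intro j
    rw [norm_mul, mul_comm Complex.I, Complex.norm_exp_ofReal_mul_I, one_mul]
    exact hz j
  have hg := expT_smul_of_mem h a.2
  have hrep : isotropyRep p (expT (a : Fin 3 → ℝ)) (vertexIncl G z) =
      vertexIncl G (fun j => Complex.exp (Complex.I * α j a) * z j) := hG.rep_eq h a 0 z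
  have h1 := hΛ.equivariant _ hg _ (hδ.mem_ball z hz) (by rw [hrep]; exact hδ.mem_ball _ hz')
  have h2 := symm_coordAct (hΛ.mem_coordDom _ hg _ (hδ.mem_ball z hz))
  rw [h1, hrep] at h2
  exact Quotient.sound ⟨expT (a : Fin 3 → ℝ), h2.symm⟩

variable [T2Space M] [ConnectedSpace M]

theorem eq_zero_of_two_weights (hφ : IsG2WithTorusSymmetry φ) (hG : IsIsotropyFrame φ p G α)
    {i j : Fin 3} (hij : i ≠ j) {a : isotropyAlg p} (hi : α i a = 0) (hj : α j a = 0) : a = 0 := by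
  have h := hG.sum_apply a
  refine hG.eq_zero hφ fun k => ?_
  fin_cases i <;> fin_cases j <;> fin_cases k <;> simp at hij hi hj h ⊢ <;> linarith

/-- The slope vectors at a vertex, with vectors that detect their orientation. -/
theorem exists_vertex_vectors (hφ : IsG2WithTorusSymmetry φ) (hG : IsIsotropyFrame φ p G α)
    (hp : finrank ℝ (isotropyAlg p) = 2) {b₁ : Fin 3 → ℝ}
    (h₁ : coordField p (extChartAt (𝓡 7) p p) b₁ = G (1, 0)) :
    ∃ a v : Fin 3 → isotropyAlg p, ∑ i, v i = 0 ∧ (∀ i, α i (v i) = 0) ∧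
      (∀ i j, i ≠ j → α j (v i) ≠ 0) ∧ (∀ i j, ∃ n : ℤ, α j (v i) = n) ∧
      (∀ i, ∃ j, α j (v i) = 1) ∧
      ∀ i, 0 < (crossProduct (a i : Fin 3 → ℝ) b₁ ⬝ᵥ (v i : Fin 3 → ℝ)) * α i (a i) := by
  have hinj := hG.injective_prod hφ
  have hsurj := (LinearMap.injective_iff_surjective_of_finrank_eq_finrank
    (f := (α 0).prod (α 1)) (by simpa using hp)).1 hinj
  obtain ⟨f₁, hf₁⟩ := hsurj (1, 0)
  obtain ⟨f₂, hf₂⟩ := hsurj (0, 1)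
  have e10 : α 0 f₁ = 1 := congrArg Prod.fst hf₁
  have e11 : α 1 f₁ = 0 := congrArg Prod.snd hf₁
  have e20 : α 0 f₂ = 0 := congrArg Prod.fst hf₂
  have e21 : α 1 f₂ = 1 := congrArg Prod.snd hf₂
  have e12 : α 2 f₁ = -1 := by have := hG.sum_apply f₁; linarith
  have e22 : α 2 f₂ = -1 := by have := hG.sum_apply f₂; linarith
  -- Up to sign the determinant of `f₁, f₂, b₁`. It does not vanish: `f₁, f₂` are a basis of the
  -- isotropy algebra dual to two weights, while `b₁` generates a nonzero orbit direction.
  set D := crossProduct (f₁ : Fin 3 → ℝ) b₁ ⬝ᵥ (f₂ : Fin 3 → ℝ) with hD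
  have hD0 : D ≠ 0 := by
    intro h0
    rw [hD, dotProduct_comm, triple_product_eq_det] at h0
    obtain ⟨c, hc0, hc⟩ := Matrix.exists_vecMul_eq_zero_iff.2 h0
    have hc' : c 0 • (f₂ : Fin 3 → ℝ) + c 1 • (f₁ : Fin 3 → ℝ) + c 2 • b₁ = 0 := by
      rw [← hc]
      funext j
      simp [Matrix.vecMul, dotProduct, Fin.sum_univ_three]
    have k1 : ∀ a : isotropyAlg p, coordField p (extChartAt (𝓡 7) p p) (a : Fin 3 → ℝ) = 0 :=
      fun a => (infAct_eq_zero_iff hφ.smooth_action p a).1 a.2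
    have k2 := congrArg (coordField p (extChartAt (𝓡 7) p p)) hc'
    rw [map_add, map_add, map_smul, map_smul, map_smul, k1, k1, h₁, map_zero, smul_zero, smul_zero,
      zero_add, zero_add, ← map_smul, map_eq_zero_iff G G.injective] at k2
    have c2 : c 2 = 0 := by simpa using congrArg Prod.fst k2
    rw [c2, zero_smul, add_zero] at hc'
    have k3 : c 0 • f₂ + c 1 • f₁ = 0 := Subtype.ext hc'
    have c0 := congrArg (α 1) k3
    have c1 := congrArg (α 0) k3
    simp only [map_add, map_smul, e10, e11, e20, e21, smul_eq_mul, map_zero] at c0 c1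
    refine hc0 (funext fun j => ?_)
    fin_cases j
    · change c 0 = 0; linarith
    · change c 1 = 0; linarith
    · exact c2
  have hD' : crossProduct (f₂ : Fin 3 → ℝ) b₁ ⬝ᵥ (f₁ : Fin 3 → ℝ) = -D := by
    simp only [hD, cross_apply, dotProduct, Fin.sum_univ_three, Matrix.cons_val_zero,
      Matrix.cons_val_one, Matrix.cons_val]
    ring
  have hD1 : crossProduct (f₁ : Fin 3 → ℝ) b₁ ⬝ᵥ (f₁ : Fin 3 → ℝ) = 0 := by
    rw [dotProduct_comm, dot_self_cross]
  -- The three kernel generators are fixed by sum zero and weights in `{0, 1, -1}` up to one common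
  -- sign; the sign of `D` decides which choice points away from the vertex on all three legs
  -- simultaneously.
  rcases hD0.lt_or_gt with hneg | hpos
  · refine ⟨![f₁, f₂, f₁], ![-f₂, f₁, f₂ - f₁], ?_, ?_, ?_, ?_, ?_, ?_⟩
    · simp [Fin.sum_univ_three]
    · intro i; fin_cases i <;> simp [e11, e12, e20, e22]
    · intro i j hij
      fin_cases i <;> fin_cases j <;>
        first | exact absurd rfl hij | simp [e10, e11, e12, e20, e21, e22]
    · intro i j
      fin_cases i <;> fin_cases j <;> simp [e10, e11, e12, e20, e21, e22]
      all_goals first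
        | (refine ⟨0, ?_⟩; norm_num; done)
        | (refine ⟨1, ?_⟩; norm_num; done)
        | (refine ⟨-1, ?_⟩; norm_num)
    · intro i
      fin_cases i
      · exact ⟨2, by simp [e22]⟩
      · exact ⟨0, by simp [e10]⟩
      · exact ⟨1, by simp [e21, e11]⟩
    · intro i
      fin_cases i
      · simpa [e10, ← hD] using hneg
      · simpa [e21, hD'] using hneg
      · simpa [e12, dotProduct_sub, ← hD, hD1] using hneg
  · refine ⟨![f₁, f₂, f₁], ![f₂, -f₁, f₁ - f₂], ?_, ?_, ?_, ?_, ?_, ?_⟩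
    · simp only [Fin.sum_univ_three, Matrix.cons_val_zero, Matrix.cons_val_one, Matrix.cons_val]
      abel
    · intro i; fin_cases i <;> simp [e11, e12, e20, e22]
    · intro i j hij
      fin_cases i <;> fin_cases j <;>
        first | exact absurd rfl hij | simp [e10, e11, e12, e20, e21, e22]
    · intro i j
      fin_cases i <;> fin_cases j <;> simp [e10, e11, e12, e20, e21, e22]
      all_goals first
        | (refine ⟨0, ?_⟩; norm_num; done)
        | (refine ⟨1, ?_⟩; norm_num; done)
        | (refine ⟨-1, ?_⟩; norm_num)
    · intro i
      fin_cases i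
      · exact ⟨1, by simp [e21]⟩
      · exact ⟨2, by simp [e12]⟩
      · exact ⟨0, by simp [e10, e20]⟩
    · intro i
      fin_cases i
      · simpa [e10, ← hD] using hpos
      · simpa [e21, hD'] using hpos
      · simpa [e12, dotProduct_sub, ← hD, hD1] using hpos

end Vertices

/-! ### The tripod of singular orbits around a vertex -/

section Stars

variable {M : Type*} [TopologicalSpace M] [ChartedSpace E7 M] [MulAction Torus3 M]
  [IsManifold (𝓡 7) ∞ M] [ContinuousSMul Torus3 M] [T2Space M] [ConnectedSpace M] {φ : Form 3 M}
  {ν : M → Fin 3 → ℝ} {μ : M → ℝ} {p : M}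

theorem exists_isVertexStar (hφ : IsG2WithTorusSymmetry φ) (hν : IsMultiMomentPhi φ ν)
    (hμ : IsMultiMomentStar φ μ) (hp : finrank ℝ (isotropyAlg p) = 2) :
    ∃ σ v H, IsVertexStar (singularImage M) (vertexSet M) (orbitLift ν hν.invariant)
      (orbitLift isotropyAlg (isotropyAlg_smul hφ.smooth_action)) (orbitLift μ hμ.invariant)
      (Quotient.mk (MulAction.orbitRel Torus3 M) p) σ v H := by
  have h := hφ.smooth_action
  obtain ⟨G, α, b₁, hG, h₁, hb⟩ := exists_vertex_frame hφ hp
  obtain ⟨ε, Λ, hΛ⟩ := exists_isLinearization h p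
  obtain ⟨δ, hδ⟩ := hΛ.exists_isSliceRadius h (isSlice_vertex hG h₁ hb)
  change IsSliceRadius p ε Λ (vertexIncl G) δ at hδ
  set ι := vertexIncl G with hιdef
  obtain ⟨a, v, hsum, hv0, hvne, hvint, hvone, hpos⟩ := exists_vertex_vectors hφ hG hp h₁
  have hprim : ∀ i, ∃ w, IsPrimitive w ∧ (v i : Fin 3 → ℝ) = realVec w := fun i => by
    obtain ⟨j, hj⟩ := hvone i
    exact hG.exists_isPrimitive hφ (hvint i) hj
  choose w hwprim hw using hprim
  have hheight := fun i => exists_height hφ hν hμ hG hΛ hδ h₁ i (a i) (v i) (hv0 i) (hpos i)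
  choose ρ hρ H hHmono hH0 hHν using hheight
  have hgen : ∀ (c : isotropyAlg p) z, isotropyGen p (c : Fin 3 → ℝ) (ι z) = 0 ↔
      ∀ j, α j c = 0 ∨ z j = 0 := fun c z => hG.gen_eq_zero_iff c 0 z
  obtain ⟨η, hη0, hη⟩ : ∃ η > 0, ∀ i, η < ρ i := by
    refine ⟨min (ρ 0) (min (ρ 1) (ρ 2)) / 2, ?_, fun i => ?_⟩
    · have := (hρ 0).1; have := (hρ 1).1; have := (hρ 2).1
      positivity
    · have h0 : 0 < min (ρ 0) (min (ρ 1) (ρ 2)) :=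
        lt_min (hρ 0).1 (lt_min (hρ 1).1 (hρ 2).1)
      have h1 : min (ρ 0) (min (ρ 1) (ρ 2)) ≤ ρ i := by
        fin_cases i
        · exact min_le_left _ _
        · exact (min_le_right _ _).trans (min_le_left _ _)
        · exact (min_le_right _ _).trans (min_le_right _ _)
      linarith
  have hηδ : η < δ := (hη 0).trans_le (hρ 0).2
  have hball : Metric.ball (0 : Fin 3 → ℂ) η ⊆ Metric.ball 0 δ := Metric.ball_subset_ball hηδ.le
  -- The cube is scaled by `η`, strictly smaller than every `ρ i`, so that the closed legs, end
  -- points included, stay where the heights are controlled.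
  let z : (Fin 3 → ℝ) → Fin 3 → ℂ := fun x j => ((η * x j : ℝ) : ℂ)
  have hzsingle : ∀ i s, z (Pi.single i s) = Pi.single i ((η * s : ℝ) : ℂ) := fun i s => by
    funext j
    by_cases hj : j = i
    · subst hj; simp [z]
    · simp [z, Pi.single_eq_of_ne hj]
  have hzmem : ∀ i, ∀ s ∈ Icc (0 : ℝ) 1, z (Pi.single i s) ∈ Metric.ball 0 δ := fun i s hs => by
    rw [hzsingle]
    refine single_mem_ball ?_
    rw [abs_of_nonneg (mul_nonneg hη0.le hs.1)]
    exact (mul_le_of_le_one_right hη0.le hs.2).trans_lt hηδ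
  have hscale : ∀ i, ∀ s ∈ Icc (0 : ℝ) 1, η * s ∈ Ico 0 (ρ i) := fun i s hs =>
    ⟨mul_nonneg hη0.le hs.1, (mul_le_of_le_one_right hη0.le hs.2).trans_lt (hη i)⟩
  have hzero : sliceMap p Λ ι 0 = Quotient.mk (MulAction.orbitRel Torus3 M) p := by
    rw [sliceMap, hΛ.slicePoint_zero]
  have hz0 : z 0 = 0 := by funext j; simp [z]
  have hvgen : ∀ i s, isotropyGen p (v i : Fin 3 → ℝ) (ι (z (Pi.single i s))) = 0 := by
    intro i s
    rw [hgen]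
    intro j
    by_cases hj : j = i
    · subst hj; exact Or.inl (hv0 j)
    · right; rw [hzsingle, Pi.single_eq_of_ne hj]
  have hvne0 : ∀ i, (v i : Fin 3 → ℝ) ≠ 0 := fun i => by
    rw [hw]; exact realVec_ne_zero (hwprim i)
  refine ⟨fun x => sliceMap p Λ ι (z x), w, fun i s => H i (η * s), ?_, ?_, ?_, hwprim, ?_, ?_,
    ?_, ?_, ?_, ?_, ?_⟩
  · refine (hΛ.continuousOn_sliceMap hδ).comp (by fun_prop) fun x hx => ?_
    rw [mem_ball_zero_iff, pi_norm_lt_iff hδ.pos]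
    intro j
    rw [Complex.norm_real, Real.norm_eq_abs, abs_of_nonneg (mul_nonneg hη0.le (hx.1 j))]
    exact (mul_le_of_le_one_right hη0.le (hx.2 j)).trans_lt hηδ
  · rw [hz0, hzero]
  · refine ⟨sliceMap p Λ ι '' Metric.ball 0 η, hδ.isOpen_image _ hball Metric.isOpen_ball, ?_, ?_⟩
    · ext x
      constructor
      · rintro ⟨x, hx, rfl⟩
        obtain ⟨i, s, hs, rfl⟩ := exists_eq_single_of_mem_tripod hx
        refine ⟨⟨_, ?_, rfl⟩, (mk_mem_singularImage_iff h).2 fun hbot => ?_⟩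
        · rw [hzsingle]
          refine single_mem_ball ?_
          rw [abs_of_nonneg (mul_nonneg hη0.le hs.1)]
          exact mul_lt_of_lt_one_right hη0 hs.2
        · have h2 := (hδ.mem_isotropyAlg _ (hzmem i s ⟨hs.1, hs.2.le⟩) (v i)).2 ⟨(v i).2, hvgen i s⟩
          rw [hbot, Submodule.mem_bot] at h2
          exact hvne0 i h2
      · rintro ⟨⟨y, hy, rfl⟩, hS⟩
        obtain ⟨c, hc, hc0⟩ := Submodule.exists_mem_ne_zero_of_ne_bot
          ((mk_mem_singularImage_iff h).1 hS)
        obtain ⟨hc1, hc2⟩ := (hδ.mem_isotropyAlg _ (hball hy) c).1 hc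
        have hc3 := (hgen ⟨c, hc1⟩ y).1 hc2
        have hc4 : (⟨c, hc1⟩ : isotropyAlg p) ≠ 0 := fun h0 => hc0 (congrArg Subtype.val h0)
        -- Two nonzero coordinates would make two weights of `c` vanish, hence all three,
        -- contradicting faithfulness. Singular slice vectors thus lie on the coordinate axes.
        have hy2 : ∀ j k, j ≠ k → y j = 0 ∨ y k = 0 := by
          intro j k hjk
          by_contra! hcon
          exact hc4 (eq_zero_of_two_weights hφ hG hjk ((hc3 j).resolve_right hcon.1)
            ((hc3 k).resolve_right hcon.2))
        obtain ⟨l, hl⟩ : ∃ l, ∀ j, j ≠ l → y j = 0 := by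
          by_cases h0 : ∃ l, y l ≠ 0
          · obtain ⟨l, hl⟩ := h0
            exact ⟨l, fun j hj => (hy2 j l hj).resolve_right hl⟩
          · push Not at h0
            exact ⟨0, fun j _ => h0 j⟩
        obtain ⟨k, hk⟩ : ∃ k : Fin 3, k ≠ l := exists_ne l
        -- An element whose `l`-th weight is minus the argument of `y l`: it rotates that coordinate
        -- to its modulus. Such an element exists because `v k` has nonzero `l`-th weight for `k ≠
        -- l`.
        let d : isotropyAlg p := (-(y l).arg / α l (v k)) • v k
        have hd : α l d = -(y l).arg := by
          simp only [d, map_smul, smul_eq_mul]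
          exact div_mul_cancel₀ _ (hvne k l hk)
        have hrot := sliceMap_rotate h hG hΛ hδ (hball hy) d
        have hyl : ‖y l‖ < η := by
          rw [mem_ball_zero_iff, pi_norm_lt_iff hη0] at hy
          exact hy l
        refine ⟨Pi.single l (‖y l‖ / η), single_mem_tripod l
          ⟨by positivity, (div_lt_one hη0).2 hyl⟩, ?_⟩
        rw [← hrot]
        simp only [hzsingle, mul_div_cancel₀ _ hη0.ne']
        congr 1
        funext j
        by_cases hj : j = l
        · subst hj
          rw [Pi.single_eq_same, hd]
          have h5 : Complex.I * ((-(y j).arg : ℝ) : ℂ) + (y j).arg * Complex.I = 0 := by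
            push_cast; ring
          have h6 := congrArg (Complex.exp (Complex.I * ((-(y j).arg : ℝ) : ℂ)) * ·)
            (Complex.norm_mul_exp_arg_mul_I (y j))
          rw [← h6, mul_left_comm, ← Complex.exp_add, h5, Complex.exp_zero, mul_one]
        · rw [Pi.single_eq_of_ne hj, hl j hj, mul_zero]
    · ext x
      constructor
      · rintro ⟨⟨y, hy, rfl⟩, hW⟩
        have h5 := (mk_mem_vertexSet_iff h).1 hW
        have h6 : isotropyAlg (slicePoint p Λ ι y) ≤ isotropyAlg p := fun b hb =>
          ((hδ.mem_isotropyAlg y (hball hy) b).1 hb).1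
        -- A second vertex in the ball would have the full isotropy algebra of `p`, so each of its
        -- coordinates would be killed by a nonzero weight and it would be the centre.
        have h7 := Submodule.eq_of_le_of_finrank_eq h6 (h5.trans hp.symm)
        have h8 : y = 0 := by
          funext j
          obtain ⟨k, hk⟩ : ∃ k : Fin 3, k ≠ j := exists_ne j
          have h9 : (v k : Fin 3 → ℝ) ∈ isotropyAlg (slicePoint p Λ ι y) := by
            rw [h7]; exact (v k).2
          have h10 := (hgen (v k) y).1 ((hδ.mem_isotropyAlg y (hball hy) (v k)).1 h9).2 j
          exact h10.resolve_left (hvne k j hk)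
        rw [h8, hzero]
        exact mem_singleton _
      · rintro rfl
        exact ⟨⟨0, Metric.mem_ball_self hη0, hzero⟩, (mk_mem_vertexSet_iff h).2 hp⟩
  · have h2 := congrArg (Subtype.val) hsum
    rw [Submodule.coe_sum] at h2
    funext j
    have h3 := congrFun h2 j
    simp only [Finset.sum_apply, hw, realVec] at h3
    rw [Finset.sum_apply]
    have h4 : ((∑ i, w i j : ℤ) : ℝ) = 0 := by rw [Int.cast_sum]; exact h3
    exact_mod_cast h4
  · intro i j hij x y hxy
    rw [← hw, ← hw] at hxy
    have h2 : x • v i = y • v j := Subtype.ext hxy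
    have h3 := congrArg (α j) h2
    have h4 := congrArg (α i) h2
    rw [map_smul, map_smul, hv0, smul_zero, smul_eq_mul] at h3 h4
    exact ⟨(mul_eq_zero.1 h3).resolve_right (hvne i j hij),
      (mul_eq_zero.1 h4.symm).resolve_right (hvne j i hij.symm)⟩
  · intro i s hs t ht hst
    exact hHmono i (hscale i s hs) (hscale i t ht) (mul_lt_mul_of_pos_left hst hη0)
  · intro i
    simp only [mul_zero, hH0]
  · intro i s hs
    change ν (slicePoint p Λ ι (z (Pi.single i s))) = ν p + _
    rw [hzsingle, (hHν i _ (hscale i s hs)).1, hw]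
  · intro i s hs
    change isotropyAlg (slicePoint p Λ ι (z (Pi.single i s))) = _
    have hs' : s ∈ Icc (0 : ℝ) 1 := ⟨hs.1.le, hs.2.le⟩
    refine le_antisymm (fun c hc => ?_) ?_
    · obtain ⟨hc1, hc2⟩ := (hδ.mem_isotropyAlg _ (hzmem i s hs') c).1 hc
      have h2 : α i ⟨c, hc1⟩ = 0 := by
        refine ((hgen ⟨c, hc1⟩ _).1 hc2 i).resolve_right ?_
        rw [hzsingle, Pi.single_eq_same]
        exact Complex.ofReal_ne_zero.2 (mul_pos hη0 hs.1).ne'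
      obtain ⟨k, hk⟩ : ∃ k : Fin 3, k ≠ i := exists_ne i
      have h3 : (⟨c, hc1⟩ : isotropyAlg p) - (α k ⟨c, hc1⟩ / α k (v i)) • v i = 0 := by
        refine eq_zero_of_two_weights hφ hG hk ?_ ?_
        · rw [map_sub, map_smul, smul_eq_mul, div_mul_cancel₀ _ (hvne i k hk.symm), sub_self]
        · rw [map_sub, map_smul, h2, hv0, smul_zero, sub_self]
      refine Submodule.mem_span_singleton.2 ⟨α k ⟨c, hc1⟩ / α k (v i), ?_⟩
      rw [← hw]
      exact (congrArg Subtype.val (sub_eq_zero.1 h3)).symm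
    · rw [Submodule.span_singleton_le_iff_mem, ← hw]
      exact (hδ.mem_isotropyAlg _ (hzmem i s hs') _).2 ⟨(v i).2, hvgen i s⟩
  · intro i s hs
    change μ (slicePoint p Λ ι (z (Pi.single i s))) = μ p
    rw [hzsingle]
    exact (hHν i _ (hscale i s hs)).2

end Stars

end ToricG2

/-! ### Assembly of the theorem -/

theorem mainTheorem5 {M : Type*} [TopologicalSpace M] [ChartedSpace E7 M]
    [IsManifold (𝓡 7) ∞ M] [T2Space M] [SecondCountableTopology M] [ConnectedSpace M]
    [MulAction Torus3 M] (φ : Form 3 M) (hφ : IsG2WithTorusSymmetry φ)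
    (ν : M → Fin 3 → ℝ) (hν : IsMultiMomentPhi φ ν)
    (μ : M → ℝ) (hμ : IsMultiMomentStar φ μ) :
    -- the Gram matrix at singular points
    (∀ p ∉ regularSet M, (gram φ p).rank ≤ 2) ∧
    -- the image of the singular orbits is a trivalent graph
    IsTrivalentGraph (singularImage M) (vertexSet M) ∧
    -- each component of the graph lies in a set where `μ` is constant
    (∀ x ∈ singularImage M, ∀ y ∈ connectedComponentIn (singularImage M) x,
      orbitLift μ hμ.invariant y = orbitLift μ hμ.invariant x) ∧
    -- edges are straight lines of rational slope in the `ν`-coordinates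
    (∀ e, IsEdge (singularImage M) (vertexSet M) e →
      ∃ (a : Fin 3 → ℝ) (v : Fin 3 → ℤ) (J : Set ℝ), IsPrimitive v ∧
        IsOpen J ∧ J.OrdConnected ∧ J.Nonempty ∧
        MapsOntoSegment (orbitLift ν hν.invariant) e a v J) ∧
    -- at each vertex there are three edges, whose primitive slope vectors, directed away from
    -- the vertex, sum to zero; in particular these edges lie in a plane
    (∀ w ∈ vertexSet M, ∃ (e : Fin 3 → Set (OrbitSpace M)) (v : Fin 3 → Fin 3 → ℤ),
      Function.Injective e ∧
      (∀ e', (IsEdge (singularImage M) (vertexSet M) e' ∧ w ∈ closure e') ↔ ∃ i, e' = e i) ∧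
      (∀ i, IsPrimitive (v i)) ∧
      (∀ i, ∃ J : Set ℝ, IsOpen J ∧ J.OrdConnected ∧ J.Nonempty ∧ IsGLB J 0 ∧
        MapsOntoSegment (orbitLift ν hν.invariant) (e i) (orbitLift ν hν.invariant w) (v i) J) ∧
      ∑ i, v i = 0 ∧
      ∃ P : AffineSubspace ℝ (Fin 3 → ℝ), Module.finrank ℝ P.direction = 2 ∧
        ∀ i, orbitLift ν hν.invariant '' e i ⊆ P) := by
  have h := hφ.smooth_action
  have hcs := continuousSMul_of_isSmoothAction h
  have hT2 := t2Space_orbitSpace h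
  have hcont : ∀ {X : Type} [TopologicalSpace X] (f : M → X) (hf : Continuous f)
      (hinv : ∀ (a : Torus3) (p : M), f (a • p) = f p), Continuous (orbitLift f hinv) :=
    fun f hf hinv => hf.quotient_lift _
  have hνc := hcont ν hν.smooth.continuous hν.invariant
  have hone : ∀ p : M, Quotient.mk (MulAction.orbitRel Torus3 M) p ∈
      singularImage M \ vertexSet M → Module.finrank ℝ (isotropyAlg p) = 1 := by
    rintro p ⟨hS, hW⟩
    have h1 := finrank_isotropyAlg_le_two hφ p
    have h2 : Module.finrank ℝ (isotropyAlg p) ≠ 0 := fun h0 =>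
      (mk_mem_singularImage_iff h).1 hS (Submodule.finrank_eq_zero.1 h0)
    have h3 : Module.finrank ℝ (isotropyAlg p) ≠ 2 := fun h0 => hW ((mk_mem_vertexSet_iff h).2 h0)
    omega
  -- The isotropy algebra as a function on the orbit space supplies the directions of the edges.
  let κ : OrbitSpace M → Submodule ℝ (Fin 3 → ℝ) := orbitLift isotropyAlg (isotropyAlg_smul h)
  have hκ : ∀ x ∈ singularImage M \ vertexSet M, ∃ v : Fin 3 → ℤ, IsPrimitive v ∧
      κ x = Submodule.span ℝ {realVec v} := by
    rintro ⟨p⟩ hx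
    exact (exists_isEdgeArc hφ hν hμ (hone p hx)).1
  have hE : ∀ x ∈ singularImage M \ vertexSet M, ∃ τ, IsEdgeArc (singularImage M) (vertexSet M)
      (orbitLift ν hν.invariant) κ (orbitLift μ hμ.invariant) x τ := by
    rintro ⟨p⟩ hx
    exact (exists_isEdgeArc hφ hν hμ (hone p hx)).2
  have hV : ∀ w ∈ vertexSet M, ∃ σ v H, IsVertexStar (singularImage M) (vertexSet M)
      (orbitLift ν hν.invariant) κ (orbitLift μ hμ.invariant) w σ v H := by
    rintro ⟨p⟩ hx
    exact exists_isVertexStar hφ hν hμ ((mk_mem_vertexSet_iff h).1 hx)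
  refine ⟨fun p hp => gram_rank_le φ hp,
    isTrivalentGraph_of_localData (isClosed_singularImage h) (vertexSet_subset_singularImage h)
      hνc hκ hE hV,
    mu_eq_of_localData hE hV, edges_straight_of_localData hνc hκ hE, fun w hw => ?_⟩
  obtain ⟨σ, v, H, hσ⟩ := hV w hw
  obtain ⟨e, he, hiff, hseg, hplane⟩ := vertex_edges_of_localData hνc hE hσ
  exact ⟨e, v, he, hiff, hσ.primitive, hseg, hσ.sum_eq_zero, hplane⟩
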